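/- There is an absolute constant $A>0$ with the following property. Let $n\ge 3$, let $d_1,\dots,d_{n-1}\ge 1$ be integers with $d:=\max_i d_i\ge 2$, put $N_i:=\binom{n+d_i-1}{d_i}$ and $N:=\sum_{i=1}^{n-1}N_i$. For $i=1,\dots,n-1$ let $C_i=(c_{i,\alpha})_{\alpha_1+\cdots+\alpha_n=d_i}$ be independent random vectors in $\mathbb{R}^{N_i}$ for which there are constants $K,c_0>0$ such that for every $i$: 1. (Centering) $\mathbb{E}\langle C_i,\theta\rangle=0$ for every $\theta\in S^{N_i-1}$; 2. (Sub-Gaussian) $\mathrm{Prob}(|\langle C_i,\theta\rangle|\ge t)\le 2e^{-t^2/K^2}$ for every $\theta\in S^{N_i-1}$ and every $t>0$; 3. (Small Ball) $\mathrm{Prob}(|\langle a,C_i\rangle|\le \varepsilon\|a\|_2)\le c_0\varepsilon$ for every nonzero $a\in\mathbb{R}^{N_i}$ and every $\varepsilon>0$. Let $P=(p_1,\dots,p_{n-1})$ be the random system of homogeneous polynomials $p_i(x)=\sum_{\alpha_1+\cdots+\alpha_n=d_i}\sqrt{\binom{d_i}{\alpha}}\,c_{i,\alpha}x^\alpha$,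 where $\binom{d_i}{\alpha}=\frac{d_i!}{\alpha_1!\cdots\alpha_n!}$. Here the condition number for real solving of a system $P=(p_1,\dots,p_{n-1})$ of homogeneous polynomials in $\mathbb{R}[x_1,\dots,x_n]$ of degrees $d_1,\dots,d_{n-1}$ is defined as follows. If $b_{i,\alpha}$ is the coefficient of $x^\alpha$ in $p_i$, let $\|P\|_W:=\big(\sum_{i}\sum_{\alpha}|b_{i,\alpha}|^2/\binom{d_i}{\alpha}\big)^{1/2}$. For $x$ in the unit sphere $S^{n-1}\subset\mathbb{R}^n$ let $D_xP$ be the restriction of the derivative $DP(x)$ to the tangent space $T_xS^{n-1}=x^\perp$, let $\Delta$ be the diagonal matrix with entries $\sqrt{d_1},\dots,\sqrt{d_{n-1}}$, and put $\tilde\mu_{\mathrm{norm}}(P,x):=\|P\|_W\,\sigma_{\max}\big((D_xP)^{-1}\Delta\big)$ if $D_xP$ is invertible and $\tilde\mu_{\mathrm{norm}}(P,x):=\infty$ otherwise, where $\sigma_{\max}$ is the largest singular value. Then $$\tilde\kappa(P,x):=\frac{\|P\|_W}{\sqrt{\|P\|_W^2\,\tilde\mu_{\mathrm{norm}}(P,x)^{-2}+\|P(x)\|_2^2}}\in[0,\infty],\qquad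 \tilde\kappa(P):=\sup_{x\in S^{n-1}}\tilde\kappa(P,x),$$ where $\infty^{-2}=0$, the quotient is $\infty$ if $P\neq 0$ and its denominator vanishes, and $\tilde\kappa(P,x):=0$ if $P=0$. Put $M:=A\sqrt{N}\,(Kc_0)^{2(n-1)}\,(3d^2\log(ed))^{2n-3}\,\sqrt{n}$. Then: 1. $$\mathrm{Prob}\big(\tilde\kappa(P)\ge tM\big)\le\begin{cases}3t^{-1/2} & \text{if } 1\le t\le (ed)^{2(n-1)},\\[2pt] 3t^{-1/2}\left(\dfrac{t}{(ed)^{2(n-1)}}\right)^{\frac{1}{4\log(ed)}} & \text{if } t\ge (ed)^{2(n-1)}.\end{cases}$$ 2. Almost surely $0<\tilde\kappa(P)<\infty$, the random variable $\log\tilde\kappa(P)$ is integrable, and $\mathbb{E}\log\tilde\kappa(P)\le 1+\log M$. -/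

import Mathlib

open MeasureTheory ProbabilityTheory
open scoped ENNReal

namespace RandomSystem

noncomputable section

/-- The exponent vectors `α = (α₁, …, αₙ)` with `α₁ + ⋯ + αₙ = d`. -/
abbrev Exponent (n d : ℕ) : Type :=
  ↥(Finset.finsuppAntidiag (Finset.univ : Finset (Fin n)) d)

/-- The form `∑_{|α| = d} √(multinomial d α) · c_α · x^α` with coefficient vector `c`. -/
def form {n d : ℕ} (c : EuclideanSpace ℝ (Exponent n d)) : MvPolynomial (Fin n) ℝ :=
  ∑ α : Exponent n d,
    MvPolynomial.monomial (α : Fin n →₀ ℕ)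
      (Real.sqrt ((α : Fin n →₀ ℕ).multinomial : ℝ) * c α)

/-- The Weyl-Bombieri norm of a form of degree `d`. -/
def formNorm {n : ℕ} (d : ℕ) (p : MvPolynomial (Fin n) ℝ) : ℝ :=
  Real.sqrt (∑ α : Exponent n d,
    |MvPolynomial.coeff (α : Fin n →₀ ℕ) p| ^ 2 / ((α : Fin n →₀ ℕ).multinomial : ℝ))

/-- The Weyl-Bombieri norm `‖P‖_W` of a system of forms with degrees `d i`. -/
def sysNorm {m n : ℕ} (d : Fin m → ℕ) (P : Fin m → MvPolynomial (Fin n) ℝ) : ℝ :=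
  Real.sqrt (∑ i, formNorm (d i) (P i) ^ 2)

/-- The value `P(x)`. -/
def sysEval {m n : ℕ} (P : Fin m → MvPolynomial (Fin n) ℝ) (x : EuclideanSpace ℝ (Fin n)) :
    EuclideanSpace ℝ (Fin m) :=
  WithLp.toLp 2 (fun i => MvPolynomial.eval (fun j => x j) (P i))

/-- The Jacobian matrix of `P` at `x`. -/
def jacobian {m n : ℕ} (P : Fin m → MvPolynomial (Fin n) ℝ) (x : EuclideanSpace ℝ (Fin n)) :
    Matrix (Fin m) (Fin n) ℝ :=
  Matrix.of fun i j => MvPolynomial.eval (fun k => x k) (MvPolynomial.pderiv j (P i))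

/-- The tangent space `T_x S^{n-1}`, as the orthogonal complement of `x`. -/
abbrev tangent {n : ℕ} (x : EuclideanSpace ℝ (Fin n)) :
    Submodule ℝ (EuclideanSpace ℝ (Fin n)) :=
  (Submodule.span ℝ {x})ᗮ

/-- `DP(x)` restricted to `T_x S^{n-1}`. -/
def tangentDeriv {m n : ℕ} (P : Fin m → MvPolynomial (Fin n) ℝ)
    (x : EuclideanSpace ℝ (Fin n)) : tangent x →ₗ[ℝ] EuclideanSpace ℝ (Fin m) :=
  (Matrix.toEuclideanLin (jacobian P x)) ∘ₗ (tangent x).subtype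

/-- The diagonal map `Δ` with diagonal entries `√(d i)`. -/
def degreeScaling {m : ℕ} (d : Fin m → ℕ) :
    EuclideanSpace ℝ (Fin m) →ₗ[ℝ] EuclideanSpace ℝ (Fin m) :=
  Matrix.toEuclideanLin (Matrix.diagonal fun i => Real.sqrt (d i : ℝ))

open Classical in
/-- The normalized local condition number
`‖P‖_W · σ_max (DP(x)|_{T_x S^{n-1}}⁻¹ ∘ Δ)`, which is `∞` if `DP(x)|_{T_x S^{n-1}}` is not
invertible. Mathlib lists the singular values in descending order, starting from index `0`. -/
def muNorm {m n : ℕ} (d : Fin m → ℕ) (P : Fin m → MvPolynomial (Fin n) ℝ)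
    (x : EuclideanSpace ℝ (Fin n)) : ℝ≥0∞ :=
  if h : Function.Bijective (tangentDeriv P x) then
    ENNReal.ofReal (sysNorm d P *
      (((LinearEquiv.ofBijective (tangentDeriv P x) h).symm.toLinearMap ∘ₗ
        degreeScaling d).singularValues 0))
  else ∞

/-- The local condition number for real solving,
`‖P‖_W / √(‖P‖_W² · μ_norm(P, x)⁻² + ‖P(x)‖²)`, with values in `[0, ∞]`:
it is `∞` when `P ≠ 0` and the denominator vanishes. (For `P = 0`, where the quotient reads
`0/0`, it gets the value `0`.) -/
def kappaAt {m n : ℕ} (d : Fin m → ℕ) (P : Fin m → MvPolynomial (Fin n) ℝ)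
    (x : EuclideanSpace ℝ (Fin n)) : ℝ≥0∞ :=
  ENNReal.ofReal (sysNorm d P) /
    (ENNReal.ofReal (sysNorm d P) ^ 2 * (muNorm d P x ^ 2)⁻¹
      + ENNReal.ofReal ‖sysEval P x‖ ^ 2) ^ (1 / 2 : ℝ)

/-- The global condition number for real solving: the supremum of the local ones over the
unit sphere. -/
def kappa {m n : ℕ} (d : Fin m → ℕ) (P : Fin m → MvPolynomial (Fin n) ℝ) : ℝ≥0∞ :=
  ⨆ x ∈ Metric.sphere (0 : EuclideanSpace ℝ (Fin n)) 1, kappaAt d P x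

/-- Centering: all one-dimensional marginals have expectation zero. -/
def Centered {Ω ι : Type*} [MeasurableSpace Ω] [Fintype ι] (μ : Measure Ω)
    (X : Ω → EuclideanSpace ℝ ι) : Prop :=
  ∀ θ : EuclideanSpace ℝ ι, ‖θ‖ = 1 →
    Integrable (fun ω => inner ℝ (X ω) θ) μ ∧ ∫ ω, inner ℝ (X ω) θ ∂μ = 0

/-- Sub-Gaussian tails with constant `K` in every direction. -/
def SubGaussian {Ω ι : Type*} [MeasurableSpace Ω] [Fintype ι] (μ : Measure Ω)
    (X : Ω → EuclideanSpace ℝ ι) (K : ℝ) : Prop :=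
  ∀ θ : EuclideanSpace ℝ ι, ‖θ‖ = 1 → ∀ t : ℝ, 0 < t →
    μ.real {ω | t ≤ |inner ℝ (X ω) θ|} ≤ 2 * Real.exp (-(t ^ 2 / K ^ 2))

/-- The small ball property with constant `c₀`, for every nonzero direction `a`
(for `a = 0` the inequality would fail for every random vector). -/
def SmallBall {Ω ι : Type*} [MeasurableSpace Ω] [Fintype ι] (μ : Measure Ω)
    (X : Ω → EuclideanSpace ℝ ι) (c₀ : ℝ) : Prop :=
  ∀ a : EuclideanSpace ℝ ι, a ≠ 0 → ∀ ε : ℝ, 0 < ε →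
    μ.real {ω | |inner ℝ a (X ω)| ≤ ε * ‖a‖} ≤ c₀ * ε

/-- `N = ∑ i, (n + d i - 1 choose d i)`. -/
def numCoeffs {m : ℕ} (n : ℕ) (d : Fin m → ℕ) : ℕ :=
  ∑ i, (n + d i - 1).choose (d i)

/-- `d = max_i d i`. -/
def maxDeg {m : ℕ} (d : Fin m → ℕ) : ℕ :=
  Finset.univ.sup d

/-- `M = A √N (K c₀)^{2(n-1)} (3 d² log(e d))^{2n-3} √n`. -/
def boundM (A K c₀ : ℝ) (n : ℕ) (d : Fin (n - 1) → ℕ) : ℝ :=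
  A * Real.sqrt (numCoeffs n d : ℝ) * (K * c₀) ^ (2 * (n - 1)) *
    (3 * (maxDeg d : ℝ) ^ 2 * Real.log (Real.exp 1 * maxDeg d)) ^ (2 * n - 3) *
    Real.sqrt (n : ℝ)

/-- The threshold `(e d)^{2(n-1)}`. -/
def threshold (n : ℕ) (d : Fin (n - 1) → ℕ) : ℝ :=
  (Real.exp 1 * (maxDeg d : ℝ)) ^ (2 * (n - 1))

/-- The condition number of the random system whose coefficient vectors are `C i`. -/
def randomKappa {Ω : Type*} {m n : ℕ} {d : Fin m → ℕ}
    (C : ∀ i : Fin m, Ω → EuclideanSpace ℝ (Exponent n (d i))) (ω : Ω) : ℝ≥0∞ :=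
  kappa d (fun i => form (C i ω))

end

end RandomSystem

/-! Put m = n - 1, D = max d_i and b = log(eD). Since 1 / σ_max((D_xP)⁻¹Δ) is the least singular
value of Δ⁻¹D_xP, the condition number is ‖P‖_W / √(min gap). The minimum runs over orthonormal
pairs (x, y), and gap = ‖Δ⁻¹DP(x)y‖² + ‖P(x)‖² (`kappa_formSys`). So a condition number of at least
T forces, for every γ > 0, one of three events (`kappa_large_cases`): ‖P‖ exceeds γ somewhere on the
sphere; ‖P‖_W ≥ √N γ; or ‖P‖ ≤ γ on the sphere and gap ≤ (εγ)² at some pair, with ε = √N / T. The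
first two are rare by the sub-Gaussian tails.

The third is where the small ball property enters. Along a great circle P is a trigonometric curve
of degree at most D, so Bernstein's inequality bounds its first two derivatives by Dγ and D²γ. If
gap ≤ (εγ)² at (x, y), then ‖P‖ ≤ 18εγ on a whole tube around x. The tube has half-width √ε/D along
y, where P and its derivative are small and only the quadratic error counts, and radius 15ε/D in the
m - 1 remaining directions (`norm_projEval_le_of_gap`). It fills a proportion q =
(√ε/D)(15ε/D)^(m-1)/24 of a ball (`exists_tube`). At a fixed point the event ‖P‖ ≤ 18εγ has
probability p of order (c₀εγ/√m)^m up to C^m (`measureReal_sysEval_le`). Fubini and Markov bound the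
third event by p/q (`measureReal_le_div_of_section`). This argument replaces a net on the sphere.
The powers of ε leave ε^m / ε^(m-1/2) = √ε, which is the decay t^(-1/2).

With γ = 3K√(bms) the first two events cost exp(-smb) each. The scale s = 1 suffices for t up to
(eD)^(2m). Beyond that s = log t / (2mb), at the price of a factor √s^m in the third event.
Integrating the tail, together with the deterministic lower bound 1/(D+1) for P ≠ 0, controls the
expected logarithm. -/

namespace RandomSystem

/-! ### M. Riesz's interpolation formula for trigonometric polynomials -/

/-- These counts are the Fourier coefficients of the Fejér kernel |∑_{j<D} e^{ijθ}|², whose values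
at the nodes are the interpolation weights. -/
lemma sum_ite_sub_eq {D : ℕ} {c : ℤ} (h0 : 0 ≤ c) (h1 : c ≤ D) :
    ∑ a ∈ Finset.range D, ∑ b ∈ Finset.range D, (if (a : ℤ) - b = c then (1 : ℂ) else 0)
      = D - c := by
  lift c to ℕ using h0
  have h1' : c ≤ D := by exact_mod_cast h1
  rw [Finset.sum_comm]
  have : ∀ b ∈ Finset.range D, ∑ a ∈ Finset.range D, (if (a : ℤ) - b = c then (1 : ℂ) else 0)
      = if b < D - c then 1 else 0 := by
    intro b _
    have : ∀ a ∈ Finset.range D, (if (a : ℤ) - b = c then (1 : ℂ) else 0)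
        = if a = b + c then 1 else 0 := by
      intro a _
      congr 1
      simp only [eq_iff_iff]; omega
    rw [Finset.sum_congr rfl this, Finset.sum_ite_eq']
    congr 1
    simp only [Finset.mem_range, eq_iff_iff]; omega
  rw [Finset.sum_congr rfl this, ← Finset.sum_filter]
  have : (Finset.range D).filter (fun b => b < D - c) = Finset.range (D - c) := by
    ext b; simp only [Finset.mem_filter, Finset.mem_range]; omega
  rw [this]
  simp [Nat.cast_sub h1']

lemma sum_ite_sub_eq_zero {D : ℕ} {c : ℤ} (h : (D : ℤ) ≤ |c|) :
    ∑ a ∈ Finset.range D, ∑ b ∈ Finset.range D, (if (a : ℤ) - b = c then (1 : ℂ) else 0) = 0 := by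
  refine Finset.sum_eq_zero fun a ha => Finset.sum_eq_zero fun b hb => if_neg ?_
  simp only [Finset.mem_range] at ha hb
  rcases abs_cases c with h' | h' <;> omega

lemma sum_ite_sub_eq_neg {D : ℕ} {c : ℤ} (h0 : 0 ≤ c) (h1 : c ≤ D) :
    ∑ a ∈ Finset.range D, ∑ b ∈ Finset.range D, (if (a : ℤ) - b = -c then (1 : ℂ) else 0)
      = D - c := by
  rw [← sum_ite_sub_eq h0 h1, Finset.sum_comm]
  refine Finset.sum_congr rfl fun a _ => Finset.sum_congr rfl fun b _ => ?_
  congr 1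
  simp only [eq_iff_iff]; omega

/-- The interpolation nodes in M. Riesz's formula. -/
noncomputable def rieszNode (D k : ℕ) : ℝ := (2 * k + 1) * Real.pi / (2 * D)

/-- The weights in M. Riesz's formula, without the sign. -/
noncomputable def rieszWeight (D k : ℕ) : ℝ :=
  Complex.normSq (∑ j ∈ Finset.range D, Complex.exp (Complex.I * (j * rieszNode D k)))
    / (2 * (D : ℝ) ^ 2)

lemma rieszWeight_nonneg (D k : ℕ) : 0 ≤ rieszWeight D k :=
  div_nonneg (Complex.normSq_nonneg _) (by positivity)

lemma rieszWeight_eq (D k : ℕ) :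
    (rieszWeight D k : ℂ) = (∑ a ∈ Finset.range D, ∑ b ∈ Finset.range D,
      Complex.exp (Complex.I * (((a : ℤ) - b : ℤ) * rieszNode D k))) / (2 * (D : ℂ) ^ 2) := by
  rw [rieszWeight]
  push_cast
  rw [← Complex.mul_conj, map_sum, Finset.sum_mul_sum]
  congr 1
  refine Finset.sum_congr rfl fun a _ => Finset.sum_congr rfl fun b _ => ?_
  rw [← Complex.exp_conj, ← Complex.exp_add]
  congr 1
  simp
  ring

/-- The terms form a geometric progression whose ratio z satisfies z^(2D) = 1. The ratio equals 1
only if r is an odd multiple of D, and |r| < 2D leaves r = ±D. -/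
lemma sum_exp_rieszNode {D : ℕ} (hD : 0 < D) {r : ℤ} (h : |r| < 2 * D) :
    ∑ k ∈ Finset.range (2 * D), (-1 : ℂ) ^ k * Complex.exp (Complex.I * (r * rieszNode D k))
      = 2 * D * Complex.I * ((if r = D then 1 else 0) - if r = -D then 1 else 0) := by
  have hD' : (D : ℂ) ≠ 0 := by exact_mod_cast hD.ne'
  set z : ℂ := -Complex.exp (Complex.I * (r * Real.pi / D)) with hz
  have key : ∀ k ∈ Finset.range (2 * D),
      (-1 : ℂ) ^ k * Complex.exp (Complex.I * (r * rieszNode D k))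
      = Complex.exp (Complex.I * (r * Real.pi / (2 * D))) * z ^ k := by
    intro k _
    rw [hz, neg_pow (Complex.exp _), ← Complex.exp_nat_mul (Complex.I * (r * Real.pi / D)) k,
      mul_left_comm (Complex.exp _), ← Complex.exp_add]
    congr 2
    rw [rieszNode]; push_cast; field_simp; ring
  rw [Finset.sum_congr rfl key, ← Finset.mul_sum]
  by_cases h1 : r = D
  · have hz1 : z = 1 := by
      rw [hz, h1]
      have : Complex.I * (((D : ℤ) : ℂ) * Real.pi / D) = Real.pi * Complex.I := by
        push_cast; field_simp
      rw [this, Complex.exp_pi_mul_I]; simp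
    have h2 : Complex.exp (Complex.I * (r * Real.pi / (2 * D))) = Complex.I := by
      rw [h1]
      have : Complex.I * (((D : ℤ) : ℂ) * Real.pi / (2 * D)) = Real.pi / 2 * Complex.I := by
        push_cast; field_simp
      rw [this, Complex.exp_pi_div_two_mul_I]
    have h3 : ¬ ((D : ℤ) = -D) := by omega
    rw [hz1, h2, h1]; simp [h3]; ring
  by_cases h2 : r = -D
  · have hz1 : z = 1 := by
      rw [hz, h2]
      have : Complex.I * (((-D : ℤ) : ℂ) * Real.pi / D) = -(Real.pi * Complex.I) := by
        push_cast; field_simp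
      rw [this, Complex.exp_neg, Complex.exp_pi_mul_I]; norm_num
    have h4 : Complex.exp (Complex.I * (r * Real.pi / (2 * D))) = -Complex.I := by
      rw [h2]
      have : Complex.I * (((-D : ℤ) : ℂ) * Real.pi / (2 * D)) = -(Real.pi / 2 * Complex.I) := by
        push_cast; field_simp
      rw [this, Complex.exp_neg, Complex.exp_pi_div_two_mul_I]; simp
    have h3 : ¬ (-(D : ℤ) = D) := by omega
    rw [hz1, h4, h2]; simp [h3]; ring
  · have hz1 : z ≠ 1 := by
      intro hz1
      have : Complex.exp (Complex.I * (r * Real.pi / D) - Real.pi * Complex.I) = 1 := by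
        rw [Complex.exp_sub, Complex.exp_pi_mul_I]
        rw [hz] at hz1
        rw [div_neg, div_one, hz1]
      obtain ⟨j, hj⟩ := Complex.exp_eq_one_iff.mp this
      have hpi : (Real.pi : ℂ) ≠ 0 := by exact_mod_cast Real.pi_ne_zero
      have h5 : (r : ℂ) = D * (2 * j + 1) := by
        have hI := Complex.I_ne_zero
        field_simp at hj
        linear_combination hj
      have h6 : r = D * (2 * j + 1) := by exact_mod_cast h5
      have h7 : |2 * j + 1| < 2 := by
        rw [h6, abs_mul, Nat.abs_cast, mul_comm] at h
        exact lt_of_mul_lt_mul_right h (by positivity)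
      have h8 : j = 0 ∨ j = -1 := by rw [abs_lt] at h7; omega
      rcases h8 with rfl | rfl
      · exact h1 (by rw [h6]; ring)
      · exact h2 (by rw [h6]; ring)
    rw [geom_sum_eq hz1]
    have : z ^ (2 * D) = 1 := by
      rw [hz, neg_pow, ← Complex.exp_nat_mul, pow_mul]
      have : ((2 * D : ℕ) : ℂ) * (Complex.I * (r * Real.pi / D)) = r * (2 * Real.pi * Complex.I) := by
        push_cast; field_simp
      rw [this, Complex.exp_int_mul_two_pi_mul_I]; simp
    simp [this, h1, h2]

/-- Once the weight is expanded, the frequencies j + a - b stay below 2D in absolute value. The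
preceding orthogonality therefore keeps only a - b = D - j and a - b = -(D + j), and the difference
of the two pair counts is j. -/
lemma riesz_identity {D : ℕ} (hD : 0 < D) {j : ℤ} (hj : |j| ≤ D) :
    (D : ℂ) * ∑ k ∈ Finset.range (2 * D), (-1 : ℂ) ^ k * rieszWeight D k *
      Complex.exp (Complex.I * (j * rieszNode D k)) = Complex.I * j := by
  have hD' : (D : ℂ) ≠ 0 := by exact_mod_cast hD.ne'
  have h1 : ∀ k ∈ Finset.range (2 * D), (-1 : ℂ) ^ k * rieszWeight D k *
      Complex.exp (Complex.I * (j * rieszNode D k)) =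
      ∑ a ∈ Finset.range D, ∑ b ∈ Finset.range D, (1 / (2 * (D : ℂ) ^ 2)) *
        ((-1 : ℂ) ^ k * Complex.exp (Complex.I * (((j + (a - b) : ℤ)) * rieszNode D k))) := by
    intro k _
    rw [rieszWeight_eq, mul_div_assoc', div_mul_eq_mul_div, Finset.mul_sum, Finset.sum_mul,
      Finset.sum_div]
    refine Finset.sum_congr rfl fun a _ => ?_
    rw [Finset.mul_sum, Finset.sum_mul, Finset.sum_div]
    refine Finset.sum_congr rfl fun b _ => ?_
    rw [mul_assoc, ← Complex.exp_add, div_eq_mul_one_div, mul_comm]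
    congr 3
    push_cast; ring
  rw [Finset.sum_congr rfl h1, Finset.sum_comm]
  have h2 : ∀ a ∈ Finset.range D, ∑ k ∈ Finset.range (2 * D), ∑ b ∈ Finset.range D,
      (1 / (2 * (D : ℂ) ^ 2)) *
        ((-1 : ℂ) ^ k * Complex.exp (Complex.I * (((j + (a - b) : ℤ)) * rieszNode D k)))
      = ∑ b ∈ Finset.range D, Complex.I / D * ((if (a : ℤ) - b = D - j then 1 else 0)
          - if (a : ℤ) - b = -(D + j) then 1 else 0) := by
    intro a ha
    rw [Finset.sum_comm]
    refine Finset.sum_congr rfl fun b hb => ?_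
    rw [← Finset.mul_sum, sum_exp_rieszNode hD]
    · have e1 : (j + (a - b) = (D : ℤ)) ↔ (a : ℤ) - b = D - j := by omega
      have e2 : (j + (a - b) = -(D : ℤ)) ↔ (a : ℤ) - b = -(D + j) := by omega
      simp only [e1, e2]
      field_simp
    · simp only [Finset.mem_range] at ha hb
      rw [abs_le] at hj
      rw [abs_lt]; omega
  rw [Finset.sum_congr rfl h2]
  simp only [← Finset.mul_sum, Finset.sum_sub_distrib]
  rw [abs_le] at hj
  rcases le_total 0 j with h | h
  · rw [sum_ite_sub_eq (by omega) (by omega), sum_ite_sub_eq_zero (c := -(D + j))]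
    · push_cast; field_simp; ring
    · rw [abs_neg, abs_of_nonneg] <;> omega
  · rw [sum_ite_sub_eq_zero (c := D - j), sum_ite_sub_eq_neg (c := D + j) (by omega) (by omega)]
    · push_cast; field_simp; ring
    · rw [abs_of_nonneg] <;> omega

/-- The case j = D of the identity: e^{iDθ_k} = i(-1)^k cancels the signs. Total mass 1 is what
yields the constant D in Bernstein's inequality. -/
lemma sum_rieszWeight {D : ℕ} (hD : 0 < D) : ∑ k ∈ Finset.range (2 * D), rieszWeight D k = 1 := by
  have hD' : (D : ℂ) ≠ 0 := by exact_mod_cast hD.ne'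
  have h := riesz_identity hD (j := D) (by simp)
  have h1 : ∀ k ∈ Finset.range (2 * D), (-1 : ℂ) ^ k * rieszWeight D k *
      Complex.exp (Complex.I * (((D : ℤ) : ℂ) * rieszNode D k)) = Complex.I * rieszWeight D k := by
    intro k _
    have : Complex.I * (((D : ℤ) : ℂ) * rieszNode D k)
        = k * (Real.pi * Complex.I) + Real.pi / 2 * Complex.I := by
      rw [rieszNode]; push_cast; field_simp
    rw [this, Complex.exp_add, Complex.exp_nat_mul, Complex.exp_pi_mul_I,
      Complex.exp_pi_div_two_mul_I]
    have : (-1 : ℂ) ^ k * (-1) ^ k = 1 := by rw [← mul_pow]; simp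
    linear_combination (Complex.I * rieszWeight D k) * this
  rw [Finset.sum_congr rfl h1, ← Finset.mul_sum] at h
  have h2 : (∑ k ∈ Finset.range (2 * D), (rieszWeight D k : ℂ)) = 1 := by
    have : (D : ℂ) * Complex.I ≠ 0 := mul_ne_zero hD' Complex.I_ne_zero
    apply mul_left_cancel₀ this
    push_cast at h
    linear_combination h
  exact_mod_cast h2

/-- Real trigonometric polynomials of degree at most `D`. -/
def IsTrigPoly (D : ℕ) (f : ℝ → ℝ) : Prop :=
  ∃ q : Polynomial ℂ, q.natDegree ≤ 2 * D ∧
    ∀ θ : ℝ, (f θ : ℂ) = Complex.exp (-(Complex.I * (D * θ))) * q.eval (Complex.exp (Complex.I * θ))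

lemma IsTrigPoly.mono {D E : ℕ} {f : ℝ → ℝ} (hf : IsTrigPoly D f) (h : D ≤ E) :
    IsTrigPoly E f := by
  obtain ⟨q, hq, hf⟩ := hf
  refine ⟨Polynomial.X ^ (E - D) * q, ?_, fun θ => ?_⟩
  · refine Polynomial.natDegree_mul_le.trans ?_
    rw [Polynomial.natDegree_X_pow]; omega
  · rw [hf, Polynomial.eval_mul, Polynomial.eval_pow, Polynomial.eval_X, ← Complex.exp_nat_mul,
      ← mul_assoc (Complex.exp _) (Complex.exp _), ← Complex.exp_add]
    congr 2
    rw [Nat.cast_sub h]; ring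

/-- M. Riesz's interpolation formula for the derivative. -/
lemma IsTrigPoly.hasDerivAt {D : ℕ} (hD : 0 < D) {f : ℝ → ℝ} (hf : IsTrigPoly D f) (θ : ℝ) :
    HasDerivAt f (D * ∑ k ∈ Finset.range (2 * D),
      (-1 : ℝ) ^ k * rieszWeight D k * f (θ + rieszNode D k)) θ := by
  obtain ⟨q, hq, hf⟩ := hf
  have hsum : ∀ φ : ℝ, (f φ : ℂ) = ∑ l ∈ Finset.range (2 * D + 1),
      q.coeff l * Complex.exp (((l : ℤ) - D : ℤ) * Complex.I * φ) := by
    intro φ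
    rw [hf, Polynomial.eval_eq_sum_range' (Nat.lt_succ_of_le hq), Finset.mul_sum]
    refine Finset.sum_congr rfl fun l _ => ?_
    rw [← Complex.exp_nat_mul, mul_left_comm, ← Complex.exp_add]
    congr 2
    push_cast; ring
  have hder : HasDerivAt (fun φ : ℝ => (f φ : ℂ)) (∑ l ∈ Finset.range (2 * D + 1),
      q.coeff l * (Complex.exp (((l : ℤ) - D : ℤ) * Complex.I * θ) *
        (((l : ℤ) - D : ℤ) * Complex.I))) θ := by
    rw [funext hsum]
    refine HasDerivAt.fun_sum fun l _ => HasDerivAt.const_mul _ ?_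
    have h1 : HasDerivAt (fun z : ℂ => Complex.exp ((((l : ℤ) - D : ℤ) : ℂ) * Complex.I * z))
        (Complex.exp (((l : ℤ) - D : ℤ) * Complex.I * θ) * (((l : ℤ) - D : ℤ) * Complex.I))
        (θ : ℂ) := by
      have := ((hasDerivAt_id (θ : ℂ)).const_mul ((((l : ℤ) - D : ℤ) : ℂ) * Complex.I)).cexp
      simpa using this
    exact h1.comp_ofReal
  have hval : (∑ l ∈ Finset.range (2 * D + 1),
      q.coeff l * (Complex.exp (((l : ℤ) - D : ℤ) * Complex.I * θ) *
        (((l : ℤ) - D : ℤ) * Complex.I))) = ((D * ∑ k ∈ Finset.range (2 * D),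
      (-1 : ℝ) ^ k * rieszWeight D k * f (θ + rieszNode D k) : ℝ) : ℂ) := by
    push_cast
    have e : ∀ k ∈ Finset.range (2 * D), (-1 : ℂ) ^ k * rieszWeight D k * f (θ + rieszNode D k)
        = ∑ l ∈ Finset.range (2 * D + 1),
          q.coeff l * (Complex.exp (((l : ℤ) - D : ℤ) * Complex.I * θ) *
          ((-1 : ℂ) ^ k * rieszWeight D k *
            Complex.exp (Complex.I * (((l : ℤ) - D : ℤ) * rieszNode D k)))) := by
      intro k _
      rw [hsum, Finset.mul_sum]
      refine Finset.sum_congr rfl fun l _ => ?_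
      have : (((l : ℤ) - D : ℤ) : ℂ) * Complex.I * ((θ + rieszNode D k : ℝ) : ℂ)
          = ((l : ℤ) - D : ℤ) * Complex.I * θ
            + Complex.I * (((l : ℤ) - D : ℤ) * rieszNode D k) := by push_cast; ring
      rw [this, Complex.exp_add]; ring
    rw [Finset.sum_congr rfl e, Finset.sum_comm, Finset.mul_sum]
    refine Finset.sum_congr rfl fun l hl => ?_
    have hl' : |(l : ℤ) - D| ≤ D := by
      simp only [Finset.mem_range] at hl
      rw [abs_le]; omega
    have h := riesz_identity hD hl'
    rw [← Finset.mul_sum, ← Finset.mul_sum]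
    push_cast at h ⊢
    linear_combination (-(q.coeff l * Complex.exp (((l : ℂ) - D) * Complex.I * θ))) * h
  rw [hval] at hder
  have := (Complex.reCLM.hasFDerivAt.comp_hasDerivAt θ hder)
  simpa only [Function.comp_def, Complex.reCLM_apply, Complex.ofReal_re] using this

/-! ### Forms restricted to great circles -/

lemma eval_smul_of_isHomogeneous {σ R : Type*} [CommRing R] {d : ℕ} {p : MvPolynomial σ R}
    (hp : p.IsHomogeneous d) (c : R) (x : σ → R) :
    MvPolynomial.eval (fun j => c * x j) p = c ^ d * MvPolynomial.eval x p := by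
  rw [MvPolynomial.eval_eq, MvPolynomial.eval_eq, Finset.mul_sum]
  refine Finset.sum_congr rfl fun m hm => ?_
  simp only [mul_pow]
  rw [Finset.prod_mul_distrib, Finset.prod_pow_eq_pow_sum,
    ← hp.degree_eq_sum_deg_support hm]
  ring

/-- One has cos θ · x + sin θ · y = e^{-iθ}(u e^{2iθ} + v) with complex vectors u, v. Homogeneity
extracts e^{-idθ} and leaves a polynomial of degree at most 2d in e^{iθ}. -/
lemma isTrigPoly_eval {n d : ℕ} {p : MvPolynomial (Fin n) ℝ} (hp : p.IsHomogeneous d)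
    (x y : Fin n → ℝ) :
    IsTrigPoly d (fun θ => MvPolynomial.eval (fun j => Real.cos θ * x j + Real.sin θ * y j) p) := by
  let u : Fin n → ℂ := fun j => (x j - Complex.I * y j) / 2
  let v : Fin n → ℂ := fun j => (x j + Complex.I * y j) / 2
  let P : MvPolynomial (Fin n) ℂ := MvPolynomial.map Complex.ofRealHom p
  have hP : P.IsHomogeneous d := hp.map _
  refine ⟨MvPolynomial.aeval
    (fun j => Polynomial.C (u j) * Polynomial.X ^ 2 + Polynomial.C (v j)) P, ?_, fun θ => ?_⟩
  · rw [mul_comm]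
    refine MvPolynomial.aeval_natDegree_le P hP.totalDegree_le _ fun j => ?_
    compute_degree
  · have h1 : Polynomial.eval (Complex.exp (Complex.I * θ)) (MvPolynomial.aeval
        (fun j => Polynomial.C (u j) * Polynomial.X ^ 2 + Polynomial.C (v j)) P)
        = MvPolynomial.eval (fun j => u j * Complex.exp (Complex.I * θ) ^ 2 + v j) P := by
      rw [← Polynomial.coe_aeval_eq_eval, ← AlgHom.comp_apply, MvPolynomial.comp_aeval,
        ← MvPolynomial.coe_aeval_eq_eval]
      simp
    have h2 : ((MvPolynomial.eval (fun j => Real.cos θ * x j + Real.sin θ * y j) p : ℝ) : ℂ)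
        = MvPolynomial.eval (fun j => Complex.exp (-(Complex.I * θ)) *
          (u j * Complex.exp (Complex.I * θ) ^ 2 + v j)) P := by
      have : (fun j => Complex.exp (-(Complex.I * θ)) *
          (u j * Complex.exp (Complex.I * θ) ^ 2 + v j)) =
          fun j => Complex.ofRealHom (Real.cos θ * x j + Real.sin θ * y j) := by
        funext j
        have e1 : Complex.exp (Complex.I * θ) = Complex.cos θ + Complex.sin θ * Complex.I := by
          rw [mul_comm, Complex.exp_mul_I]
        have e2 : Complex.exp (-(Complex.I * θ)) = Complex.cos θ - Complex.sin θ * Complex.I := by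
          have : -(Complex.I * θ) = (-θ : ℂ) * Complex.I := by ring
          rw [this, Complex.exp_mul_I, Complex.cos_neg, Complex.sin_neg]; ring
        have e3 := Complex.sin_sq_add_cos_sq (θ : ℂ)
        rw [e1, e2]
        simp only [u, v, Complex.ofRealHom_eq_coe]
        push_cast
        have hI := Complex.I_sq
        have e4 : (Complex.cos θ - Complex.sin θ * Complex.I) *
          (Complex.cos θ + Complex.sin θ * Complex.I) = 1 := by 
          linear_combination e3 - Complex.sin (θ : ℂ) ^ 2 * hI
        linear_combination (((x j : ℂ) - Complex.I * y j) / 2 *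
          (Complex.cos θ + Complex.sin θ * Complex.I)) * e4 - Complex.sin θ * y j * hI
      rw [this]
      exact (MvPolynomial.map_eval Complex.ofRealHom _ p).symm ▸ rfl
    rw [h2, h1, eval_smul_of_isHomogeneous hP, ← Complex.exp_nat_mul]
    congr 2
    ring

lemma hasDerivAt_mvPolynomial_eval {n : ℕ} (p : MvPolynomial (Fin n) ℝ) {c : ℝ → Fin n → ℝ}
    {c' : Fin n → ℝ} {t : ℝ} (h : ∀ j, HasDerivAt (fun s => c s j) (c' j) t) :
    HasDerivAt (fun s => MvPolynomial.eval (c s) p)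
      (∑ j, MvPolynomial.eval (c t) (MvPolynomial.pderiv j p) * c' j) t := by
  induction p using MvPolynomial.induction_on with
  | C a => simpa using hasDerivAt_const t a
  | add p q hp hq =>
    simp only [map_add, add_mul, Finset.sum_add_distrib]
    exact hp.add hq
  | mul_X p i hp =>
    have := hp.mul (h i)
    simp only [map_mul, MvPolynomial.eval_X]
    refine this.congr_deriv ?_
    simp only [MvPolynomial.pderiv_mul, MvPolynomial.pderiv_X, map_add, map_mul,
      MvPolynomial.eval_X, add_mul, Finset.sum_add_distrib, Finset.sum_mul]
    congr 1
    · exact Finset.sum_congr rfl fun j _ => by ring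
    · rw [Finset.sum_eq_single i]
      · simp
      · intro j _ hj
        simp [hj.symm]
      · simp

/-! ### Bernstein's inequality for vector-valued trigonometric curves -/

section TrigCurve

variable {m D : ℕ} {f : ℝ → EuclideanSpace ℝ (Fin m)} {γ : ℝ}

/-- The derivative of a trigonometric curve of degree `D`, as given by Riesz's formula. -/
noncomputable def rieszDeriv (D : ℕ) (f : ℝ → EuclideanSpace ℝ (Fin m)) (θ : ℝ) :
    EuclideanSpace ℝ (Fin m) :=
  (D : ℝ) • ∑ k ∈ Finset.range (2 * D),
    ((-1 : ℝ) ^ k * rieszWeight D k) • f (θ + rieszNode D k)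

lemma hasDerivAt_of_coord {f : ℝ → EuclideanSpace ℝ (Fin m)} {f' : EuclideanSpace ℝ (Fin m)}
    {t : ℝ} (h : ∀ i, HasDerivAt (fun s => f s i) (f' i) t) : HasDerivAt f f' t := by
  exact ((PiLp.continuousLinearEquiv 2 ℝ (fun _ : Fin m => ℝ)).symm :
    (Fin m → ℝ) →L[ℝ] EuclideanSpace ℝ (Fin m)).hasFDerivAt.comp_hasDerivAt t (hasDerivAt_pi.2 h)

lemma hasDerivAt_rieszDeriv (hD : 0 < D) (hf : ∀ i, IsTrigPoly D (fun θ => f θ i)) (θ : ℝ) :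
    HasDerivAt f (rieszDeriv D f θ) θ := by
  refine hasDerivAt_of_coord fun i => ?_
  refine ((hf i).hasDerivAt hD θ).congr_deriv ?_
  simp [rieszDeriv]

/-- Bernstein's inequality. Riesz's coefficients have absolute values summing to 1, so the triangle
inequality suffices and the dimension of the target costs nothing. -/
lemma norm_rieszDeriv_le (hD : 0 < D) (hγ : ∀ θ, ‖f θ‖ ≤ γ) (θ : ℝ) :
    ‖rieszDeriv D f θ‖ ≤ D * γ := by
  rw [rieszDeriv, norm_smul, Real.norm_natCast]
  refine mul_le_mul_of_nonneg_left ?_ (by positivity)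
  refine (norm_sum_le _ _).trans ?_
  calc _ ≤ ∑ k ∈ Finset.range (2 * D), rieszWeight D k * γ := by
        refine Finset.sum_le_sum fun k _ => ?_
        rw [norm_smul, norm_mul, norm_pow, norm_neg, norm_one, one_pow, one_mul,
          Real.norm_of_nonneg (rieszWeight_nonneg D k)]
        exact mul_le_mul_of_nonneg_left (hγ _) (rieszWeight_nonneg D k)
    _ = γ := by rw [← Finset.sum_mul, sum_rieszWeight hD, one_mul]

/-- Riesz's formula is a finite combination of translates of f, so it can be differentiated by
applying it again. Bernstein's bound then iterates to D²γ for the second derivative. -/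
lemma hasDerivAt_rieszDeriv_rieszDeriv (hD : 0 < D)
    (hf : ∀ i, IsTrigPoly D (fun θ => f θ i)) (θ : ℝ) :
    HasDerivAt (rieszDeriv D f) (rieszDeriv D (rieszDeriv D f) θ) θ := by
  refine HasDerivAt.const_smul (D : ℝ) ?_
  refine HasDerivAt.fun_sum fun k _ => HasDerivAt.fun_const_smul _ ?_
  exact (hasDerivAt_rieszDeriv hD hf (θ + rieszNode D k)).comp_add_const θ _

lemma norm_sub_le_of_trig (hD : 0 < D) (hf : ∀ i, IsTrigPoly D (fun θ => f θ i))
    (hγ : ∀ θ, ‖f θ‖ ≤ γ) (θ φ : ℝ) : ‖f θ - f φ‖ ≤ D * γ * |θ - φ| := by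
  have := Convex.norm_image_sub_le_of_norm_hasDerivWithin_le (s := Set.univ) (C := D * γ)
    (fun x _ => (hasDerivAt_rieszDeriv hD hf x).hasDerivWithinAt)
    (fun x _ => norm_rieszDeriv_le hD hγ x) convex_univ (Set.mem_univ φ) (Set.mem_univ θ)
  simpa [Real.norm_eq_abs] using this

/-- Mean value inequality for s ↦ f(s) - s f'(0), whose derivative is at most D²γ|s|. The lost
factor 1/2 is harmless. -/
lemma norm_sub_sub_le_of_trig (hD : 0 < D) (hf : ∀ i, IsTrigPoly D (fun θ => f θ i))
    (hγ : ∀ θ, ‖f θ‖ ≤ γ) (θ : ℝ) :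
    ‖f θ - f 0 - θ • rieszDeriv D f 0‖ ≤ D ^ 2 * γ * θ ^ 2 := by
  have hγ0 : 0 ≤ γ := (norm_nonneg _).trans (hγ 0)
  have h1 : ∀ s, ‖rieszDeriv D f s - rieszDeriv D f 0‖ ≤ D * (D * γ) * |s| := by
    intro s
    have := Convex.norm_image_sub_le_of_norm_hasDerivWithin_le (s := Set.univ) (C := D * (D * γ))
      (fun x _ => (hasDerivAt_rieszDeriv_rieszDeriv hD hf x).hasDerivWithinAt)
      (fun x _ => norm_rieszDeriv_le hD (norm_rieszDeriv_le hD hγ) x) convex_univ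
      (Set.mem_univ 0) (Set.mem_univ s)
    simpa [Real.norm_eq_abs] using this
  have h2 : ∀ s ∈ Set.uIcc 0 θ, HasDerivWithinAt (fun s => f s - s • rieszDeriv D f 0)
      (rieszDeriv D f s - rieszDeriv D f 0) (Set.uIcc 0 θ) s := by
    intro s _
    have := ((hasDerivAt_rieszDeriv hD hf s).fun_sub
      ((hasDerivAt_id s).smul_const (rieszDeriv D f 0))).hasDerivWithinAt (s := Set.uIcc 0 θ)
    simpa using this
  have := Convex.norm_image_sub_le_of_norm_hasDerivWithin_le (C := D * (D * γ) * |θ|) h2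
    (fun s hs => (h1 s).trans (by
      have : |s| ≤ |θ| := by
        have := Set.abs_sub_left_of_mem_uIcc hs
        simpa using this
      gcongr)) (convex_uIcc 0 θ) Set.left_mem_uIcc Set.right_mem_uIcc
  have e : f θ - θ • rieszDeriv D f 0 - (f 0 - (0 : ℝ) • rieszDeriv D f 0)
      = f θ - f 0 - θ • rieszDeriv D f 0 := by rw [zero_smul]; abel
  rw [e] at this
  refine this.trans (le_of_eq ?_)
  rw [sub_zero, Real.norm_eq_abs, ← sq_abs θ]; ring

end TrigCurve

/-! ### First and second order estimates on the sphere, in affine coordinates -/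

section Sphere

variable {m n D : ℕ} {d : Fin m → ℕ} {P : Fin m → MvPolynomial (Fin n) ℝ} {γ : ℝ}
  {x y : EuclideanSpace ℝ (Fin n)}

/-- The directional derivative `DP(x) y`. -/
noncomputable def dirDeriv (P : Fin m → MvPolynomial (Fin n) ℝ)
    (x y : EuclideanSpace ℝ (Fin n)) : EuclideanSpace ℝ (Fin m) :=
  Matrix.toEuclideanLin (jacobian P x) y

lemma dirDeriv_apply (P : Fin m → MvPolynomial (Fin n) ℝ) (x y : EuclideanSpace ℝ (Fin n))
    (i : Fin m) : dirDeriv P x y i =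
      ∑ j, MvPolynomial.eval (fun k => x k) (MvPolynomial.pderiv j (P i)) * y j := by
  simp [dirDeriv, jacobian, Matrix.toLpLin_apply, Matrix.mulVec, dotProduct]

lemma isTrigPoly_sysEval (hP : ∀ i, (P i).IsHomogeneous (d i)) (hd : ∀ i, d i ≤ D)
    (x y : EuclideanSpace ℝ (Fin n)) (i : Fin m) :
    IsTrigPoly D (fun θ => sysEval P (Real.cos θ • x + Real.sin θ • y) i) := by
  have := (isTrigPoly_eval (hP i) (fun j => x j) (fun j => y j)).mono (hd i)
  simpa [sysEval] using this

lemma hasDerivAt_sysEval (P : Fin m → MvPolynomial (Fin n) ℝ) (x y : EuclideanSpace ℝ (Fin n)) :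
    HasDerivAt (fun θ : ℝ => sysEval P (Real.cos θ • x + Real.sin θ • y)) (dirDeriv P x y) 0 := by
  refine hasDerivAt_of_coord fun i => ?_
  have := hasDerivAt_mvPolynomial_eval (P i) (t := 0)
    (c := fun θ j => Real.cos θ * x j + Real.sin θ * y j) (c' := fun j => y j) (fun j => by
      have := ((Real.hasDerivAt_cos 0).mul_const (x j)).fun_add
        ((Real.hasDerivAt_sin 0).mul_const (y j))
      simpa using this)
  rw [dirDeriv_apply]
  simpa [sysEval] using this

lemma norm_cos_smul_add_sin_smul (hx : ‖x‖ = 1) (hy : ‖y‖ = 1) (hxy : inner ℝ x y = 0) (θ : ℝ) :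
    ‖Real.cos θ • x + Real.sin θ • y‖ = 1 := by
  have h : ‖Real.cos θ • x + Real.sin θ • y‖ ^ 2 = 1 := by
    rw [norm_add_sq_real, norm_smul, norm_smul, hx, hy, inner_smul_left, inner_smul_right, hxy]
    simp
  nlinarith [norm_nonneg (Real.cos θ • x + Real.sin θ • y)]

lemma abs_arctan_le (t : ℝ) : |Real.arctan t| ≤ |t| := by
  have key : ∀ t : ℝ, 0 ≤ t → Real.arctan t ≤ t := fun t ht => by
    have := Real.le_tan (Real.arctan_nonneg.2 ht) (Real.arctan_lt_pi_div_two t)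
    rwa [Real.tan_arctan] at this
  rcases le_total 0 t with h | h
  · rw [abs_of_nonneg h, abs_of_nonneg (Real.arctan_nonneg.2 h)]; exact key t h
  · rw [abs_of_nonpos h, abs_of_nonpos (Real.arctan_le_zero.2 h), ← Real.arctan_neg]
    exact key _ (by linarith)

/-- Translates estimates in the angle of a great circle into estimates at points of the ambient
space, where Lebesgue measure is available. The angle is at most |r|/s because |arctan t| ≤ |t|. -/
lemma normalize_eq (hx : ‖x‖ = 1) (hy : ‖y‖ = 1) (hxy : inner ℝ x y = 0) {s : ℝ} (hs : 0 < s)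
    (r : ℝ) : ‖s • x + r • y‖⁻¹ • (s • x + r • y)
      = Real.cos (Real.arctan (r / s)) • x + Real.sin (Real.arctan (r / s)) • y := by
  have h : ‖s • x + r • y‖ = s * √(1 + (r / s) ^ 2) := by
    have h1 : ‖s • x + r • y‖ ^ 2 = s ^ 2 + r ^ 2 := by
      rw [norm_add_sq_real, norm_smul, norm_smul, hx, hy, inner_smul_left, inner_smul_right, hxy]
      simp
    rw [← Real.sqrt_sq (norm_nonneg _), h1, ← Real.sqrt_sq hs.le, ← Real.sqrt_mul (by positivity),
      Real.sqrt_sq hs.le]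
    congr 1; field_simp
  have h0 : √(1 + (r / s) ^ 2) ≠ 0 := by positivity
  rw [Real.cos_arctan, Real.sin_arctan, h, smul_add, smul_smul, smul_smul]
  congr 2
  · field_simp
  · field_simp

/-- The value of `P` at the radial projection of `w` to the unit sphere. -/
noncomputable def projEval (P : Fin m → MvPolynomial (Fin n) ℝ) (w : EuclideanSpace ℝ (Fin n)) :
    EuclideanSpace ℝ (Fin m) :=
  sysEval P (‖w‖⁻¹ • w)

lemma norm_projEval_sub_le (hD : 0 < D) (hP : ∀ i, (P i).IsHomogeneous (d i))
    (hd : ∀ i, d i ≤ D) (hγ : ∀ z, ‖z‖ = 1 → ‖sysEval P z‖ ≤ γ) (hx : ‖x‖ = 1)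
    {v : EuclideanSpace ℝ (Fin n)} (hv : inner ℝ x v = 0) {s : ℝ} (hs : 0 < s) :
    ‖projEval P (s • x + v) - sysEval P x‖ ≤ D * γ * (‖v‖ / s) := by
  have hγ0 : 0 ≤ γ := (norm_nonneg _).trans (hγ x hx)
  rcases eq_or_ne v 0 with rfl | hv0
  · have : ‖s • x‖⁻¹ • (s • x) = x := by
      rw [norm_smul, hx, Real.norm_of_nonneg hs.le, smul_smul, mul_one, inv_mul_cancel₀ hs.ne',
        one_smul]
    simp [projEval, this]
  · have hvn : ‖v‖ ≠ 0 := norm_ne_zero_iff.2 hv0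
    set y := ‖v‖⁻¹ • v with hydef
    have hy : ‖y‖ = 1 := by rw [hydef, norm_smul, norm_inv, norm_norm, inv_mul_cancel₀ hvn]
    have hvy : v = ‖v‖ • y := by rw [hydef, smul_smul, mul_inv_cancel₀ hvn, one_smul]
    have hxy : inner ℝ x y = 0 := by rw [hydef, inner_smul_right, hv, mul_zero]
    rw [hvy, projEval, normalize_eq hx hy hxy hs]
    have h := norm_sub_le_of_trig hD (isTrigPoly_sysEval hP hd x y)
      (fun θ => hγ _ (norm_cos_smul_add_sin_smul hx hy hxy θ)) (Real.arctan (‖v‖ / s)) 0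
    simp only [Real.cos_zero, Real.sin_zero, one_smul, zero_smul, add_zero, sub_zero] at h
    refine h.trans (mul_le_mul_of_nonneg_left ?_ (by positivity))
    refine (abs_arctan_le _).trans (le_of_eq ?_)
    rw [← hvy, abs_of_nonneg (by positivity)]

lemma norm_projEval_le_of_tangent (hD : 0 < D) (hP : ∀ i, (P i).IsHomogeneous (d i))
    (hd : ∀ i, d i ≤ D) (hγ : ∀ z, ‖z‖ = 1 → ‖sysEval P z‖ ≤ γ) (hx : ‖x‖ = 1) (hy : ‖y‖ = 1)
    (hxy : inner ℝ x y = 0) {s : ℝ} (hs : 0 < s) (r : ℝ) :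
    ‖projEval P (s • x + r • y)‖ ≤
      ‖sysEval P x‖ + |r| / s * ‖dirDeriv P x y‖ + D ^ 2 * γ * (r / s) ^ 2 := by
  have hγ0 : 0 ≤ γ := (norm_nonneg _).trans (hγ x hx)
  rw [projEval, normalize_eq hx hy hxy hs]
  set θ := Real.arctan (r / s) with hθ
  have h := norm_sub_sub_le_of_trig hD (isTrigPoly_sysEval hP hd x y)
      (fun θ => hγ _ (norm_cos_smul_add_sin_smul hx hy hxy θ)) θ
  have hder := (hasDerivAt_rieszDeriv hD (isTrigPoly_sysEval hP hd x y) 0).unique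
    (hasDerivAt_sysEval P x y)
  rw [hder] at h
  simp only [Real.cos_zero, Real.sin_zero, one_smul, zero_smul, add_zero] at h
  have hθ1 : |θ| ≤ |r| / s := by
    refine (abs_arctan_le _).trans (le_of_eq ?_)
    rw [abs_div, abs_of_pos hs]
  have hθ2 : θ ^ 2 ≤ (r / s) ^ 2 := by
    rw [sq_le_sq]; exact abs_arctan_le _
  set F := sysEval P (Real.cos θ • x + Real.sin θ • y)
  calc ‖F‖ = ‖sysEval P x + θ • dirDeriv P x y + (F - sysEval P x - θ • dirDeriv P x y)‖ := by
        congr 1; abel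
    _ ≤ ‖sysEval P x‖ + ‖θ • dirDeriv P x y‖ + ‖F - sysEval P x - θ • dirDeriv P x y‖ :=
        norm_add₃_le
    _ ≤ _ := by
        rw [norm_smul, Real.norm_eq_abs]
        have : (D : ℝ) ^ 2 * γ * θ ^ 2 ≤ D ^ 2 * γ * (r / s) ^ 2 := by gcongr
        have h3 : |θ| * ‖dirDeriv P x y‖ ≤ |r| / s * ‖dirDeriv P x y‖ := by gcongr
        linarith

/-- Two arcs are used: from x towards y to the direction of u = s x + r y, with the second order
estimate, and then towards z, which is orthogonal to u, with the first order estimate. Here ‖u‖ ≥ s.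
-/
lemma norm_projEval_tube_le (hD : 0 < D) (hP : ∀ i, (P i).IsHomogeneous (d i))
    (hd : ∀ i, d i ≤ D) (hγ : ∀ z, ‖z‖ = 1 → ‖sysEval P z‖ ≤ γ) (hx : ‖x‖ = 1) (hy : ‖y‖ = 1)
    (hxy : inner ℝ x y = 0) {s : ℝ} (hs : 0 < s) (r : ℝ) {z : EuclideanSpace ℝ (Fin n)}
    (hxz : inner ℝ x z = 0) (hyz : inner ℝ y z = 0) :
    ‖projEval P (s • x + r • y + z)‖ ≤
      ‖sysEval P x‖ + |r| / s * ‖dirDeriv P x y‖ + D ^ 2 * γ * (r / s) ^ 2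
        + D * γ * (‖z‖ / s) := by
  have hγ0 : 0 ≤ γ := (norm_nonneg _).trans (hγ x hx)
  set u := s • x + r • y with hu
  have hun : s ≤ ‖u‖ := by
    have h1 : ‖u‖ ^ 2 = s ^ 2 + r ^ 2 := by
      rw [hu, norm_add_sq_real, norm_smul, norm_smul, hx, hy, inner_smul_left, inner_smul_right,
        hxy]
      simp
    nlinarith [norm_nonneg u, sq_nonneg r]
  have hu0 : 0 < ‖u‖ := hs.trans_le hun
  have hun1 : ‖‖u‖⁻¹ • u‖ = 1 := by rw [norm_smul, norm_inv, norm_norm, inv_mul_cancel₀ hu0.ne']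
  have huu : u = ‖u‖ • (‖u‖⁻¹ • u) := by rw [smul_smul, mul_inv_cancel₀ hu0.ne', one_smul]
  have huz : inner ℝ (‖u‖⁻¹ • u) z = 0 := by
    rw [inner_smul_left, hu, inner_add_left, inner_smul_left, inner_smul_left, hxz, hyz]; simp
  have h1 := norm_projEval_sub_le hD hP hd hγ hun1 huz hu0
  rw [← huu] at h1
  have h2 := norm_projEval_le_of_tangent hD hP hd hγ hx hy hxy hs r
  rw [← hu, projEval] at h2
  have h3 : (D : ℝ) * γ * (‖z‖ / ‖u‖) ≤ D * γ * (‖z‖ / s) := by gcongr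
  have h4 := norm_sub_norm_le (projEval P (u + z)) (sysEval P (‖u‖⁻¹ • u))
  linarith

lemma norm_dirDeriv_le (hD : 0 < D) (hP : ∀ i, (P i).IsHomogeneous (d i))
    (hd : ∀ i, d i ≤ D) (hγ : ∀ z, ‖z‖ = 1 → ‖sysEval P z‖ ≤ γ) (hx : ‖x‖ = 1) (hy : ‖y‖ = 1)
    (hxy : inner ℝ x y = 0) : ‖dirDeriv P x y‖ ≤ D * γ := by
  rw [← (hasDerivAt_rieszDeriv hD (isTrigPoly_sysEval hP hd x y) 0).unique
    (hasDerivAt_sysEval P x y)]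
  exact norm_rieszDeriv_le hD (fun θ => hγ _ (norm_cos_smul_add_sin_smul hx hy hxy θ)) 0

end Sphere

/-! ### Weyl-normalized forms as inner products with the Veronese vector -/

lemma Exponent.sum_eq {n d : ℕ} (α : Exponent n d) : ∑ j, (α : Fin n →₀ ℕ) j = d := by
  have := α.2
  rw [Finset.mem_finsuppAntidiag] at this
  exact this.1

lemma form_isHomogeneous {n d : ℕ} (c : EuclideanSpace ℝ (Exponent n d)) :
    (form c).IsHomogeneous d := by
  refine MvPolynomial.IsHomogeneous.sum _ _ _ fun α _ => ?_
  refine MvPolynomial.isHomogeneous_monomial _ ?_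
  rw [Finsupp.degree_eq_sum, α.sum_eq]

/-- The vector of normalized monomials of degree `d`. -/
noncomputable def veronese {n : ℕ} (d : ℕ) (x : EuclideanSpace ℝ (Fin n)) :
    EuclideanSpace ℝ (Exponent n d) :=
  WithLp.toLp 2 fun α => √((α : Fin n →₀ ℕ).multinomial : ℝ) * ∏ j, x j ^ (α : Fin n →₀ ℕ) j

lemma eval_form {n d : ℕ} (c : EuclideanSpace ℝ (Exponent n d)) (x : EuclideanSpace ℝ (Fin n)) :
    MvPolynomial.eval (fun j => x j) (form c) = inner ℝ c (veronese d x) := by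
  rw [form, map_sum, PiLp.inner_apply]
  refine Finset.sum_congr rfl fun α _ => ?_
  rw [MvPolynomial.eval_monomial, Finsupp.prod_fintype _ _ (by simp)]
  simp [veronese]
  ring

/-- This is the multinomial theorem. At unit vectors p_i(x) becomes a marginal of C_i in a unit
direction, so the tail and small ball hypotheses apply with unchanged constants. -/
lemma norm_veronese {n d : ℕ} (x : EuclideanSpace ℝ (Fin n)) : ‖veronese d x‖ = ‖x‖ ^ d := by
  have h : ‖veronese d x‖ ^ 2 = (‖x‖ ^ d) ^ 2 := by
    rw [EuclideanSpace.norm_sq_eq, ← pow_mul, mul_comm d, pow_mul, EuclideanSpace.norm_sq_eq,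
      Finset.sum_pow_eq_sum_piAntidiag]
    simp only [veronese, Real.norm_eq_abs, sq_abs, mul_pow]
    rw [Finset.sum_coe_sort (Finset.finsuppAntidiag (Finset.univ : Finset (Fin n)) d)
      (fun α : Fin n →₀ ℕ => √(α.multinomial : ℝ) ^ 2 * (∏ j, x.ofLp j ^ α j) ^ 2)]
    refine Finset.sum_bij' (fun α _ => (α : Fin n → ℕ))
      (fun f _ => Finsupp.equivFunOnFinite.symm f) ?_ ?_ ?_ ?_ ?_
    · intro α hα
      rw [Finset.mem_finsuppAntidiag] at hα
      simp [← hα.1]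
    · intro f hf
      rw [Finset.mem_piAntidiag] at hf
      simp [Finset.mem_finsuppAntidiag, ← hf.1]
    · intro α _
      ext; simp
    · intro f _
      rfl
    · intro α _
      rw [Real.sq_sqrt (Nat.cast_nonneg _),
        Finsupp.multinomial_eq_of_support_subset (Finset.subset_univ α.support),
        ← Finset.prod_pow]
      congr 1
      refine Finset.prod_congr rfl fun j _ => ?_
      rw [← pow_mul, ← pow_mul, mul_comm]
  exact (pow_left_inj₀ (norm_nonneg _) (by positivity) two_ne_zero).1 h

lemma multinomial_pos' {n : ℕ} (α : Fin n →₀ ℕ) : (0 : ℝ) < (α.multinomial : ℝ) := by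
  rw [Finsupp.multinomial_eq]
  exact_mod_cast Nat.multinomial_pos _ _

lemma coeff_form {n d : ℕ} (c : EuclideanSpace ℝ (Exponent n d)) (α : Exponent n d) :
    MvPolynomial.coeff (α : Fin n →₀ ℕ) (form c)
      = √((α : Fin n →₀ ℕ).multinomial : ℝ) * c α := by
  rw [form, MvPolynomial.coeff_sum, Finset.sum_eq_single α]
  · simp
  · intro β _ hβ
    rw [MvPolynomial.coeff_monomial, if_neg]
    exact fun h => hβ (Subtype.ext h)
  · simp

lemma formNorm_form {n d : ℕ} (c : EuclideanSpace ℝ (Exponent n d)) :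
    formNorm d (form c) = ‖c‖ := by
  rw [formNorm, EuclideanSpace.norm_eq]
  congr 1
  refine Finset.sum_congr rfl fun α _ => ?_
  have := multinomial_pos' (α : Fin n →₀ ℕ)
  rw [coeff_form, sq_abs, mul_pow, Real.sq_sqrt this.le, Real.norm_eq_abs, sq_abs]
  field_simp

/-! ### Systems of forms and the minimal gap -/

section System

variable {m n : ℕ} {d : Fin m → ℕ}

/-- The system of forms with given coefficient vectors. -/
noncomputable def formSys (c : ∀ i, EuclideanSpace ℝ (Exponent n (d i))) :
    Fin m → MvPolynomial (Fin n) ℝ := fun i => form (c i)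

lemma sysNorm_formSys (c : ∀ i, EuclideanSpace ℝ (Exponent n (d i))) :
    sysNorm d (formSys c) = √(∑ i, ‖c i‖ ^ 2) := by
  simp [sysNorm, formSys, formNorm_form]

lemma sysEval_formSys (c : ∀ i, EuclideanSpace ℝ (Exponent n (d i)))
    (x : EuclideanSpace ℝ (Fin n)) (i : Fin m) :
    sysEval (formSys c) x i = inner ℝ (c i) (veronese (d i) x) := by
  simp [sysEval, formSys, eval_form]

lemma norm_sysEval_formSys_le (c : ∀ i, EuclideanSpace ℝ (Exponent n (d i)))
    {x : EuclideanSpace ℝ (Fin n)} (hx : ‖x‖ = 1) :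
    ‖sysEval (formSys c) x‖ ≤ sysNorm d (formSys c) := by
  rw [sysNorm_formSys, EuclideanSpace.norm_eq]
  refine Real.sqrt_le_sqrt (Finset.sum_le_sum fun i _ => ?_)
  rw [sysEval_formSys]
  have := norm_inner_le_norm (𝕜 := ℝ) (c i) (veronese (d i) x)
  rw [norm_veronese, hx, one_pow, mul_one] at this
  gcongr

lemma continuous_veronese (d : ℕ) :
    Continuous (veronese d : EuclideanSpace ℝ (Fin n) → EuclideanSpace ℝ (Exponent n d)) := by
  unfold veronese
  fun_prop

lemma continuous_sysEval_formSys :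
    Continuous fun p : (∀ i, EuclideanSpace ℝ (Exponent n (d i))) × EuclideanSpace ℝ (Fin n) =>
      sysEval (formSys p.1) p.2 := by
  have : (fun p : (∀ i, EuclideanSpace ℝ (Exponent n (d i))) × EuclideanSpace ℝ (Fin n) =>
      sysEval (formSys p.1) p.2) = fun p => WithLp.toLp 2 fun i =>
        inner ℝ (p.1 i) (veronese (d i) p.2) := by
    funext p; ext i; exact sysEval_formSys _ _ i
  rw [this]
  refine (PiLp.continuous_toLp 2 _).comp (continuous_pi fun i => ?_)
  exact ((continuous_apply i).comp continuous_fst).inner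
    ((continuous_veronese (d i)).comp continuous_snd)

lemma eval_pderiv_form {d : ℕ} (c : EuclideanSpace ℝ (Exponent n d)) (j : Fin n)
    (x : Fin n → ℝ) : MvPolynomial.eval x (MvPolynomial.pderiv j (form c)) =
      ∑ α : Exponent n d, √((α : Fin n →₀ ℕ).multinomial : ℝ) * c α *
        MvPolynomial.eval x (MvPolynomial.pderiv j
          (MvPolynomial.monomial (α : Fin n →₀ ℕ) (1 : ℝ))) := by
  rw [form, map_sum, map_sum]
  refine Finset.sum_congr rfl fun α _ => ?_
  rw [← mul_one (√((α : Fin n →₀ ℕ).multinomial : ℝ) * c α), ← MvPolynomial.C_mul_monomial,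
    MvPolynomial.pderiv_C_mul, map_mul, MvPolynomial.eval_C, mul_one]

lemma continuous_dirDeriv_formSys (i : Fin m) :
    Continuous fun p : (∀ i, EuclideanSpace ℝ (Exponent n (d i))) ×
      (EuclideanSpace ℝ (Fin n) × EuclideanSpace ℝ (Fin n)) =>
      dirDeriv (formSys p.1) p.2.1 p.2.2 i := by
  simp only [dirDeriv_apply, formSys, eval_pderiv_form]
  refine continuous_finsetSum _ fun j _ => Continuous.mul ?_ (by fun_prop)
  refine continuous_finsetSum _ fun α _ => Continuous.mul (by fun_prop) ?_
  exact (MvPolynomial.continuous_eval _).comp (by fun_prop)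

/-- The square of the denominator of the local condition number, with the tangent direction made
explicit. -/
noncomputable def gap (d : Fin m → ℕ) (P : Fin m → MvPolynomial (Fin n) ℝ)
    (p : EuclideanSpace ℝ (Fin n) × EuclideanSpace ℝ (Fin n)) : ℝ :=
  ∑ i, dirDeriv P p.1 p.2 i ^ 2 / d i + ‖sysEval P p.1‖ ^ 2

lemma gap_nonneg (P : Fin m → MvPolynomial (Fin n) ℝ)
    (p : EuclideanSpace ℝ (Fin n) × EuclideanSpace ℝ (Fin n)) : 0 ≤ gap d P p := by
  unfold gap; positivity

/-- Orthonormal pairs of vectors. -/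
def orthoPairs (n : ℕ) : Set (EuclideanSpace ℝ (Fin n) × EuclideanSpace ℝ (Fin n)) :=
  {p | ‖p.1‖ = 1 ∧ ‖p.2‖ = 1 ∧ inner ℝ p.1 p.2 = 0}

lemma isCompact_orthoPairs (n : ℕ) : IsCompact (orthoPairs n) := by
  refine ((isCompact_sphere (0 : EuclideanSpace ℝ (Fin n)) 1).prod
    (isCompact_sphere (0 : EuclideanSpace ℝ (Fin n)) 1)).of_isClosed_subset ?_ ?_
  · refine (isClosed_eq (by fun_prop) (by fun_prop)).inter
      ((isClosed_eq (by fun_prop) (by fun_prop)).inter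
        (isClosed_eq (continuous_fst.inner continuous_snd) (by fun_prop)))
  · rintro ⟨x, y⟩ ⟨h1, h2, -⟩
    simp_all

lemma orthoPairs_nonempty (hn : 2 ≤ n) : (orthoPairs n).Nonempty := by
  refine ⟨(EuclideanSpace.single ⟨0, by omega⟩ 1, EuclideanSpace.single ⟨1, by omega⟩ 1), ?_⟩
  simp [orthoPairs, EuclideanSpace.inner_single_left]

lemma continuous_gap_formSys :
    Continuous fun p : (∀ i, EuclideanSpace ℝ (Exponent n (d i))) ×
      (EuclideanSpace ℝ (Fin n) × EuclideanSpace ℝ (Fin n)) => gap d (formSys p.1) p.2 := by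
  refine (continuous_finsetSum _ fun i _ => ((continuous_dirDeriv_formSys i).pow 2).div_const _).add
    ?_
  exact ((continuous_sysEval_formSys.comp
    (continuous_fst.prodMk (continuous_fst.comp continuous_snd))).norm).pow 2

/-- The minimum of `gap` over all orthonormal pairs. -/
noncomputable def minGap (c : ∀ i, EuclideanSpace ℝ (Exponent n (d i))) : ℝ :=
  sInf (gap d (formSys c) '' orthoPairs n)

/-- A minimum over a compact set of a jointly continuous function. This is the source of the
measurability of the condition number. -/
lemma continuous_minGap :
    Continuous (minGap : (∀ i, EuclideanSpace ℝ (Exponent n (d i))) → ℝ) :=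
  (isCompact_orthoPairs n).continuous_sInf continuous_gap_formSys

lemma exists_minGap (hn : 2 ≤ n) (c : ∀ i, EuclideanSpace ℝ (Exponent n (d i))) :
    ∃ p ∈ orthoPairs n, gap d (formSys c) p = minGap c := by
  have hc : Continuous (gap d (formSys c)) :=
    Continuous.uncurry_left c (f := fun c p => gap d (formSys c) p) continuous_gap_formSys
  obtain ⟨p, hp, h⟩ := ((isCompact_orthoPairs n).image hc).sInf_mem
    ((orthoPairs_nonempty hn).image _)
  exact ⟨p, hp, h⟩

lemma minGap_le (c : ∀ i, EuclideanSpace ℝ (Exponent n (d i)))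
    {p : EuclideanSpace ℝ (Fin n) × EuclideanSpace ℝ (Fin n)} (hp : p ∈ orthoPairs n) :
    minGap c ≤ gap d (formSys c) p :=
  csInf_le ⟨0, by rintro _ ⟨q, -, rfl⟩; exact gap_nonneg _ _⟩ ⟨p, hp, rfl⟩

lemma minGap_nonneg (c : ∀ i, EuclideanSpace ℝ (Exponent n (d i))) : 0 ≤ minGap c :=
  Real.sInf_nonneg (by rintro _ ⟨q, -, rfl⟩; exact gap_nonneg _ _)

end System

/-! ### The largest singular value as an attained operator norm -/

section SingularValue

variable {E F : Type*} [NormedAddCommGroup E] [InnerProductSpace ℝ E] [FiniteDimensional ℝ E]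
  [NormedAddCommGroup F] [InnerProductSpace ℝ F] [FiniteDimensional ℝ F]

lemma norm_apply_le_singularValues (T : E →ₗ[ℝ] F) (u : E) :
    ‖T u‖ ≤ T.singularValues 0 * ‖u‖ := by
  have h0 := T.singularValues_nonneg 0
  refine le_of_sq_le_sq ?_ (by positivity)
  have hS := T.isSymmetric_adjoint_comp_self
  set b := hS.eigenvectorBasis rfl with hb
  have h1 : ‖T u‖ ^ 2 = ∑ i, hS.eigenvalues rfl i * (b.repr u i) ^ 2 := by
    rw [← real_inner_self_eq_norm_sq, ← LinearMap.adjoint_inner_left, ← LinearMap.comp_apply,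
      ← b.repr.inner_map_map, PiLp.inner_apply]
    refine Finset.sum_congr rfl fun i _ => ?_
    rw [hb, hS.eigenvectorBasis_apply_self_apply]
    simp
    ring
  have h2 : ‖u‖ ^ 2 = ∑ i, (b.repr u i) ^ 2 := by
    rw [← b.repr.norm_map u, EuclideanSpace.norm_sq_eq]
    simp
  rw [h1, mul_pow, h2, Finset.mul_sum]
  refine Finset.sum_le_sum fun i _ => mul_le_mul_of_nonneg_right ?_ (sq_nonneg _)
  rw [← T.sq_singularValues_fin rfl i]
  have := T.singularValues_antitone (Nat.zero_le (i : ℕ))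
  have h3 := T.singularValues_nonneg i
  gcongr

lemma exists_norm_apply_eq_singularValues [Nontrivial E] (T : E →ₗ[ℝ] F) :
    ∃ u : E, ‖u‖ = 1 ∧ ‖T u‖ = T.singularValues 0 := by
  obtain ⟨v, hv⟩ := (T.hasEigenvalue_adjoint_comp_self_sq_singularValues
    (n := 0) Module.finrank_pos).exists_hasEigenvector
  have h1 : ‖T v‖ = T.singularValues 0 * ‖v‖ := by
    refine (pow_left_inj₀ (norm_nonneg _)
      (mul_nonneg (T.singularValues_nonneg 0) (norm_nonneg _)) two_ne_zero).1 ?_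
    rw [← real_inner_self_eq_norm_sq, ← LinearMap.adjoint_inner_left, ← LinearMap.comp_apply,
      hv.apply_eq_smul, inner_smul_left, real_inner_self_eq_norm_sq]
    simp; ring
  have hv0 : ‖v‖ ≠ 0 := norm_ne_zero_iff.2 hv.2
  refine ⟨‖v‖⁻¹ • v, ?_, ?_⟩
  · rw [norm_smul, norm_inv, norm_norm, inv_mul_cancel₀ hv0]
  · rw [map_smul, norm_smul, norm_inv, norm_norm, h1]
    field_simp

end SingularValue

/-! ### The condition number in terms of the minimal gap -/

section Kappa

variable {m n : ℕ} {d : Fin m → ℕ} {P : Fin m → MvPolynomial (Fin n) ℝ}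
  {x y : EuclideanSpace ℝ (Fin n)}

lemma mem_tangent_iff : y ∈ tangent x ↔ inner ℝ x y = 0 :=
  Submodule.mem_orthogonal_singleton_iff_inner_right

lemma tangentDeriv_apply (y : tangent x) : tangentDeriv P x y = dirDeriv P x y := rfl

lemma degreeScaling_apply (u : EuclideanSpace ℝ (Fin m)) (i : Fin m) :
    degreeScaling d u i = √(d i : ℝ) * u i := by
  simp [degreeScaling, Matrix.toLpLin_apply, Matrix.mulVec_diagonal]

lemma finrank_tangent (hn : m + 1 = n) (hx : ‖x‖ = 1) : Module.finrank ℝ (tangent x) = m := by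
  have hx0 : x ≠ 0 := by rintro rfl; simp at hx
  have h := Submodule.finrank_add_finrank_orthogonal (Submodule.span ℝ {x})
  rw [finrank_span_singleton hx0, finrank_euclideanSpace, Fintype.card_fin] at h
  change Module.finrank ℝ ↥(Submodule.span ℝ {x})ᗮ = m
  omega

/-- The square of the denominator in `kappaAt`. -/
noncomputable def kappaDenom (d : Fin m → ℕ) (P : Fin m → MvPolynomial (Fin n) ℝ)
    (x : EuclideanSpace ℝ (Fin n)) : ℝ≥0∞ :=
  ENNReal.ofReal (sysNorm d P) ^ 2 * (muNorm d P x ^ 2)⁻¹ + ENNReal.ofReal ‖sysEval P x‖ ^ 2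

lemma sysNorm_mul_inv_muNorm (hW : 0 < sysNorm d P) (h : Function.Bijective (tangentDeriv P x))
    (hσ : 0 < ((LinearEquiv.ofBijective (tangentDeriv P x) h).symm.toLinearMap ∘ₗ
        degreeScaling d).singularValues 0) :
    ENNReal.ofReal (sysNorm d P) ^ 2 * (muNorm d P x ^ 2)⁻¹ =
      ENNReal.ofReal ((((LinearEquiv.ofBijective (tangentDeriv P x) h).symm.toLinearMap ∘ₗ
        degreeScaling d).singularValues 0 ^ 2)⁻¹) := by
  rw [muNorm, dif_pos h, ← ENNReal.ofReal_pow hW.le, ← ENNReal.ofReal_pow (by positivity),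
    ← ENNReal.ofReal_inv_of_pos (by positivity), ← ENNReal.ofReal_mul (by positivity)]
  congr 1
  field_simp

/-- If u is a unit vector at which R = (D_xP)⁻¹Δ attains its norm σ, then y = σ⁻¹Ru is a unit
tangent vector with Δ⁻¹DP(x)y = σ⁻¹u. In the singular case equality of dimensions gives a kernel
vector, and both derivative terms vanish. -/
lemma exists_kappaDenom_eq (hn : m + 1 = n) (hm : 0 < m) (hd : ∀ i, 1 ≤ d i)
    (hW : 0 < sysNorm d P) (hx : ‖x‖ = 1) :
    ∃ y, (x, y) ∈ orthoPairs n ∧ kappaDenom d P x = ENNReal.ofReal (gap d P (x, y)) := by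
  have hd' : ∀ i, (0 : ℝ) < d i := fun i => by exact_mod_cast hd i
  have : Nonempty (Fin m) := ⟨⟨0, hm⟩⟩
  by_cases h : Function.Bijective (tangentDeriv P x)
  · set R := (LinearEquiv.ofBijective (tangentDeriv P x) h).symm.toLinearMap ∘ₗ
      degreeScaling d with hR
    have hTR : ∀ u, tangentDeriv P x (R u) = degreeScaling d u := fun u =>
      (LinearEquiv.ofBijective (tangentDeriv P x) h).apply_symm_apply (degreeScaling d u)
    obtain ⟨u, hu, hRu⟩ := exists_norm_apply_eq_singularValues R
    have hσ : 0 < R.singularValues 0 := by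
      refine lt_of_le_of_ne (R.singularValues_nonneg 0) fun h0 => ?_
      have h1 : R u = 0 := norm_eq_zero.1 (hRu.trans h0.symm)
      have h2 := hTR u
      rw [h1, map_zero] at h2
      have h3 : u = 0 := by
        ext i
        have := congrArg (fun v : EuclideanSpace ℝ (Fin m) => v i) h2
        simp only [degreeScaling_apply] at this
        have h4 : √(d i : ℝ) ≠ 0 := (Real.sqrt_pos.2 (hd' i)).ne'
        simpa [h4] using this.symm
      rw [h3, norm_zero] at hu
      exact zero_ne_one hu
    set σ := R.singularValues 0
    refine ⟨σ⁻¹ • (R u : EuclideanSpace ℝ (Fin n)), ⟨hx, ?_, ?_⟩, ?_⟩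
    · rw [norm_smul, norm_inv, Real.norm_of_nonneg hσ.le]
      have : ‖(R u : EuclideanSpace ℝ (Fin n))‖ = σ := hRu
      rw [this, inv_mul_cancel₀ hσ.ne']
    · exact mem_tangent_iff.1 ((tangent x).smul_mem _ (R u).2)
    · rw [kappaDenom, sysNorm_mul_inv_muNorm hW h hσ, gap, ENNReal.ofReal_add (by positivity)
        (by positivity), ENNReal.ofReal_pow (norm_nonneg _)]
      congr 2
      have h1 : dirDeriv P x (σ⁻¹ • (R u : EuclideanSpace ℝ (Fin n)))
          = σ⁻¹ • degreeScaling d u := by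
        rw [← hTR u, ← map_smul, tangentDeriv_apply]; rfl
      have h2 : ∑ i, u i ^ 2 = 1 := by
        have := EuclideanSpace.norm_sq_eq u
        rw [hu] at this
        simpa using this.symm
      simp only [h1]
      change (σ ^ 2)⁻¹ = _
      rw [← mul_one (σ ^ 2)⁻¹, ← h2, Finset.mul_sum]
      refine Finset.sum_congr rfl fun i _ => ?_
      rw [PiLp.smul_apply, degreeScaling_apply, smul_eq_mul, mul_pow, mul_pow,
        Real.sq_sqrt (hd' i).le]
      have := (hd' i).ne'
      field_simp
  · have hinj : ¬ Function.Injective (tangentDeriv P x) := fun hi => h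
      ⟨hi, (LinearMap.injective_iff_surjective_of_finrank_eq_finrank (by
        rw [finrank_tangent hn hx, finrank_euclideanSpace, Fintype.card_fin])).1 hi⟩
    rw [← LinearMap.ker_eq_bot, Submodule.eq_bot_iff] at hinj
    push Not at hinj
    obtain ⟨v, hv, hv0⟩ := hinj
    have hvn : ‖v‖ ≠ 0 := norm_ne_zero_iff.2 hv0
    refine ⟨‖v‖⁻¹ • (v : EuclideanSpace ℝ (Fin n)), ⟨hx, ?_, ?_⟩, ?_⟩
    · rw [norm_smul, norm_inv, norm_norm]
      exact inv_mul_cancel₀ hvn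
    · exact mem_tangent_iff.1 ((tangent x).smul_mem _ v.2)
    · have h1 : dirDeriv P x (‖v‖⁻¹ • (v : EuclideanSpace ℝ (Fin n))) = 0 := by
        have : tangentDeriv P x (‖v‖⁻¹ • v) = 0 := by
          rw [map_smul, LinearMap.mem_ker.1 hv, smul_zero]
        exact this
      rw [kappaDenom, muNorm, dif_neg h, gap, h1, ← ENNReal.ofReal_pow (norm_nonneg _)]
      simp

/-- The vector u = Δ⁻¹DP(x)y satisfies Ru = y, so 1 ≤ σ‖u‖. If D_xP is not invertible, the
derivative term on the left is 0. -/
lemma kappaDenom_le (hd : ∀ i, 1 ≤ d i) (hW : 0 < sysNorm d P) (hp : (x, y) ∈ orthoPairs n) :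
    kappaDenom d P x ≤ ENNReal.ofReal (gap d P (x, y)) := by
  obtain ⟨hx, hy, hxy⟩ := hp
  have hd' : ∀ i, (0 : ℝ) < d i := fun i => by exact_mod_cast hd i
  rw [kappaDenom, gap, ENNReal.ofReal_add (by positivity)
        (by positivity), ENNReal.ofReal_pow (norm_nonneg _)]
  refine add_le_add ?_ le_rfl
  by_cases h : Function.Bijective (tangentDeriv P x)
  · set R := (LinearEquiv.ofBijective (tangentDeriv P x) h).symm.toLinearMap ∘ₗ
      degreeScaling d with hR
    let y' : tangent x := ⟨y, mem_tangent_iff.2 hxy⟩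
    let u : EuclideanSpace ℝ (Fin m) := WithLp.toLp 2 fun i => dirDeriv P x y i / √(d i : ℝ)
    have hu : degreeScaling d u = tangentDeriv P x y' := by
      ext i
      have h4 : √(d i : ℝ) ≠ 0 := (Real.sqrt_pos.2 (hd' i)).ne'
      rw [degreeScaling_apply, tangentDeriv_apply]
      simp only [u, y']
      field_simp
    have hRu : R u = y' := by
      rw [hR, LinearMap.comp_apply, hu]
      exact (LinearEquiv.ofBijective (tangentDeriv P x) h).symm_apply_apply y'
    have h1 := norm_apply_le_singularValues R u
    rw [hRu] at h1
    have hy' : ‖y'‖ = 1 := hy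
    rw [hy'] at h1
    have hσ : 0 < R.singularValues 0 := by
      refine lt_of_le_of_ne (R.singularValues_nonneg 0) fun h0 => ?_
      rw [← h0, zero_mul] at h1
      linarith
    rw [sysNorm_mul_inv_muNorm hW h hσ]
    refine ENNReal.ofReal_le_ofReal ?_
    change (R.singularValues 0 ^ 2)⁻¹ ≤ _
    have h2 : ∑ i, dirDeriv P x y i ^ 2 / (d i : ℝ) = ‖u‖ ^ 2 := by
      rw [EuclideanSpace.norm_sq_eq]
      refine Finset.sum_congr rfl fun i _ => ?_
      simp only [u, Real.norm_eq_abs, sq_abs, div_pow]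
      rw [Real.sq_sqrt (hd' i).le]
    simp only [h2]
    rw [inv_le_iff_one_le_mul₀ (by positivity), ← mul_pow, mul_comm]
    exact one_le_pow₀ h1
  · rw [muNorm, dif_neg h]
    simp

lemma kappa_formSys (hn : m + 1 = n) (hm : 0 < m) (hd : ∀ i, 1 ≤ d i)
    (c : ∀ i, EuclideanSpace ℝ (Exponent n (d i))) (hW : 0 < sysNorm d (formSys c)) :
    kappa d (formSys c) =
      ENNReal.ofReal (sysNorm d (formSys c)) / ENNReal.ofReal (√(minGap c)) := by
  have hsq : ENNReal.ofReal (√(minGap c)) = ENNReal.ofReal (minGap c) ^ (1 / 2 : ℝ) := by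
    rw [ENNReal.ofReal_rpow_of_nonneg (minGap_nonneg c) (by norm_num), Real.sqrt_eq_rpow]
  rw [hsq]
  refine le_antisymm (iSup₂_le fun x hx => ?_) ?_
  · rw [mem_sphere_zero_iff_norm] at hx
    obtain ⟨y, hy, hxy⟩ := exists_kappaDenom_eq hn hm hd hW hx
    change _ / kappaDenom d (formSys c) x ^ (1 / 2 : ℝ) ≤ _
    rw [hxy]
    refine ENNReal.div_le_div_left (ENNReal.rpow_le_rpow ?_ (by norm_num)) _
    exact ENNReal.ofReal_le_ofReal (minGap_le c hy)
  · obtain ⟨⟨x, y⟩, hp, hxy⟩ := exists_minGap (by omega) c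
    have hx : x ∈ Metric.sphere (0 : EuclideanSpace ℝ (Fin n)) 1 := by
      rw [mem_sphere_zero_iff_norm]; exact hp.1
    refine le_trans ?_ (le_iSup₂ (f := fun x _ => kappaAt d (formSys c) x) x hx)
    change _ ≤ _ / kappaDenom d (formSys c) x ^ (1 / 2 : ℝ)
    rw [← hxy]
    exact ENNReal.div_le_div_left (ENNReal.rpow_le_rpow (kappaDenom_le hd hW hp) (by norm_num)) _

lemma kappa_eq_zero_of_sysNorm (h : sysNorm d P = 0) : kappa d P = 0 := by
  simp [kappa, kappaAt, h]

end Kappa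

/-! ### Moments of one-dimensional marginals by the layer cake formula -/

lemma integral_mul_exp_mul_sq (b x : ℝ) :
    ∫ t in (0 : ℝ)..x, 2 * b * t * Real.exp (b * t ^ 2) = Real.exp (b * x ^ 2) - 1 := by
  have h : ∀ t ∈ Set.uIcc 0 x, HasDerivAt (fun t : ℝ => Real.exp (b * t ^ 2))
      (2 * b * t * Real.exp (b * t ^ 2)) t := by
    intro t _
    have := (((hasDerivAt_id t).pow 2).const_mul b).exp
    refine this.congr_deriv ?_
    simp; ring
  rw [intervalIntegral.integral_eq_sub_of_hasDerivAt h
    (Continuous.intervalIntegrable (by fun_prop) _ _)]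
  simp

lemma lintegral_mul_exp_neg_mul_sq {b : ℝ} (hb : 0 < b) :
    ∫⁻ t in Set.Ioi (0 : ℝ), ENNReal.ofReal (t * Real.exp (-b * t ^ 2))
      = ENNReal.ofReal (1 / (2 * b)) := by
  have h1 := integral_rpow_mul_exp_neg_mul_rpow (p := 2) (q := 1) two_pos (by norm_num) hb
  have h2 := integrableOn_rpow_mul_exp_neg_mul_rpow (s := 1) (p := 2) (by norm_num) two_pos hb
  simp only [Real.rpow_one, Real.rpow_two] at h1 h2
  rw [← ofReal_integral_eq_lintegral_ofReal h2, h1]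
  · congr 1
    norm_num
    rw [Real.rpow_neg_one]
  · filter_upwards [ae_restrict_mem measurableSet_Ioi] with t ht
    have : 0 < t := ht
    positivity

lemma lintegral_sq_mul_exp_neg_mul_sq {b : ℝ} (hb : 0 < b) :
    ∫⁻ t in Set.Ioi (0 : ℝ), ENNReal.ofReal (t ^ 2 * Real.exp (-b * t ^ 2))
      = ENNReal.ofReal (√(Real.pi / b) / (4 * b)) := by
  have h1 := integral_rpow_mul_exp_neg_mul_rpow (p := 2) (q := 2) two_pos (by norm_num) hb
  have h2 := integrableOn_rpow_mul_exp_neg_mul_rpow (s := 2) (p := 2) (by norm_num) two_pos hb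
  simp only [Real.rpow_two] at h1 h2
  rw [← ofReal_integral_eq_lintegral_ofReal h2, h1]
  · congr 1
    have e1 : Real.Gamma ((2 + 1) / 2) = √Real.pi / 2 := by
      have : ((2 : ℝ) + 1) / 2 = 1 / 2 + 1 := by norm_num
      rw [this, Real.Gamma_add_one (by norm_num), Real.Gamma_one_half_eq]; ring
    have e2 : b ^ (-(2 + 1 : ℝ) / 2) = 1 / (b * √b) := by
      have : (-(2 + 1 : ℝ) / 2) = -(1 + 1 / 2) := by norm_num
      rw [this, Real.rpow_neg hb.le, Real.rpow_add hb, Real.rpow_one, ← Real.sqrt_eq_rpow, one_div]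
    rw [e1, e2, Real.sqrt_div Real.pi_pos.le]
    have : √b ≠ 0 := by positivity
    field_simp
    norm_num
  · filter_upwards with t
    positivity

section OneDim

variable {Ω : Type*} [MeasurableSpace Ω] {μ : Measure Ω} [IsProbabilityMeasure μ] {ξ : Ω → ℝ}

/-- Exponential square moment of a sub-Gaussian variable. -/
lemma lintegral_exp_sq_le (hξ : Measurable ξ) {K : ℝ} (hK : 0 < K)
    (h : ∀ t : ℝ, 0 < t → μ.real {ω | t ≤ |ξ ω|} ≤ 2 * Real.exp (-(t ^ 2 / K ^ 2))) :
    ∫⁻ ω, ENNReal.ofReal (Real.exp (4 / 5 / K ^ 2 * ξ ω ^ 2)) ∂μ ≤ 9 := by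
  -- With an exponent β/K², β < 1, the layer cake bound is 1 + 2β/(1 - β), which is 9 at β = 4/5.
  set b := 4 / 5 / K ^ 2 with hb
  have hb0 : 0 < b := by positivity
  have h1 := lintegral_comp_eq_lintegral_meas_le_mul μ (f := fun ω => |ξ ω|)
    (g := fun t => 2 * b * t * Real.exp (b * t ^ 2)) (ae_of_all _ fun ω => abs_nonneg _)
    (by fun_prop) (fun t _ => Continuous.intervalIntegrable (by fun_prop) _ _)
    (by
      filter_upwards [ae_restrict_mem measurableSet_Ioi] with t ht
      have : 0 < t := ht
      positivity)
  simp only [integral_mul_exp_mul_sq, sq_abs] at h1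
  have h2 : ∀ ω, ENNReal.ofReal (Real.exp (b * ξ ω ^ 2)) =
      1 + ENNReal.ofReal (Real.exp (b * ξ ω ^ 2) - 1) := by
    intro ω
    rw [← ENNReal.ofReal_one, ← ENNReal.ofReal_add zero_le_one]
    · congr 1; ring
    · have := Real.one_le_exp (show 0 ≤ b * ξ ω ^ 2 by positivity)
      linarith
  simp only [h2]
  rw [lintegral_add_left measurable_const, lintegral_const, measure_univ, one_mul, h1]
  have h3 : ∫⁻ t in Set.Ioi (0 : ℝ), μ {a | t ≤ |ξ a|} *
      ENNReal.ofReal (2 * b * t * Real.exp (b * t ^ 2)) ≤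
      ∫⁻ t in Set.Ioi (0 : ℝ), ENNReal.ofReal (4 * b) *
        ENNReal.ofReal (t * Real.exp (-(1 / 5 / K ^ 2) * t ^ 2)) := by
    refine setLIntegral_mono' measurableSet_Ioi fun t ht => ?_
    have ht' : 0 < t := ht
    have h4 : μ {a | t ≤ |ξ a|} ≤ ENNReal.ofReal (2 * Real.exp (-(t ^ 2 / K ^ 2))) := by
      rw [← ofReal_measureReal]
      exact ENNReal.ofReal_le_ofReal (h t ht')
    refine (mul_le_mul_left h4 _).trans (le_of_eq ?_)
    rw [← ENNReal.ofReal_mul (by positivity), ← ENNReal.ofReal_mul (by positivity)]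
    congr 1
    have : Real.exp (-(1 / 5 / K ^ 2) * t ^ 2)
        = Real.exp (-(t ^ 2 / K ^ 2)) * Real.exp (b * t ^ 2) := by
      rw [← Real.exp_add, hb]; congr 1; field_simp; ring
    rw [this]; ring
  have h5 := lintegral_mul_exp_neg_mul_sq (b := 1 / 5 / K ^ 2) (by positivity)
  rw [lintegral_const_mul _ (by fun_prop), h5, ← ENNReal.ofReal_mul (by positivity)] at h3
  refine (add_le_add le_rfl h3).trans (le_of_eq ?_)
  rw [← ENNReal.ofReal_one, ← ENNReal.ofReal_add zero_le_one (by positivity), hb]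
  have : (1 + 4 * (4 / 5 / K ^ 2) * (1 / (2 * (1 / 5 / K ^ 2))) : ℝ) = 9 := by
    field_simp; norm_num
  rw [this]; norm_num

lemma integrable_exp_sq (hξ : Measurable ξ) {K : ℝ} (hK : 0 < K)
    (h : ∀ t : ℝ, 0 < t → μ.real {ω | t ≤ |ξ ω|} ≤ 2 * Real.exp (-(t ^ 2 / K ^ 2))) :
    Integrable (fun ω => Real.exp (4 / 5 / K ^ 2 * ξ ω ^ 2)) μ := by
  refine ⟨by fun_prop, ?_⟩
  rw [hasFiniteIntegral_iff_ofReal (ae_of_all _ fun ω => (Real.exp_pos _).le)]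
  exact (lintegral_exp_sq_le hξ hK h).trans_lt (by norm_num)

lemma integral_exp_sq_le (hξ : Measurable ξ) {K : ℝ} (hK : 0 < K)
    (h : ∀ t : ℝ, 0 < t → μ.real {ω | t ≤ |ξ ω|} ≤ 2 * Real.exp (-(t ^ 2 / K ^ 2))) :
    ∫ ω, Real.exp (4 / 5 / K ^ 2 * ξ ω ^ 2) ∂μ ≤ 9 := by
  rw [integral_eq_lintegral_of_nonneg_ae (ae_of_all _ fun ω => (Real.exp_pos _).le) (by fun_prop)]
  exact ENNReal.toReal_le_of_le_ofReal (by norm_num)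
    ((lintegral_exp_sq_le hξ hK h).trans (by norm_num))

/-- Laplace transform of the square of a variable with a small ball property. -/
lemma integral_exp_neg_sq_le (hξ : Measurable ξ) {c₀ b : ℝ} (hc : 0 < c₀) (hb : 0 < b)
    (h : ∀ t : ℝ, 0 < t → μ.real {ω | |ξ ω| ≤ t} ≤ c₀ * t) :
    ∫ ω, Real.exp (-b * ξ ω ^ 2) ∂μ ≤ c₀ * √(Real.pi / b) / 2 := by
  have h1 := lintegral_comp_eq_lintegral_meas_le_mul μ (f := fun ω => |ξ ω|)
    (g := fun t => 2 * b * t * Real.exp (-b * t ^ 2)) (ae_of_all _ fun ω => abs_nonneg _)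
    (by fun_prop) (fun t _ => Continuous.intervalIntegrable (by fun_prop) _ _)
    (by
      filter_upwards [ae_restrict_mem measurableSet_Ioi] with t ht
      have : 0 < t := ht
      positivity)
  have hint : ∀ x : ℝ, ∫ t in (0 : ℝ)..x, 2 * b * t * Real.exp (-b * t ^ 2)
      = 1 - Real.exp (-b * x ^ 2) := by
    intro x
    have e := integral_mul_exp_mul_sq (-b) x
    have e2 : ∀ t : ℝ, 2 * -b * t * Real.exp (-b * t ^ 2)
        = -(2 * b * t * Real.exp (-b * t ^ 2)) := fun t => by ring
    simp only [e2, intervalIntegral.integral_neg] at e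
    linarith
  simp only [hint, sq_abs] at h1
  have hexp : Integrable (fun ω => Real.exp (-b * ξ ω ^ 2)) μ := by
    refine Integrable.of_bound (C := 1) (by fun_prop) (ae_of_all _ fun ω => ?_)
    rw [Real.norm_of_nonneg (Real.exp_pos _).le, Real.exp_le_one_iff]
    have : 0 ≤ b * ξ ω ^ 2 := by positivity
    linarith
  have hsub : Integrable (fun ω => 1 - Real.exp (-b * ξ ω ^ 2)) μ := (integrable_const 1).sub hexp
  rw [← ofReal_integral_eq_lintegral_ofReal hsub
    (ae_of_all _ fun ω => by
      have : 0 ≤ b * ξ ω ^ 2 := by positivity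
      have := Real.exp_le_one_iff.2 (show -b * ξ ω ^ 2 ≤ 0 by linarith)
      simp only [Pi.zero_apply]; linarith),
    integral_sub (integrable_const 1) hexp, integral_const, probReal_univ, one_smul] at h1
  have h2 : ∫⁻ t in Set.Ioi (0 : ℝ), ENNReal.ofReal (2 * b) *
        ENNReal.ofReal (t * Real.exp (-b * t ^ 2)) ≤
      ∫⁻ t in Set.Ioi (0 : ℝ), (ENNReal.ofReal (2 * b * c₀) *
        ENNReal.ofReal (t ^ 2 * Real.exp (-b * t ^ 2)) +
        μ {a | t ≤ |ξ a|} * ENNReal.ofReal (2 * b * t * Real.exp (-b * t ^ 2))) := by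
    refine setLIntegral_mono' measurableSet_Ioi fun t ht => ?_
    have ht' : 0 < t := ht
    -- The small ball property serves as a lower bound 1 - c₀t for the upper tail. It is kept in
    -- additive form because 1 - c₀t may be negative.
    have h3 : 1 ≤ ENNReal.ofReal (c₀ * t) + μ {a | t ≤ |ξ a|} := by
      calc (1 : ℝ≥0∞) = μ Set.univ := measure_univ.symm
        _ ≤ μ ({a | |ξ a| ≤ t} ∪ {a | t ≤ |ξ a|}) := measure_mono fun a _ => (le_total |ξ a| t : _ ∨ _)
        _ ≤ μ {a | |ξ a| ≤ t} + μ {a | t ≤ |ξ a|} := measure_union_le _ _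
        _ ≤ _ := by
          gcongr
          rw [← ofReal_measureReal]
          exact ENNReal.ofReal_le_ofReal (h t ht')
    calc ENNReal.ofReal (2 * b) * ENNReal.ofReal (t * Real.exp (-b * t ^ 2))
        = 1 * ENNReal.ofReal (2 * b * t * Real.exp (-b * t ^ 2)) := by
          rw [← ENNReal.ofReal_mul (by positivity), one_mul]; congr 1; ring
      _ ≤ (ENNReal.ofReal (c₀ * t) + μ {a | t ≤ |ξ a|}) *
            ENNReal.ofReal (2 * b * t * Real.exp (-b * t ^ 2)) := by gcongr
      _ = _ := by
          rw [add_mul]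
          congr 1
          rw [← ENNReal.ofReal_mul (by positivity), ← ENNReal.ofReal_mul (by positivity)]
          congr 1; ring
  rw [lintegral_add_left (by fun_prop), lintegral_const_mul _ (by fun_prop),
    lintegral_const_mul _ (by fun_prop), lintegral_mul_exp_neg_mul_sq hb,
    lintegral_sq_mul_exp_neg_mul_sq hb, ← h1, ← ENNReal.ofReal_mul (by positivity),
    ← ENNReal.ofReal_mul (by positivity)] at h2
  have hle : ∫ ω, Real.exp (-b * ξ ω ^ 2) ∂μ ≤ 1 := by
    have := integral_mono hexp (integrable_const (1 : ℝ)) (fun ω => by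
      have : 0 ≤ b * ξ ω ^ 2 := by positivity
      exact Real.exp_le_one_iff.2 (show -b * ξ ω ^ 2 ≤ 0 by linarith))
    simpa using this
  rw [← ENNReal.ofReal_add (by positivity) (by linarith),
    ENNReal.ofReal_le_ofReal_iff (by positivity)] at h2
  have e1 : 2 * b * (1 / (2 * b)) = 1 := by field_simp
  have e2 : 2 * b * c₀ * (√(Real.pi / b) / (4 * b)) = c₀ * √(Real.pi / b) / 2 := by
    field_simp; norm_num
  rw [e1, e2] at h2
  linarith

/-- The product of the sub-Gaussian and the small ball constants is bounded below. -/
lemma subGaussian_mul_smallBall_ge {K c₀ : ℝ} (hK : 0 < K)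
    (h : ∀ t : ℝ, 0 < t → μ.real {ω | t ≤ |ξ ω|} ≤ 2 * Real.exp (-(t ^ 2 / K ^ 2)))
    (h' : ∀ t : ℝ, 0 < t → μ.real {ω | |ξ ω| ≤ t} ≤ c₀ * t) : 12 / 25 ≤ K * c₀ := by
  -- Splitting at level 2K gives 1 ≤ 2Kc₀ + 2e⁻⁴, and 2e⁻⁴ ≤ 1/25.
  have h1 : 1 ≤ μ.real {ω | |ξ ω| ≤ 2 * K} + μ.real {ω | 2 * K ≤ |ξ ω|} := by
    calc (1 : ℝ) = μ.real Set.univ := probReal_univ.symm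
      _ ≤ μ.real ({a | |ξ a| ≤ 2 * K} ∪ {a | 2 * K ≤ |ξ a|}) :=
        measureReal_mono fun a _ => (le_total |ξ a| (2 * K) : _ ∨ _)
      _ ≤ _ := measureReal_union_le _ _
  have h2 := h (2 * K) (by positivity)
  have h3 := h' (2 * K) (by positivity)
  have e : (2 * K) ^ 2 / K ^ 2 = 4 := by field_simp; norm_num
  rw [e] at h2
  have h4 : Real.exp (-4) ≤ 1 / 50 := by
    rw [Real.exp_neg, one_div]
    apply inv_anti₀ (by norm_num)
    have := Real.exp_one_gt_d9
    have e4 : Real.exp 4 = Real.exp 1 ^ 4 := by rw [← Real.exp_nat_mul]; norm_num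
    rw [e4]
    calc (50 : ℝ) ≤ 2.7182818283 ^ 4 := by norm_num
      _ ≤ _ := by gcongr
  linarith

end OneDim

/-! ### Sums of squares of marginals: small ball and tail bounds -/

section Tensorization

variable {Ω : Type*} [MeasurableSpace Ω] {μ : Measure Ω} [IsProbabilityMeasure μ] {m : ℕ}
  {ξ : Fin m → Ω → ℝ}

lemma measureReal_sum_sq_le (hm : 0 < m) (hξ : ∀ i, Measurable (ξ i)) (hind : iIndepFun ξ μ)
    {c₀ R : ℝ} (hc : 0 < c₀) (hR : 0 < R)
    (h : ∀ i, ∀ t : ℝ, 0 < t → μ.real {ω | |ξ i ω| ≤ t} ≤ c₀ * t) :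
    μ.real {ω | ∑ i, ξ i ω ^ 2 ≤ R ^ 2} ≤ (207 / 100 * c₀ * R / √m) ^ m := by
  have hm' : (0 : ℝ) < m := by exact_mod_cast hm
  -- The minimizer of e^{bR²} b^{-m/2} in Chernoff's bound. It produces the constant √(2πe)/2 <
  -- 207/100.
  set b : ℝ := m / (2 * R ^ 2) with hb
  have hb0 : 0 < b := by positivity
  have hind2 : iIndepFun (fun i ω => ξ i ω ^ 2) μ :=
    hind.comp (fun _ x => x ^ 2) fun _ => by fun_prop
  have hint : ∀ i ∈ (Finset.univ : Finset (Fin m)),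
      Integrable (fun ω => Real.exp (-b * (fun ω => ξ i ω ^ 2) ω)) μ := by
    intro i _
    refine Integrable.of_bound (C := 1) (by fun_prop) (ae_of_all _ fun ω => ?_)
    rw [Real.norm_of_nonneg (Real.exp_pos _).le, Real.exp_le_one_iff]
    have : 0 ≤ b * ξ i ω ^ 2 := by positivity
    linarith
  have h1 := measure_le_le_exp_mul_mgf (μ := μ) (X := ∑ i, fun ω => ξ i ω ^ 2) (t := -b) (R ^ 2)
    (by linarith) (hind2.integrable_exp_mul_sum (fun i => by fun_prop) hint)
  rw [hind2.mgf_sum (fun i => by fun_prop)] at h1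
  simp only [Finset.sum_apply] at h1
  refine h1.trans ?_
  have h2 : ∏ i, mgf (fun ω => ξ i ω ^ 2) μ (-b) ≤ (c₀ * √(Real.pi / b) / 2) ^ m := by
    calc _ ≤ ∏ _i : Fin m, (c₀ * √(Real.pi / b) / 2) :=
          Finset.prod_le_prod (fun _ _ => mgf_nonneg)
            fun i _ => integral_exp_neg_sq_le (hξ i) hc hb0 (h i)
      _ = _ := by rw [Finset.prod_const, Finset.card_univ, Fintype.card_fin]
  have h3 : Real.exp (- -b * R ^ 2) = √(Real.exp 1) ^ m := by
    have : - -b * R ^ 2 = m * (1 / 2) := by rw [hb]; field_simp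
    rw [this, Real.exp_nat_mul, ← Real.exp_half]
  rw [h3]
  calc _ ≤ √(Real.exp 1) ^ m * (c₀ * √(Real.pi / b) / 2) ^ m := by gcongr
    _ = (√(Real.exp 1) * (c₀ * √(Real.pi / b) / 2)) ^ m := by rw [mul_pow]
    _ ≤ _ := by
      refine pow_le_pow_left₀ (by positivity) ?_ m
      have e1 : √(Real.pi / b) = √(2 * Real.pi) * R / √m := by
        rw [hb]
        have : Real.pi / (m / (2 * R ^ 2)) = 2 * Real.pi * R ^ 2 / m := by field_simp
        rw [this, Real.sqrt_div (by positivity), Real.sqrt_mul (by positivity),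
          Real.sqrt_sq hR.le]
      have e2 : √(Real.exp 1) * √(2 * Real.pi) ≤ 207 / 50 := by
        rw [← Real.sqrt_mul (Real.exp_pos _).le]
        refine Real.sqrt_le_iff.2 ⟨by norm_num, ?_⟩
        have := Real.exp_one_lt_d9
        have := Real.pi_lt_d4
        have := Real.pi_pos
        nlinarith
      rw [e1]
      calc √(Real.exp 1) * (c₀ * (√(2 * Real.pi) * R / √m) / 2)
          = (√(Real.exp 1) * √(2 * Real.pi)) * (c₀ * R / √m / 2) := by ring
        _ ≤ 207 / 50 * (c₀ * R / √m / 2) := by gcongr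
        _ = _ := by ring

lemma measureReal_le_sum_sq (hξ : ∀ i, Measurable (ξ i)) (hind : iIndepFun ξ μ)
    {K : ℝ} (hK : 0 < K) (a : ℝ)
    (h : ∀ i, ∀ t : ℝ, 0 < t → μ.real {ω | t ≤ |ξ i ω|} ≤ 2 * Real.exp (-(t ^ 2 / K ^ 2))) :
    μ.real {ω | a ≤ ∑ i, ξ i ω ^ 2} ≤ Real.exp (-(4 / 5 / K ^ 2) * a) * 9 ^ m := by
  have hind2 : iIndepFun (fun i ω => ξ i ω ^ 2) μ :=
    hind.comp (fun _ x => x ^ 2) fun _ => by fun_prop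
  have h1 := measure_ge_le_exp_mul_mgf (μ := μ) (X := ∑ i, fun ω => ξ i ω ^ 2)
    (t := 4 / 5 / K ^ 2) a (by positivity)
    (hind2.integrable_exp_mul_sum (fun i => by fun_prop)
      fun i _ => integrable_exp_sq (hξ i) hK (h i))
  rw [hind2.mgf_sum (fun i => by fun_prop)] at h1
  simp only [Finset.sum_apply] at h1
  refine h1.trans ?_
  gcongr
  calc _ ≤ ∏ _i : Fin m, (9 : ℝ) := Finset.prod_le_prod (fun _ _ => mgf_nonneg)
            fun i _ => integral_exp_sq_le (hξ i) hK (h i)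
    _ = _ := by simp

end Tensorization

/-- Tail bound for a sum of squares of arbitrarily dependent sub-Gaussian variables. -/
lemma measureReal_le_sum_sq_of_dependent {Ω ι : Type*} [MeasurableSpace Ω] {μ : Measure Ω}
    [IsProbabilityMeasure μ] [Fintype ι] [Nonempty ι] {ξ : ι → Ω → ℝ}
    (hξ : ∀ i, Measurable (ξ i)) {K : ℝ} (hK : 0 < K) (a : ℝ)
    (h : ∀ i, ∀ t : ℝ, 0 < t → μ.real {ω | t ≤ |ξ i ω|} ≤ 2 * Real.exp (-(t ^ 2 / K ^ 2))) :
    μ.real {ω | a ≤ ∑ i, ξ i ω ^ 2} ≤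
      Real.exp (-(4 / 5 / K ^ 2 / Fintype.card ι) * a) * 9 := by
  have hN : (0 : ℝ) < Fintype.card ι := by exact_mod_cast Fintype.card_pos
  set N := (Fintype.card ι : ℝ)
  -- The coordinates of a single coefficient vector may be dependent, so the exponential moment does
  -- not factor. Jensen's inequality replaces independence, at the cost of the factor 1/N in the
  -- exponent.
  have hpt : ∀ ω, Real.exp (4 / 5 / K ^ 2 / N * ∑ i, ξ i ω ^ 2) ≤
      ∑ i, N⁻¹ * Real.exp (4 / 5 / K ^ 2 * ξ i ω ^ 2) := by
    intro ω
    have := convexOn_exp.map_sum_le (t := Finset.univ) (w := fun _ : ι => N⁻¹)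
      (p := fun i => 4 / 5 / K ^ 2 * ξ i ω ^ 2) (fun _ _ => by positivity)
      (by simp [N]) (fun _ _ => Set.mem_univ _)
    simp only [smul_eq_mul] at this
    refine le_trans (le_of_eq ?_) this
    congr 1
    rw [Finset.mul_sum]
    refine Finset.sum_congr rfl fun i _ => by ring
  have hint2 : Integrable (fun ω => ∑ i, N⁻¹ * Real.exp (4 / 5 / K ^ 2 * ξ i ω ^ 2)) μ :=
    integrable_finsetSum _ fun i _ => (integrable_exp_sq (hξ i) hK (h i)).const_mul _
  have hint1 : Integrable (fun ω => Real.exp (4 / 5 / K ^ 2 / N * ∑ i, ξ i ω ^ 2)) μ := by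
    refine hint2.mono' (by fun_prop) (ae_of_all _ fun ω => ?_)
    rw [Real.norm_of_nonneg (Real.exp_pos _).le]
    exact hpt ω
  have h1 := measure_ge_le_exp_mul_mgf (μ := μ) (X := fun ω => ∑ i, ξ i ω ^ 2)
    (t := 4 / 5 / K ^ 2 / N) a (by positivity) hint1
  refine h1.trans ?_
  gcongr
  calc mgf (fun ω => ∑ i, ξ i ω ^ 2) μ (4 / 5 / K ^ 2 / N)
      ≤ ∫ ω, ∑ i, N⁻¹ * Real.exp (4 / 5 / K ^ 2 * ξ i ω ^ 2) ∂μ := integral_mono hint1 hint2 hpt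
    _ = ∑ i, N⁻¹ * ∫ ω, Real.exp (4 / 5 / K ^ 2 * ξ i ω ^ 2) ∂μ := by
        rw [integral_finsetSum _ fun i _ => (integrable_exp_sq (hξ i) hK (h i)).const_mul _]
        simp only [integral_const_mul]
    _ ≤ ∑ _i : ι, N⁻¹ * 9 := by
        gcongr with i
        exact integral_exp_sq_le (hξ i) hK (h i)
    _ = 9 := by simp [N]

/-- If every outcome in `A` forces an event to hold on a proportion `q` of the points of `B`, while
at each point of `B` the event has probability at most `p`, then `A` has probability at most
`p / q`. -/
lemma measureReal_le_div_of_section {Ω E : Type*} [MeasurableSpace Ω] [MeasurableSpace E]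
    {μ : Measure Ω} [IsProbabilityMeasure μ] {ν : Measure E} [SFinite ν] {S : Set (Ω × E)}
    (hS : MeasurableSet S) {B : Set E} (hB0 : ν B ≠ 0) (hB : ν B ≠ ∞)
    {A : Set Ω} {p q : ℝ} (hp : 0 ≤ p) (hq : 0 < q)
    (hA : ∀ ω ∈ A, ENNReal.ofReal q * ν B ≤ ν (Prod.mk ω ⁻¹' S ∩ B))
    (hpS : ∀ᵐ w ∂ν, μ.real {ω | (ω, w) ∈ S} ≤ p) : μ.real A ≤ p / q := by
  have hmeas : Measurable fun ω => (ν.restrict B) (Prod.mk ω ⁻¹' S) :=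
    measurable_measure_prodMk_left hS
  have h1 := mul_meas_ge_le_lintegral (μ := μ) hmeas (ENNReal.ofReal q * ν B)
  rw [← Measure.prod_apply hS, Measure.prod_apply_symm hS] at h1
  have h2 : ∫⁻ w, μ ((fun ω => (ω, w)) ⁻¹' S) ∂(ν.restrict B) ≤ ENNReal.ofReal p * ν B := by
    calc _ ≤ ∫⁻ _w, ENNReal.ofReal p ∂(ν.restrict B) := by
          refine lintegral_mono_ae ((ae_restrict_of_ae hpS).mono fun w hw => ?_)
          rw [← ofReal_measureReal (μ := μ)]
          exact ENNReal.ofReal_le_ofReal hw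
      _ = _ := by rw [lintegral_const, Measure.restrict_apply_univ]
  -- Passing to the measurable superlevel set of the section measure means that A itself need not be
  -- measurable.
  have h3 : μ A ≤ μ {ω | ENNReal.ofReal q * ν B ≤ (ν.restrict B) (Prod.mk ω ⁻¹' S)} := by
    refine measure_mono fun ω hω => ?_
    change ENNReal.ofReal q * ν B ≤ (ν.restrict B) (Prod.mk ω ⁻¹' S)
    rw [Measure.restrict_apply (hS.preimage measurable_prodMk_left)]
    exact hA ω hω
  have h4 : ENNReal.ofReal q * ν B * μ A ≤ ENNReal.ofReal p * ν B :=
    (mul_le_mul_right h3 _).trans (h1.trans h2)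
  rw [mul_right_comm, ENNReal.mul_le_mul_iff_left hB0 hB] at h4
  rw [le_div_iff₀ hq, mul_comm]
  have := ENNReal.toReal_mono ENNReal.ofReal_ne_top h4
  rwa [ENNReal.toReal_mul, ENNReal.toReal_ofReal hq.le, ENNReal.toReal_ofReal hp] at this

/-! ### Volume of a tube relative to a ball -/

/-- The volume is expressed through the k-dimensional unit ball, so that this factor cancels against
the cross-section of the tube. -/
lemma volume_closedBall_add_two (k : ℕ) (hk : 0 < k) {R : ℝ} (hR : 0 ≤ R) :
    volume (Metric.closedBall (0 : EuclideanSpace ℝ (Fin (k + 2))) R) =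
      ENNReal.ofReal (R ^ (k + 2) * (2 * Real.pi / (k + 2)) *
        (√Real.pi ^ k / Real.Gamma (k / 2 + 1))) := by
  rw [EuclideanSpace.volume_closedBall, Fintype.card_fin, ← ENNReal.ofReal_pow hR,
    ← ENNReal.ofReal_mul (by positivity), mul_assoc]
  congr 2
  have h1 : (((k + 2 : ℕ) : ℝ) / 2 + 1) = ((k : ℝ) / 2 + 1) + 1 := by push_cast; ring
  have h0 : Real.Gamma ((k : ℝ) / 2 + 1) ≠ 0 := (Real.Gamma_pos_of_pos (by positivity)).ne'
  rw [h1, Real.Gamma_add_one (by positivity), pow_add, Real.sq_sqrt Real.pi_pos.le]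
  field_simp

lemma exists_cylinder (k : ℕ) (hk : 0 < k) {x y : EuclideanSpace ℝ (Fin (k + 2))}
    (hx : ‖x‖ = 1) (hy : ‖y‖ = 1) (hxy : inner ℝ x y = 0) {a₁ a₂ ρ δ : ℝ}
    (ha : a₁ ≤ a₂) (hρ : 0 ≤ ρ) (hδ : 0 ≤ δ) :
    ∃ T : Set (EuclideanSpace ℝ (Fin (k + 2))),
      volume T = ENNReal.ofReal ((a₂ - a₁) * (2 * ρ) * δ ^ k *
        (√Real.pi ^ k / Real.Gamma (k / 2 + 1))) ∧
      ∀ w ∈ T, ∃ (s r : ℝ) (z : EuclideanSpace ℝ (Fin (k + 2))), w = s • x + r • y + z ∧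
        a₁ ≤ s ∧ s ≤ a₂ ∧ |r| ≤ ρ ∧ ‖z‖ ≤ δ ∧ inner ℝ x z = 0 ∧ inner ℝ y z = 0 := by
  have : Nonempty (Fin k) := ⟨⟨0, hk⟩⟩
  have hcard : Module.finrank ℝ (EuclideanSpace ℝ (Fin (k + 2))) = Fintype.card (Fin 2 ⊕ Fin k) := by
    rw [finrank_euclideanSpace, Fintype.card_fin, Fintype.card_sum, Fintype.card_fin,
      Fintype.card_fin, add_comm]
  let v : Fin 2 ⊕ Fin k → EuclideanSpace ℝ (Fin (k + 2)) := Sum.elim ![x, y] 0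
  have hv : Orthonormal ℝ ((Set.range (Sum.inl : Fin 2 → Fin 2 ⊕ Fin k)).domRestrict v) := by
    constructor
    · rintro ⟨_, i, rfl⟩
      fin_cases i
      · exact hx
      · exact hy
    · rintro ⟨_, i, rfl⟩ ⟨_, j, rfl⟩ hij
      have hyx : inner ℝ y x = 0 := by rw [real_inner_comm, hxy]
      fin_cases i <;> fin_cases j <;> simp [Set.domRestrict, v, hxy, hyx] at hij ⊢
  obtain ⟨b, hb⟩ := hv.exists_orthonormalBasis_extension_of_card_eq hcard
  have hb0 : b (Sum.inl 0) = x := hb _ ⟨0, rfl⟩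
  have hb1 : b (Sum.inl 1) = y := hb _ ⟨1, rfl⟩
  let φ : EuclideanSpace ℝ (Fin (k + 2)) → (Fin 2 → ℝ) × (Fin k → ℝ) := fun w =>
    MeasurableEquiv.sumPiEquivProdPi (fun _ : Fin 2 ⊕ Fin k => ℝ) (WithLp.ofLp (b.repr w))
  have hφ : MeasurePreserving φ volume volume :=
    (volume_measurePreserving_sumPiEquivProdPi (fun _ : Fin 2 ⊕ Fin k => ℝ)).comp
      ((PiLp.volume_preserving_ofLp (Fin 2 ⊕ Fin k)).comp b.measurePreserving_repr)
  let D₁ : Set (Fin 2 → ℝ) := Set.univ.pi ![Set.Icc a₁ a₂, Set.Icc (-ρ) ρ]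
  let D₂ : Set (Fin k → ℝ) := (WithLp.toLp 2 : (Fin k → ℝ) → EuclideanSpace ℝ (Fin k)) ⁻¹'
    Metric.closedBall 0 δ
  have hD₁ : MeasurableSet D₁ := by
    refine MeasurableSet.univ_pi fun i => ?_
    fin_cases i <;> exact measurableSet_Icc
  have hD₂ : MeasurableSet D₂ :=
    (PiLp.volume_preserving_toLp (Fin k)).measurable measurableSet_closedBall
  refine ⟨φ ⁻¹' (D₁ ×ˢ D₂), ?_, ?_⟩
  · rw [hφ.measure_preimage (hD₁.prod hD₂).nullMeasurableSet, Measure.volume_eq_prod,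
      Measure.prod_prod, (PiLp.volume_preserving_toLp (Fin k)).measure_preimage
        measurableSet_closedBall.nullMeasurableSet, EuclideanSpace.volume_closedBall,
      volume_pi_pi, Fin.prod_univ_two]
    simp only [Matrix.cons_val_zero, Matrix.cons_val_one, Real.volume_Icc, Fintype.card_fin]
    have h0 : 0 < Real.Gamma ((k : ℝ) / 2 + 1) := Real.Gamma_pos_of_pos (by positivity)
    rw [← ENNReal.ofReal_mul (by linarith), ← ENNReal.ofReal_pow hδ,
      ← ENNReal.ofReal_mul (by positivity),
      ← ENNReal.ofReal_mul (mul_nonneg (by linarith) (by linarith))]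
    congr 1
    ring
  · rintro w ⟨h1, h2⟩
    have e0 : b.repr w (Sum.inl 0) ∈ Set.Icc a₁ a₂ := h1 0 (Set.mem_univ _)
    have e1 : b.repr w (Sum.inl 1) ∈ Set.Icc (-ρ) ρ := h1 1 (Set.mem_univ _)
    have e2 : ‖(WithLp.toLp 2 fun j => b.repr w (Sum.inr j) : EuclideanSpace ℝ (Fin k))‖ ≤ δ := by
      have : (WithLp.toLp 2 fun j => b.repr w (Sum.inr j) : EuclideanSpace ℝ (Fin k)) ∈
        Metric.closedBall 0 δ := h2
      rwa [mem_closedBall_zero_iff] at this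
    set s := b.repr w (Sum.inl 0)
    set r := b.repr w (Sum.inl 1)
    have hx0 : b.repr x = EuclideanSpace.single (Sum.inl 0) 1 := by rw [← hb0, b.repr_self]
    have hy0 : b.repr y = EuclideanSpace.single (Sum.inl 1) 1 := by rw [← hb1, b.repr_self]
    have hz : ∀ i, b.repr (w - s • x - r • y) i =
        b.repr w i - s * (if i = Sum.inl 0 then 1 else 0) - r * (if i = Sum.inl 1 then 1 else 0) := by
      intro i
      rw [map_sub, map_sub, map_smul, map_smul, hx0, hy0]
      simp
    refine ⟨s, r, w - s • x - r • y, by abel, e0.1, e0.2, abs_le.2 e1, ?_, ?_, ?_⟩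
    · rw [← b.repr.norm_map]
      refine le_trans (le_of_eq ?_) e2
      rw [EuclideanSpace.norm_eq, EuclideanSpace.norm_eq]
      congr 1
      rw [Fintype.sum_sum_type, Fin.sum_univ_two, hz, hz]
      simp only [hz]
      simp [s, r]
    · rw [← hb0, ← b.repr_apply_apply, hb0, hz]
      simp [s]
    · rw [← hb1, ← b.repr_apply_apply, hb1, hz]
      simp [r]

/-- A tube around the direction `y` at `x` fills a definite proportion of a ball. -/
lemma exists_tube (k : ℕ) (hk : 0 < k) {x y : EuclideanSpace ℝ (Fin (k + 2))}
    (hx : ‖x‖ = 1) (hy : ‖y‖ = 1) (hxy : inner ℝ x y = 0) {ρ δ : ℝ}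
    (hρ : 0 < ρ) (hδ : 0 < δ) (h : ρ ^ 2 + δ ^ 2 ≤ 2 / (k + 2)) :
    ∃ T ⊆ Metric.closedBall (0 : EuclideanSpace ℝ (Fin (k + 2))) (1 + 1 / (k + 2)),
      ENNReal.ofReal (ρ * δ ^ k / 24) *
        volume (Metric.closedBall (0 : EuclideanSpace ℝ (Fin (k + 2))) (1 + 1 / (k + 2)))
        ≤ volume T ∧
      ∀ w ∈ T, ∃ (s r : ℝ) (z : EuclideanSpace ℝ (Fin (k + 2))), w = s • x + r • y + z ∧
        0 < s ∧ |r| / s ≤ ρ ∧ ‖z‖ / s ≤ δ ∧ inner ℝ x z = 0 ∧ inner ℝ y z = 0 := by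
  have hk' : (0 : ℝ) < k := by exact_mod_cast hk
  have hn : (0 : ℝ) < k + 2 := by positivity
  -- With s in [a, 1], shrinking the cross-section by a gives |r|/s ≤ ρ and ‖z‖/s ≤ δ. Writing n = k
  -- + 2, from (1 + 1/n)^n ≤ e and a^(n-1) ≥ 1/e the volume ratio is at least ρδ^k/(πe²), and πe² <
  -- 24.
  set a : ℝ := 1 - 1 / (k + 2) with ha
  have ha' : a = (k + 1) / (k + 2) := by rw [ha]; field_simp; ring
  have ha0 : 0 < a := by rw [ha']; positivity
  have ha1 : a ≤ 1 := by rw [ha]; linarith [show (0 : ℝ) < 1 / (k + 2) by positivity]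
  obtain ⟨T, hT, hTw⟩ := exists_cylinder k hk hx hy hxy ha1 (ρ := a * ρ) (δ := a * δ)
    (by positivity) (by positivity)
  refine ⟨T, fun w hw => ?_, ?_, fun w hw => ?_⟩
  · obtain ⟨s, r, z, rfl, h1, h2, h3, h4, h5, h6⟩ := hTw w hw
    rw [mem_closedBall_zero_iff]
    refine le_of_sq_le_sq ?_ (by positivity)
    have e1 : ‖s • x + r • y + z‖ ^ 2 = s ^ 2 + r ^ 2 + ‖z‖ ^ 2 := by
      rw [norm_add_sq_real, norm_add_sq_real, norm_smul, norm_smul, hx, hy, inner_add_left,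
        inner_smul_left, inner_smul_left, inner_smul_left, inner_smul_right, hxy, h5, h6]
      simp
    have e2 : s ^ 2 ≤ 1 := by
      have : 0 ≤ s := ha0.le.trans h1
      nlinarith
    have e3 : r ^ 2 ≤ ρ ^ 2 := by
      rw [← sq_abs r]
      exact pow_le_pow_left₀ (abs_nonneg _) (h3.trans (by nlinarith)) 2
    have e4 : ‖z‖ ^ 2 ≤ δ ^ 2 := pow_le_pow_left₀ (norm_nonneg _) (h4.trans (by nlinarith)) 2
    -- The cross term 2/n is exactly the room that the hypothesis on ρ² + δ² requires.
    have e5 : (1 + 1 / ((k : ℝ) + 2)) ^ 2 = 1 + 2 / (k + 2) + (1 / (k + 2)) ^ 2 := by ring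
    rw [e1, e5]
    nlinarith [sq_nonneg (1 / ((k : ℝ) + 2))]
  · rw [hT, volume_closedBall_add_two k hk (by positivity), ← ENNReal.ofReal_mul (by positivity)]
    refine ENNReal.ofReal_le_ofReal ?_
    have h0 : 0 < Real.Gamma ((k : ℝ) / 2 + 1) := Real.Gamma_pos_of_pos (by positivity)
    have hR : (1 + 1 / ((k : ℝ) + 2)) ^ (k + 2) ≤ Real.exp 1 := by
      calc (1 + 1 / ((k : ℝ) + 2)) ^ (k + 2) ≤ Real.exp (1 / ((k : ℝ) + 2)) ^ (k + 2) := by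
            gcongr
            rw [add_comm]
            exact Real.add_one_le_exp _
        _ = Real.exp 1 := by
            rw [← Real.exp_nat_mul]
            congr 1
            push_cast
            field_simp
    have hA : Real.exp (-1) ≤ a ^ (k + 1) := by
      rw [Real.exp_neg, inv_le_comm₀ (Real.exp_pos 1) (by positivity), ← inv_pow]
      calc a⁻¹ ^ (k + 1) ≤ Real.exp (1 / ((k : ℝ) + 1)) ^ (k + 1) := by
            gcongr
            have : a⁻¹ = 1 / ((k : ℝ) + 1) + 1 := by rw [ha']; field_simp; ring
            rw [this]
            exact Real.add_one_le_exp _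
        _ = Real.exp 1 := by
            rw [← Real.exp_nat_mul]
            congr 1
            push_cast
            field_simp
    have hnum : (1 + 1 / ((k : ℝ) + 2)) ^ (k + 2) * Real.pi ≤ 24 * a ^ (k + 1) := by
      have e1 : Real.exp 1 * Real.pi ≤ 24 * Real.exp (-1) := by
        rw [Real.exp_neg, ← div_eq_mul_inv, le_div_iff₀ (Real.exp_pos 1)]
        have h1 := Real.exp_one_lt_d9
        have h2 := Real.pi_lt_d4
        calc Real.exp 1 * Real.pi * Real.exp 1 ≤ 2.7182818286 * 3.1416 * 2.7182818286 := by
              gcongr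
          _ ≤ 24 := by norm_num
      calc _ ≤ Real.exp 1 * Real.pi := by gcongr
        _ ≤ _ := e1.trans (by gcongr)
    have hsub : 1 - a = 1 / (k + 2) := by rw [ha]; ring
    rw [hsub]
    calc ρ * δ ^ k / 24 * ((1 + 1 / ((k : ℝ) + 2)) ^ (k + 2) * (2 * Real.pi / (k + 2)) *
          (√Real.pi ^ k / Real.Gamma (k / 2 + 1)))
        = ((1 + 1 / ((k : ℝ) + 2)) ^ (k + 2) * Real.pi) *
          (ρ * δ ^ k / 24 * (2 / (k + 2)) * (√Real.pi ^ k / Real.Gamma (k / 2 + 1))) := by ring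
      _ ≤ (24 * a ^ (k + 1)) *
          (ρ * δ ^ k / 24 * (2 / (k + 2)) * (√Real.pi ^ k / Real.Gamma (k / 2 + 1))) := by gcongr
      _ = _ := by rw [mul_pow, pow_succ]; ring
  · obtain ⟨s, r, z, hw, h1, h2, h3, h4, h5, h6⟩ := hTw w hw
    have hs : 0 < s := ha0.trans_le h1
    refine ⟨s, r, z, hw, hs, ?_, ?_, h5, h6⟩
    · rw [div_le_iff₀ hs]; nlinarith
    · rw [div_le_iff₀ hs]; nlinarith

/-! ### Deterministic consequences of a maximum point and of a small gap -/

section Deterministic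

variable {m n D : ℕ} {d : Fin m → ℕ} {P : Fin m → MvPolynomial (Fin n) ℝ} {γ : ℝ}
  {x y : EuclideanSpace ℝ (Fin n)}

/-- Near a point of the sphere where `‖P‖` is maximal, `‖P‖` is almost maximal. -/
lemma le_norm_projEval_of_isMax (hD : 0 < D) (hP : ∀ i, (P i).IsHomogeneous (d i))
    (hd : ∀ i, d i ≤ D) (hx : ‖x‖ = 1) (hmax : ∀ z, ‖z‖ = 1 → ‖sysEval P z‖ ≤ ‖sysEval P x‖)
    {w : EuclideanSpace ℝ (Fin n)} (hw : ‖w - x‖ ≤ 1 / (5 * D + 1)) :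
    4 / 5 * ‖sysEval P x‖ ≤ ‖projEval P w‖ := by
  have hD' : (0 : ℝ) < D := by exact_mod_cast hD
  set η : ℝ := 1 / (5 * D + 1) with hη
  have hη0 : 0 < η := by positivity
  have hη1 : η < 1 := by
    rw [hη, div_lt_one (by positivity)]; linarith
  -- The radius η is chosen so that the first order estimate loses exactly one fifth of the maximum.
  have hηD : D * (η / (1 - η)) = 1 / 5 := by
    rw [hη]
    have : (1 : ℝ) - 1 / (5 * D + 1) = 5 * D / (5 * D + 1) := by field_simp; ring
    rw [this]; field_simp
  set e : ℝ := inner ℝ x (w - x) with he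
  set v := (w - x) - e • x with hv
  have hwv : w = (1 + e) • x + v := by rw [hv, add_smul, one_smul]; abel
  have hin : |e| ≤ η := by
    refine (abs_real_inner_le_norm _ _).trans ?_
    rw [hx, one_mul]; exact hw
  have hs1 : 1 - η ≤ 1 + e := by linarith [(abs_le.1 hin).1]
  have hxv : inner ℝ x v = 0 := by
    rw [hv, inner_sub_right, inner_smul_right, real_inner_self_eq_norm_sq, hx, ← he]; ring
  have hvη : ‖v‖ ≤ η := by
    refine le_of_sq_le_sq ?_ hη0.le
    have h1 : ‖w - x‖ ^ 2 = ‖v‖ ^ 2 + e ^ 2 := by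
      have h : w - x = v + e • x := by rw [hv]; abel
      rw [h, norm_add_sq_real, inner_smul_right, real_inner_comm, hxv, norm_smul, hx]
      simp
    have h2 : ‖w - x‖ ^ 2 ≤ η ^ 2 := by gcongr
    nlinarith [sq_nonneg e]
  have hs0 : 0 < 1 + e := by linarith
  have h1 := norm_projEval_sub_le hD hP hd hmax hx hxv hs0
  rw [← hwv] at h1
  have h2 : (D : ℝ) * ‖sysEval P x‖ * (‖v‖ / (1 + e)) ≤ ‖sysEval P x‖ / 5 := by
    calc (D : ℝ) * ‖sysEval P x‖ * (‖v‖ / (1 + e)) ≤ D * ‖sysEval P x‖ * (η / (1 - η)) := by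
          have : 0 < 1 - η := by linarith
          gcongr
      _ = ‖sysEval P x‖ * (D * (η / (1 - η))) := by ring
      _ = ‖sysEval P x‖ / 5 := by rw [hηD]; ring
  have h3 := norm_sub_norm_le (sysEval P x) (projEval P w)
  rw [norm_sub_rev] at h3
  linarith

/-- If `P` is nearly singular at `x` in the direction `y` then it is small on a tube. -/
lemma norm_projEval_le_of_gap (hD : 0 < D) (hP : ∀ i, (P i).IsHomogeneous (d i))
    (hd1 : ∀ i, 1 ≤ d i) (hd : ∀ i, d i ≤ D) (hγ : 0 < γ) (hsup : ∀ z, ‖z‖ = 1 → ‖sysEval P z‖ ≤ γ)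
    (hp : (x, y) ∈ orthoPairs n) {ε : ℝ} (hε : 0 < ε) (hε1 : ε ≤ 1)
    (hgap : gap d P (x, y) ≤ (ε * γ) ^ 2) {s r : ℝ} {z : EuclideanSpace ℝ (Fin n)} (hs : 0 < s)
    (hr : |r| / s ≤ √ε / D) (hz : ‖z‖ / s ≤ 15 * ε / D)
    (hxz : inner ℝ x z = 0) (hyz : inner ℝ y z = 0) :
    ‖projEval P (s • x + r • y + z)‖ ≤ 18 * (ε * γ) := by
  obtain ⟨hx, hy, hxy⟩ := hp
  simp only at hx hy hxy
  have hD' : (1 : ℝ) ≤ D := by exact_mod_cast hD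
  have hD0 : (0 : ℝ) < D := by linarith
  set α := ε * γ with hα
  have hα0 : 0 < α := by positivity
  -- The four terms are at most α, α, α and 15α. The half-width √ε/D makes the quadratic term equal
  -- to α at the boundary. The factor √D in the linear term comes from undoing Δ.
  have h1 := norm_projEval_tube_le hD hP hd hsup hx hy hxy hs r hxz hyz
  have hP : ‖sysEval P x‖ ≤ α := by
    refine le_of_sq_le_sq (le_trans ?_ hgap) hα0.le
    unfold gap
    have : 0 ≤ ∑ i, dirDeriv P x y i ^ 2 / (d i : ℝ) := by positivity
    simp only
    linarith
  have hdir : ‖dirDeriv P x y‖ ≤ √D * α := by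
    refine le_of_sq_le_sq ?_ (by positivity)
    rw [mul_pow, Real.sq_sqrt hD0.le, EuclideanSpace.norm_sq_eq]
    have h2 : ∑ i, dirDeriv P x y i ^ 2 / (d i : ℝ) ≤ α ^ 2 := by
      refine le_trans ?_ hgap
      unfold gap
      simp only
      linarith [sq_nonneg ‖sysEval P x‖]
    calc ∑ i, ‖dirDeriv P x y i‖ ^ 2
        ≤ ∑ i, D * (dirDeriv P x y i ^ 2 / (d i : ℝ)) := by
          refine Finset.sum_le_sum fun i _ => ?_
          have hdi : (0 : ℝ) < d i := by exact_mod_cast hd1 i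
          have hdD : (d i : ℝ) ≤ D := by exact_mod_cast hd i
          rw [Real.norm_eq_abs, sq_abs, mul_div_assoc', le_div_iff₀ hdi, mul_comm]
          gcongr
      _ = D * ∑ i, dirDeriv P x y i ^ 2 / (d i : ℝ) := by rw [Finset.mul_sum]
      _ ≤ D * α ^ 2 := by gcongr
  have h2 : |r| / s * ‖dirDeriv P x y‖ ≤ α := by
    calc |r| / s * ‖dirDeriv P x y‖ ≤ √ε / D * (√D * α) := by gcongr
      _ ≤ 1 / D * (D * α) := by
          gcongr
          · exact Real.sqrt_le_one.2 hε1
          · rw [Real.sqrt_le_left (by linarith)]; nlinarith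
      _ = α := by field_simp
  have h3 : (D : ℝ) ^ 2 * γ * (r / s) ^ 2 ≤ α := by
    calc (D : ℝ) ^ 2 * γ * (r / s) ^ 2 = D ^ 2 * γ * (|r| / s) ^ 2 := by
          rw [div_pow, div_pow, sq_abs]
      _ ≤ D ^ 2 * γ * (√ε / D) ^ 2 := by gcongr
      _ = α := by rw [div_pow, Real.sq_sqrt hε.le, hα]; field_simp
  have h4 : (D : ℝ) * γ * (‖z‖ / s) ≤ 15 * α := by
    calc (D : ℝ) * γ * (‖z‖ / s) ≤ D * γ * (15 * ε / D) := by gcongr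
      _ = 15 * α := by rw [hα]; field_simp
  linarith

end Deterministic

/-! ### Probability bounds for the supremum, the Weyl norm and the gap -/

section RandomForms

variable {Ω : Type*} {m n : ℕ} {d : Fin m → ℕ}
  {C : ∀ i : Fin m, Ω → EuclideanSpace ℝ (Exponent n (d i))} {K c₀ : ℝ}

/-- The random system of forms. -/
noncomputable def randomSys (C : ∀ i : Fin m, Ω → EuclideanSpace ℝ (Exponent n (d i))) (ω : Ω) :
    Fin m → MvPolynomial (Fin n) ℝ :=
  formSys fun i => C i ω

lemma norm_sq_sysEval_randomSys (ω : Ω) (u : EuclideanSpace ℝ (Fin n)) :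
    ‖sysEval (randomSys C ω) u‖ ^ 2 = ∑ i, inner ℝ (C i ω) (veronese (d i) u) ^ 2 := by
  rw [EuclideanSpace.norm_sq_eq]
  refine Finset.sum_congr rfl fun i _ => ?_
  rw [randomSys, sysEval_formSys, Real.norm_eq_abs, sq_abs]

lemma randomSys_isHomogeneous (ω : Ω) (i : Fin m) : (randomSys C ω i).IsHomogeneous (d i) :=
  form_isHomogeneous _

variable [MeasurableSpace Ω] {μ : Measure Ω}

lemma iIndepFun_inner (hind : iIndepFun C μ)
    (v : ∀ i, EuclideanSpace ℝ (Exponent n (d i))) :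
    iIndepFun (fun i ω => inner ℝ (C i ω) (v i)) μ :=
  hind.comp (fun i c => inner ℝ c (v i)) fun i => by fun_prop

lemma SubGaussian.inner_tail {i : Fin m} (h : SubGaussian μ (C i) K)
    {θ : EuclideanSpace ℝ (Exponent n (d i))} (hθ : ‖θ‖ = 1) (t : ℝ) (ht : 0 < t) :
    μ.real {ω | t ≤ |inner ℝ (C i ω) θ|} ≤ 2 * Real.exp (-(t ^ 2 / K ^ 2)) :=
  h θ hθ t ht

lemma SmallBall.inner_ball {i : Fin m} (h : SmallBall μ (C i) c₀)
    {θ : EuclideanSpace ℝ (Exponent n (d i))} (hθ : ‖θ‖ = 1) (t : ℝ) (ht : 0 < t) :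
    μ.real {ω | |inner ℝ (C i ω) θ| ≤ t} ≤ c₀ * t := by
  have hθ0 : θ ≠ 0 := by rintro rfl; simp at hθ
  have := h θ hθ0 t ht
  simpa only [hθ, mul_one, real_inner_comm] using this

variable [IsProbabilityMeasure μ]

lemma measureReal_sysEval_le (hm : 0 < m) (hC : ∀ i, Measurable (C i)) (hind : iIndepFun C μ)
    (hc : 0 < c₀) (hsb : ∀ i, SmallBall μ (C i) c₀) {R : ℝ} (hR : 0 < R)
    {u : EuclideanSpace ℝ (Fin n)} (hu : ‖u‖ = 1) :
    μ.real {ω | ‖sysEval (randomSys C ω) u‖ ≤ R} ≤ (207 / 100 * c₀ * R / √m) ^ m := by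
  have h := measureReal_sum_sq_le hm (ξ := fun i ω => inner ℝ (C i ω) (veronese (d i) u))
    (fun i => by have := hC i; fun_prop) (iIndepFun_inner hind _) hc hR
    (fun i => (hsb i).inner_ball (by rw [norm_veronese, hu, one_pow]))
  convert h using 4 with ω
  rw [← norm_sq_sysEval_randomSys, sq_le_sq₀ (norm_nonneg _) hR.le]

lemma measureReal_le_sysEval (hC : ∀ i, Measurable (C i)) (hind : iIndepFun C μ)
    (hK : 0 < K) (hsg : ∀ i, SubGaussian μ (C i) K) {a : ℝ} (ha : 0 ≤ a)
    {u : EuclideanSpace ℝ (Fin n)} (hu : ‖u‖ = 1) :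
    μ.real {ω | a ≤ ‖sysEval (randomSys C ω) u‖} ≤
      Real.exp (-(4 / 5 / K ^ 2) * a ^ 2) * 9 ^ m := by
  have h := measureReal_le_sum_sq (ξ := fun i ω => inner ℝ (C i ω) (veronese (d i) u))
    (fun i => by have := hC i; fun_prop) (iIndepFun_inner hind _) hK (a ^ 2)
    (fun i => (hsg i).inner_tail (by rw [norm_veronese, hu, one_pow]))
  convert h using 4 with ω
  rw [← norm_sq_sysEval_randomSys, sq_le_sq₀ ha (norm_nonneg _)]

lemma measureReal_le_sysNorm (hC : ∀ i, Measurable (C i)) (hK : 0 < K)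
    (hsg : ∀ i, SubGaussian μ (C i) K) (hN : 0 < numCoeffs n d) {a : ℝ} (ha : 0 ≤ a) :
    μ.real {ω | a ≤ sysNorm d (randomSys C ω)} ≤
      Real.exp (-(4 / 5 / K ^ 2 / numCoeffs n d) * a ^ 2) * 9 := by
  have hcard : Fintype.card (Σ i, Exponent n (d i)) = numCoeffs n d := by
    rw [Fintype.card_sigma, numCoeffs]
    refine Finset.sum_congr rfl fun i _ => ?_
    rw [Fintype.card_coe, Finset.card_finsuppAntidiag_nat_eq_choose, Finset.card_univ,
      Fintype.card_fin]
  have : Nonempty (Σ i, Exponent n (d i)) := Fintype.card_pos_iff.1 (by omega)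
  have h := measureReal_le_sum_sq_of_dependent (ι := Σ i, Exponent n (d i))
    (ξ := fun p ω => C p.1 ω p.2) (μ := μ)
    (fun p => by have := hC p.1; fun_prop) hK (a ^ 2) (fun p t ht => by
      have := (hsg p.1).inner_tail (θ := EuclideanSpace.single p.2 1) (by simp) t ht
      simpa [EuclideanSpace.inner_single_right] using this)
  rw [hcard] at h
  convert h using 4 with ω
  rw [randomSys, sysNorm_formSys, Real.le_sqrt ha (by positivity), Fintype.sum_sigma]
  simp only [EuclideanSpace.norm_sq_eq, Real.norm_eq_abs, sq_abs]

lemma measurable_norm_sysEval_formSys :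
    Measurable fun q : (∀ i, EuclideanSpace ℝ (Exponent n (d i))) ×
      EuclideanSpace ℝ (Fin n) => ‖sysEval (formSys q.1) q.2‖ :=
  continuous_sysEval_formSys.norm.measurable

lemma measurable_pair (hC : ∀ i, Measurable (C i)) :
    Measurable fun p : Ω × EuclideanSpace ℝ (Fin n) =>
      ((fun i => C i p.1, ‖p.2‖⁻¹ • p.2) :
        (∀ i, EuclideanSpace ℝ (Exponent n (d i))) × EuclideanSpace ℝ (Fin n)) :=
  (measurable_pi_lambda _ fun i => (hC i).comp measurable_fst).prodMk
    (measurable_snd.norm.inv.smul measurable_snd)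

lemma measurable_projEval_randomSys (hC : ∀ i, Measurable (C i)) :
    Measurable fun p : Ω × EuclideanSpace ℝ (Fin n) => ‖projEval (randomSys C p.1) p.2‖ := by
  simp only [projEval, randomSys]
  have h := Measurable.comp (g := fun q : (∀ i, EuclideanSpace ℝ (Exponent n (d i))) ×
      EuclideanSpace ℝ (Fin n) => ‖sysEval (formSys q.1) q.2‖)
      (f := fun p : Ω × EuclideanSpace ℝ (Fin n) =>
      ((fun i => C i p.1, ‖p.2‖⁻¹ • p.2) :
        (∀ i, EuclideanSpace ℝ (Exponent n (d i))) × EuclideanSpace ℝ (Fin n))) measurable_norm_sysEval_formSys (measurable_pair hC)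
  simp only [Function.comp_def] at h
  exact h

lemma norm_inv_norm_smul {w : EuclideanSpace ℝ (Fin n)} (hw : w ≠ 0) : ‖‖w‖⁻¹ • w‖ = 1 := by
  rw [norm_smul, norm_inv, norm_norm, inv_mul_cancel₀ (norm_ne_zero_iff.2 hw)]

/-- Tail bound for the supremum of the system over the unit sphere. -/
lemma measureReal_exists_lt_sysEval (hn : 0 < n) (hC : ∀ i, Measurable (C i))
    (hind : iIndepFun C μ) (hK : 0 < K) (hsg : ∀ i, SubGaussian μ (C i) K) {D : ℕ} (hD : 0 < D)
    (hd : ∀ i, d i ≤ D) {γ : ℝ} (hγ : 0 ≤ γ) :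
    μ.real {ω | ∃ u : EuclideanSpace ℝ (Fin n), ‖u‖ = 1 ∧ γ < ‖sysEval (randomSys C ω) u‖} ≤
      Real.exp (-(4 / 5 / K ^ 2) * (4 / 5 * γ) ^ 2) * 9 ^ m * (5 * D + 2) ^ n := by
  have : Nonempty (Fin n) := ⟨⟨0, hn⟩⟩
  have hD' : (0 : ℝ) < D := by exact_mod_cast hD
  set η : ℝ := 1 / (5 * D + 1) with hη
  have hη0 : 0 < η := by positivity
  have hS : MeasurableSet {p : Ω × EuclideanSpace ℝ (Fin n) |
      4 / 5 * γ ≤ ‖projEval (randomSys C p.1) p.2‖} :=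
    measurableSet_le measurable_const (measurable_projEval_randomSys hC)
  have hB : volume (Metric.closedBall (0 : EuclideanSpace ℝ (Fin n)) (1 + η)) ≠ ∞ :=
    measure_closedBall_lt_top.ne
  have hB0 : volume (Metric.closedBall (0 : EuclideanSpace ℝ (Fin n)) (1 + η)) ≠ 0 :=
    (Metric.measure_closedBall_pos _ _ (by linarith)).ne'
  have key := measureReal_le_div_of_section (μ := μ) hS hB0 hB
    (A := {ω | ∃ u : EuclideanSpace ℝ (Fin n), ‖u‖ = 1 ∧ γ < ‖sysEval (randomSys C ω) u‖})
    (p := Real.exp (-(4 / 5 / K ^ 2) * (4 / 5 * γ) ^ 2) * 9 ^ m)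
    (q := (1 / (5 * D + 2)) ^ n) (by positivity) (by positivity) ?_ ?_
  · refine key.trans (le_of_eq ?_)
    rw [one_div, inv_pow, div_inv_eq_mul]
  · rintro ω ⟨u₀, hu₀, hγu⟩
    have hcont : Continuous fun u => ‖sysEval (randomSys C ω) u‖ :=
      (Continuous.uncurry_left (fun i => C i ω) (f := fun c u => sysEval (formSys c) u)
        continuous_sysEval_formSys).norm
    obtain ⟨x, hx, hmax⟩ := (isCompact_sphere (0 : EuclideanSpace ℝ (Fin n)) 1).exists_isMaxOn
      ⟨u₀, by simpa using hu₀⟩ hcont.continuousOn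
    rw [mem_sphere_zero_iff_norm] at hx
    have hmax' : ∀ z : EuclideanSpace ℝ (Fin n), ‖z‖ = 1 →
        ‖sysEval (randomSys C ω) z‖ ≤ ‖sysEval (randomSys C ω) x‖ := fun z hz =>
      hmax (mem_sphere_zero_iff_norm.2 hz)
    have hγ' : γ < ‖sysEval (randomSys C ω) x‖ := hγu.trans_le (hmax' u₀ hu₀)
    -- The ball around the maximum point plays the role of a net: its proportion is (η/(1+η))^n =
    -- (5D+2)^(-n).
    have hsub : Metric.closedBall x η ⊆ Prod.mk ω ⁻¹' {p : Ω × EuclideanSpace ℝ (Fin n) |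
        4 / 5 * γ ≤ ‖projEval (randomSys C p.1) p.2‖} ∩ Metric.closedBall 0 (1 + η) := by
      intro w hw
      rw [mem_closedBall_iff_norm] at hw
      refine ⟨?_, ?_⟩
      · change 4 / 5 * γ ≤ ‖projEval (randomSys C ω) w‖
        have := le_norm_projEval_of_isMax hD (randomSys_isHomogeneous ω) hd hx hmax' hw
        linarith
      · rw [mem_closedBall_zero_iff]
        have := norm_add_le x (w - x)
        rw [add_sub_cancel, hx] at this
        linarith
    refine le_trans (le_of_eq ?_) (measure_mono hsub)
    rw [Measure.addHaar_closedBall _ _ hη0.le, Measure.addHaar_closedBall _ _ (by linarith),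
      ← mul_assoc, ← ENNReal.ofReal_mul (by positivity), finrank_euclideanSpace, Fintype.card_fin,
      ← mul_pow]
    congr 3
    rw [hη]; field_simp; ring
  · have h0 : ∀ᵐ w : EuclideanSpace ℝ (Fin n), w ≠ 0 := by
      simp [ae_iff]
    filter_upwards [h0] with w hw
    exact measureReal_le_sysEval hC hind hK hsg (by positivity) (norm_inv_norm_smul hw)

/-- The probability that the system is bounded by `γ` on the sphere but nearly singular. -/
lemma measureReal_gap_le (hn : m + 1 = n) (hm : 2 ≤ m) (hC : ∀ i, Measurable (C i))
    (hind : iIndepFun C μ) (hc : 0 < c₀) (hsb : ∀ i, SmallBall μ (C i) c₀) {D : ℕ} (hD : 0 < D)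
    (hd1 : ∀ i, 1 ≤ d i) (hd : ∀ i, d i ≤ D) {γ ε : ℝ} (hγ : 0 < γ) (hε : 0 < ε) (hε1 : ε ≤ 1)
    (hεn : (√ε / D) ^ 2 + (15 * ε / D) ^ 2 ≤ 2 / n) :
    μ.real {ω | (∀ u : EuclideanSpace ℝ (Fin n), ‖u‖ = 1 → ‖sysEval (randomSys C ω) u‖ ≤ γ) ∧
        ∃ p ∈ orthoPairs n, gap d (randomSys C ω) p ≤ (ε * γ) ^ 2} ≤
      (207 / 100 * c₀ * (18 * (ε * γ)) / √m) ^ m /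
        (√ε / D * (15 * ε / D) ^ (m - 1) / 24) := by
  obtain ⟨k, rfl⟩ : ∃ k, m = k + 1 := ⟨m - 1, by omega⟩
  subst hn
  have hk : 0 < k := by omega
  have hD0 : (0 : ℝ) < D := by exact_mod_cast hD
  have hsε : 0 < √ε := Real.sqrt_pos.2 hε
  have hS : MeasurableSet {p : Ω × EuclideanSpace ℝ (Fin (k + 2)) |
      ‖projEval (randomSys C p.1) p.2‖ ≤ 18 * (ε * γ)} :=
    measurableSet_le (measurable_projEval_randomSys hC) measurable_const
  have hB : volume (Metric.closedBall (0 : EuclideanSpace ℝ (Fin (k + 2))) (1 + 1 / (k + 2))) ≠ ∞ :=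
    measure_closedBall_lt_top.ne
  have hB0 : volume (Metric.closedBall (0 : EuclideanSpace ℝ (Fin (k + 2))) (1 + 1 / (k + 2)))
      ≠ 0 := (Metric.measure_closedBall_pos _ _ (by positivity)).ne'
  refine measureReal_le_div_of_section (μ := μ) hS hB0 hB (by positivity) (by positivity) ?_ ?_
  · rintro ω ⟨hsup, ⟨x, y⟩, ⟨hx, hy, hxy⟩, hgap⟩
    obtain ⟨T, hTB, hTv, hTw⟩ := exists_tube k hk hx hy hxy (ρ := √ε / D) (δ := 15 * ε / D)
      (by positivity) (by positivity) (by
        refine hεn.trans (le_of_eq ?_)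
        push_cast; ring)
    refine hTv.trans (measure_mono fun w hw => ⟨?_, hTB hw⟩)
    obtain ⟨s, r, z, rfl, hs, hr, hz, hxz, hyz⟩ := hTw w hw
    exact norm_projEval_le_of_gap hD (randomSys_isHomogeneous ω) hd1 hd hγ hsup ⟨hx, hy, hxy⟩ hε
      hε1 hgap hs hr hz hxz hyz
  · have h0 : ∀ᵐ w : EuclideanSpace ℝ (Fin (k + 2)), w ≠ 0 := by
      simp [ae_iff]
    filter_upwards [h0] with w hw
    exact measureReal_sysEval_le (by omega) hC hind hc hsb (by positivity) (norm_inv_norm_smul hw)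

end RandomForms

/-! ### Numerical inequalities behind the constant A -/

section Numerics

lemma one_add_log_ge {D : ℕ} (hD : 2 ≤ D) : 169 / 100 ≤ 1 + Real.log D := by
  have h1 : Real.log 2 ≤ Real.log D := Real.log_le_log (by norm_num) (by exact_mod_cast hD)
  have := Real.log_two_gt_d9
  linarith

/-- The Gaussian exponent is (4/5)(16/25)·9 = 576/125 times smb. The factors 9^m and (5D+2)^(m+1)
cost at most (7/2)mb, which leaves more than smb. -/
lemma sup_tail_numeric {D m : ℕ} (hD : 2 ≤ D) (hm : 2 ≤ m) {K s b γ : ℝ} (hK : 0 < K)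
    (hs : 1 ≤ s) (hb : b = 1 + Real.log D) (hγ : γ ^ 2 = 9 * b * K ^ 2 * m * s) :
    Real.exp (-(4 / 5 / K ^ 2) * (4 / 5 * γ) ^ 2) * 9 ^ m * (5 * D + 2) ^ (m + 1) ≤
      Real.exp (-(s * m * b)) := by
  have hD2 : (2 : ℝ) ≤ D := by exact_mod_cast hD
  have hm2 : (2 : ℝ) ≤ m := by exact_mod_cast hm
  have hb1 := one_add_log_ge hD
  rw [← hb] at hb1
  have hlogD : Real.log 2 ≤ Real.log D := Real.log_le_log (by norm_num) hD2
  have h9 : (9 : ℝ) ^ m = Real.exp (m * Real.log 9) := by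
    rw [Real.exp_nat_mul, Real.exp_log (by norm_num)]
  have h6 : ((5 : ℝ) * D + 2) ^ (m + 1) ≤ Real.exp ((m + 1) * (Real.log 6 + Real.log D)) := by
    have e : Real.exp ((m + 1) * (Real.log 6 + Real.log D)) = (6 * D) ^ (m + 1) := by
      have : ((m : ℝ) + 1) = ((m + 1 : ℕ) : ℝ) := by push_cast; ring
      rw [this, Real.exp_nat_mul, Real.exp_add, Real.exp_log (by norm_num),
        Real.exp_log (by linarith)]
    rw [e]
    gcongr
    linarith
  have hconst : 2 * Real.log 9 + 3 * Real.log 6 ≤ 7 + 4 * Real.log 2 := by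
    have e1 : 2 * Real.log 9 + 3 * Real.log 6 = Real.log 17496 := by
      rw [show (17496 : ℝ) = 9 ^ 2 * 6 ^ 3 by norm_num, Real.log_mul (by norm_num) (by norm_num),
        Real.log_pow, Real.log_pow]
      norm_num
    have e2 : 7 + 4 * Real.log 2 = Real.log (Real.exp 1 ^ 7 * 2 ^ 4) := by
      rw [Real.log_mul (by positivity) (by norm_num), Real.log_pow, Real.log_pow, Real.log_exp]
      norm_num
    rw [e1, e2]
    refine Real.log_le_log (by norm_num) ?_
    have := Real.exp_one_gt_d9
    calc (17496 : ℝ) ≤ 2.7182818283 ^ 7 * 2 ^ 4 := by norm_num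
      _ ≤ _ := by gcongr
  have hexp : -(4 / 5 / K ^ 2) * (4 / 5 * γ) ^ 2 = -(576 / 125 * (s * m * b)) := by
    rw [mul_pow, hγ]; field_simp; ring
  rw [hexp, h9]
  calc _ ≤ Real.exp (-(576 / 125 * (s * m * b))) * Real.exp (m * Real.log 9) *
        Real.exp ((m + 1) * (Real.log 6 + Real.log D)) := by gcongr
    _ = Real.exp (-(576 / 125 * (s * m * b)) + m * Real.log 9 +
          (m + 1) * (Real.log 6 + Real.log D)) := by rw [Real.exp_add, Real.exp_add]
    _ ≤ _ := by
      refine Real.exp_le_exp.2 ?_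
      have hl6 : 0 ≤ Real.log 6 + Real.log D := by
        have := Real.log_nonneg (show (1 : ℝ) ≤ 6 by norm_num)
        have := Real.log_nonneg (show (1 : ℝ) ≤ D by linarith)
        linarith
      have h1 : ((m : ℝ) + 1) * (Real.log 6 + Real.log D) ≤
          3 / 2 * m * (Real.log 6 + Real.log D) := by
        apply mul_le_mul_of_nonneg_right _ hl6
        linarith
      have h2 : Real.log 9 + 3 / 2 * (Real.log 6 + Real.log D) ≤ 7 / 2 * b := by
        rw [hb]; linarith
      have h3 : (m : ℝ) * (Real.log 9 + 3 / 2 * (Real.log 6 + Real.log D)) ≤ m * (7 / 2 * b) := by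
        gcongr
      have h4 : (m : ℝ) * b ≤ s * (m * b) := le_mul_of_one_le_left (by positivity) hs
      nlinarith

lemma norm_tail_numeric {D m : ℕ} (hD : 2 ≤ D) (hm : 2 ≤ m) {K s b γ N : ℝ} (hK : 0 < K)
    (hN : 0 < N) (hs : 1 ≤ s) (hb : b = 1 + Real.log D) (hγ : γ ^ 2 = 9 * b * K ^ 2 * m * s) :
    Real.exp (-(4 / 5 / K ^ 2 / N) * (√N * γ) ^ 2) * 9 ≤ Real.exp (-(s * m * b)) := by
  have hm2 : (2 : ℝ) ≤ m := by exact_mod_cast hm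
  have hb1 := one_add_log_ge hD
  rw [← hb] at hb1
  have h1 : (2 : ℝ) ≤ s * m * b := by
    have h2 : (2 : ℝ) ≤ s * m := by nlinarith
    nlinarith
  have hexp : -(4 / 5 / K ^ 2 / N) * (√N * γ) ^ 2 = -(36 / 5 * (s * m * b)) := by
    rw [mul_pow, hγ, Real.sq_sqrt hN.le]; field_simp; ring
  have h9 : (9 : ℝ) ≤ Real.exp (31 / 5 * (s * m * b)) := by
    have := Real.add_one_le_exp (31 / 5 * (s * m * b))
    linarith
  rw [hexp]
  calc _ ≤ Real.exp (-(36 / 5 * (s * m * b))) * Real.exp (31 / 5 * (s * m * b)) := by gcongr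
    _ = _ := by rw [← Real.exp_add]; congr 1; ring

/-- Forces ε ≤ 1/(10⁷n), so that the tube fits in the ball. The lower bound on q = Kc₀ is essential,
since q^(2m) could otherwise be arbitrarily small. -/
lemma scale_numeric {D m : ℕ} (hD : 2 ≤ D) (hm : 2 ≤ m) {q b : ℝ} (hq : 12 / 25 ≤ q)
    (hb : b = 1 + Real.log D) :
    (m : ℝ) + 1 ≤ q ^ (2 * m) * (3 * (D : ℝ) ^ 2 * b) ^ (2 * m - 1) := by
  have hD2 : (2 : ℝ) ≤ D := by exact_mod_cast hD
  have hb1 := one_add_log_ge hD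
  rw [← hb] at hb1
  have hB : (20 : ℝ) ≤ 3 * (D : ℝ) ^ 2 * b := by
    have : (4 : ℝ) ≤ (D : ℝ) ^ 2 := by nlinarith
    nlinarith
  have h1 : (m : ℝ) + 1 ≤ 2 ^ m := by
    have := Nat.lt_two_pow_self (n := m)
    exact_mod_cast this
  obtain ⟨k, rfl⟩ : ∃ k, m = k + 1 := ⟨m - 1, by omega⟩
  have e : 2 * (k + 1) - 1 = 2 * k + 1 := by omega
  rw [e]
  calc ((k + 1 : ℕ) : ℝ) + 1 ≤ 2 ^ (k + 1) := h1
    _ ≤ ((12 / 25 : ℝ) ^ 2 * 20) * ((12 / 25) ^ 2 * 20 ^ 2) ^ k := by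
      rw [pow_succ, mul_comm]
      gcongr <;> norm_num
    _ = (12 / 25 : ℝ) ^ (2 * (k + 1)) * 20 ^ (2 * k + 1) := by
      rw [mul_pow, ← pow_mul, ← pow_mul]; ring
    _ ≤ _ := by gcongr

/-- The origin of 10⁷ and of the exponent 2m - 1. The squared base on the left is 9(1863/750)²D²b,
and D²b ≥ (1863/750)², so (3D²b)² dominates it m - 1 times. The remaining factor costs
360²·3·(1863/750)² < 10⁷. -/
lemma power_numeric {D m : ℕ} (hD : 2 ≤ D) (hm : 2 ≤ m) {b : ℝ} (hb : b = 1 + Real.log D) :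
    360 ^ 2 * (1863 / 250 * D * √b) ^ (2 * m) ≤
      10 ^ 7 * (3 * (D : ℝ) ^ 2 * b) ^ (2 * m - 1) := by
  have hD2 : (2 : ℝ) ≤ D := by exact_mod_cast hD
  have hb1 := one_add_log_ge hD
  rw [← hb] at hb1
  have hDb : (1863 / 750 : ℝ) ^ 2 ≤ (D : ℝ) ^ 2 * b := by
    have : (4 : ℝ) ≤ (D : ℝ) ^ 2 := by nlinarith
    nlinarith
  obtain ⟨k, rfl⟩ : ∃ k, m = k + 1 := ⟨m - 1, by omega⟩
  have e : 2 * (k + 1) - 1 = 2 * k + 1 := by omega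
  rw [e]
  have e1 : (1863 / 250 * D * √b) ^ (2 * (k + 1)) =
      (3 * (D : ℝ) ^ 2 * b) * (3 * (1863 / 750) ^ 2) *
        (9 * (1863 / 750) ^ 2 * (D ^ 2 * b)) ^ k := by
    have : (1863 / 250 * D * √b) ^ 2 = 9 * (1863 / 750) ^ 2 * (D ^ 2 * b) := by
      rw [mul_pow, Real.sq_sqrt (by linarith)]; ring
    rw [pow_mul, this, pow_succ]; ring
  have e2 : (3 * (D : ℝ) ^ 2 * b) ^ (2 * k + 1) =
      (3 * (D : ℝ) ^ 2 * b) * (9 * (D ^ 2 * b) * (D ^ 2 * b)) ^ k := by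
    rw [pow_succ, pow_mul, mul_comm]
    congr 2; ring
  rw [e1, e2]
  have h3 : (9 * (1863 / 750 : ℝ) ^ 2 * (D ^ 2 * b)) ^ k ≤
      (9 * (D ^ 2 * b) * (D ^ 2 * b)) ^ k := by gcongr
  have h4 : 0 ≤ (9 * (1863 / 750 : ℝ) ^ 2 * ((D : ℝ) ^ 2 * b)) ^ k := by positivity
  have h5 : 0 < 3 * (D : ℝ) ^ 2 * b := by positivity
  calc 360 ^ 2 * ((3 * (D : ℝ) ^ 2 * b) * (3 * (1863 / 750) ^ 2) *
        (9 * (1863 / 750) ^ 2 * (D ^ 2 * b)) ^ k)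
      = (360 ^ 2 * (3 * (1863 / 750) ^ 2)) * ((3 * (D : ℝ) ^ 2 * b) *
        (9 * (1863 / 750) ^ 2 * (D ^ 2 * b)) ^ k) := by ring
    _ ≤ 10 ^ 7 * ((3 * (D : ℝ) ^ 2 * b) * (9 * (D ^ 2 * b) * (D ^ 2 * b)) ^ k) := by
      gcongr
      norm_num

/-- The bound of `measureReal_gap_le` at `γ = 3 √b K √m √s`, simplified. -/
lemma gap_bound_eq {m : ℕ} (hm : 2 ≤ m) {D c₀ K b s ε : ℝ} (hD : 0 < D) (hε : 0 < ε) :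
    (207 / 100 * c₀ * (18 * (ε * (3 * √b * K * √m * √s))) / √m) ^ m /
        (√ε / D * (15 * ε / D) ^ (m - 1) / 24) =
      360 * √ε * ((K * c₀) ^ m * (1863 / 250 * D * √b) ^ m) * √s ^ m := by
  have hm' : (0 : ℝ) < m := by exact_mod_cast (by omega : 0 < m)
  have hsm : √(m : ℝ) ≠ 0 := (Real.sqrt_pos.2 hm').ne'
  have hsε : √ε ≠ 0 := (Real.sqrt_pos.2 hε).ne'
  obtain ⟨k, rfl⟩ : ∃ k, m = k + 1 := ⟨m - 1, by omega⟩
  rw [Nat.add_sub_cancel]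
  -- Here 2.07·18·3/15 = 1863/250. Of the m factors 15ε/D one survives the division, and
  -- 24·(15ε/D)/(√ε/D) = 360√ε.
  have e1 : 207 / 100 * c₀ * (18 * (ε * (3 * √b * K * √((k + 1 : ℕ) : ℝ) * √s))) /
      √((k + 1 : ℕ) : ℝ) = (15 * ε / D) * ((K * c₀) * (1863 / 250 * D * √b) * √s) := by
    field_simp; ring
  have h15 : (15 * ε / D) ^ k ≠ 0 := by positivity
  have hss : √ε * √ε = ε := Real.mul_self_sqrt hε.le
  have e2 : (K * c₀) ^ (k + 1) * (1863 / 250 * D * √b) ^ (k + 1) * √s ^ (k + 1) =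
      ((K * c₀) * (1863 / 250 * D * √b) * √s) ^ (k + 1) := by simp only [mul_pow]
  rw [e1, mul_assoc (360 * √ε), e2, mul_pow (15 * ε / D), pow_succ (15 * ε / D)]
  generalize ((K * c₀) * (1863 / 250 * D * √b) * √s) ^ (k + 1) = X
  rw [div_eq_iff (by positivity)]
  generalize (15 * ε / D) ^ k = Y
  field_simp
  rw [Real.sq_sqrt hε.le]
  ring

lemma ball_radii_numeric {m : ℕ} {ε D : ℝ} (hε : 0 < ε) (h : ε ≤ 1 / (10 ^ 7 * (m + 1)))
    (hD : 1 ≤ D) : ε ≤ 1 ∧ (√ε / D) ^ 2 + (15 * ε / D) ^ 2 ≤ 2 / ((m + 1 : ℕ) : ℝ) := by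
  have hm0 : (0 : ℝ) ≤ m := Nat.cast_nonneg m
  have hD2 : 1 ≤ D ^ 2 := by nlinarith
  have hε1 : ε ≤ 1 := h.trans (by rw [div_le_one (by positivity)]; linarith)
  refine ⟨hε1, ?_⟩
  have h1 : (√ε / D) ^ 2 ≤ ε := by
    rw [div_pow, Real.sq_sqrt hε.le]
    exact div_le_self hε.le hD2
  have h2 : (15 * ε / D) ^ 2 ≤ 225 * ε := by
    rw [div_pow]
    refine (div_le_self (by positivity) hD2).trans ?_
    nlinarith
  have h3 : 226 * ε ≤ 2 / ((m + 1 : ℕ) : ℝ) := by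
    push_cast
    calc 226 * ε ≤ 226 * (1 / (10 ^ 7 * (m + 1))) := by gcongr
      _ ≤ _ := by
        rw [mul_one_div, div_le_div_iff₀ (by positivity) (by positivity)]
        nlinarith
  linarith

lemma gap_numeric {D m : ℕ} (hD : 2 ≤ D) (hm : 2 ≤ m) {q b t r ε : ℝ} (hq : 0 < q)
    (hb : b = 1 + Real.log D) (ht : 1 ≤ t) (hr : 1 ≤ r)
    (hε : ε = 1 / (t * 10 ^ 7 * (q ^ (2 * m) * (3 * (D : ℝ) ^ 2 * b) ^ (2 * m - 1)) * r)) :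
    360 * √ε * (q ^ m * (1863 / 250 * D * √b) ^ m) ≤ 1 / √t := by
  have hb1 := one_add_log_ge hD
  rw [← hb] at hb1
  have hD0 : (0 : ℝ) < D := by exact_mod_cast (by omega : 0 < D)
  have hp := power_numeric hD hm hb
  generalize hY : (3 * (D : ℝ) ^ 2 * b) ^ (2 * m - 1) = Y at hε hp
  have hY0 : 0 < Y := by rw [← hY]; positivity
  have hX0 : 0 < 1863 / 250 * D * √b := by positivity
  generalize 1863 / 250 * D * √b = X at hp hX0
  have ht0 : 0 < t := by linarith
  have hr0 : 0 < r := by linarith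
  have hε0 : 0 < ε := by rw [hε]; positivity
  refine (sq_le_sq₀ (by positivity) (by positivity)).1 ?_
  calc _ = ε * q ^ (2 * m) * (360 ^ 2 * X ^ (2 * m)) := by
        rw [mul_pow, mul_pow, mul_pow, Real.sq_sqrt hε0.le]; ring
    _ ≤ ε * q ^ (2 * m) * (10 ^ 7 * Y) := by gcongr
    _ = 1 / (t * r) := by rw [hε]; field_simp
    _ ≤ 1 / t := one_div_le_one_div_of_le ht0 (by nlinarith)
    _ = (1 / √t) ^ 2 := by rw [div_pow, Real.sq_sqrt ht0.le, one_pow]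

end Numerics

/-! ### The three events behind a large condition number -/

section LargeKappa

variable {Ω : Type*} {m : ℕ} {d : Fin m → ℕ}
  {C : ∀ i : Fin m, Ω → EuclideanSpace ℝ (Exponent (m + 1) (d i))}

/-- A large condition number forces a small gap, a large value or a large norm. -/
lemma kappa_large_cases (hm : 2 ≤ m) (hd1 : ∀ i, 1 ≤ d i) {T γ : ℝ} (hT : 0 < T)
    {ω : Ω} (h : ENNReal.ofReal T ≤ randomKappa C ω) {N : ℝ} :
    (∃ u : EuclideanSpace ℝ (Fin (m + 1)), ‖u‖ = 1 ∧ γ < ‖sysEval (randomSys C ω) u‖) ∨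
    √N * γ ≤ sysNorm d (randomSys C ω) ∨
    ((∀ u : EuclideanSpace ℝ (Fin (m + 1)), ‖u‖ = 1 → ‖sysEval (randomSys C ω) u‖ ≤ γ) ∧
        ∃ p ∈ orthoPairs (m + 1), gap d (randomSys C ω) p ≤ (√N / T * γ) ^ 2) := by
  by_cases h1 : ∃ u : EuclideanSpace ℝ (Fin (m + 1)), ‖u‖ = 1 ∧
      γ < ‖sysEval (randomSys C ω) u‖
  · exact Or.inl h1
  refine Or.inr ?_
  by_cases h2 : √N * γ ≤ sysNorm d (randomSys C ω)
  · exact Or.inl h2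
  refine Or.inr ?_
  push Not at h1 h2
  refine ⟨h1, ?_⟩
  change ENNReal.ofReal T ≤ kappa d (randomSys C ω) at h
  have hW0 : 0 ≤ sysNorm d (randomSys C ω) := Real.sqrt_nonneg _
  have hW : 0 < sysNorm d (randomSys C ω) := by
    refine hW0.lt_of_ne' fun h0 => ?_
    rw [kappa_eq_zero_of_sysNorm h0, nonpos_iff_eq_zero, ENNReal.ofReal_eq_zero] at h
    linarith
  rw [randomSys, kappa_formSys rfl (by omega) hd1 _ hW] at h
  obtain ⟨p, hp, hgap⟩ := exists_minGap (d := d) (by omega : 2 ≤ m + 1) (fun i => C i ω)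
  refine ⟨p, hp, ?_⟩
  rw [randomSys, hgap]
  have h0 := minGap_nonneg (d := d) (fun i => C i ω)
  have hT' : ENNReal.ofReal T ≠ 0 := by simpa using hT
  have h3 : ENNReal.ofReal (√(minGap fun i => C i ω)) ≤
      ENNReal.ofReal (sysNorm d (formSys fun i => C i ω) / T) := by
    rw [ENNReal.ofReal_div_of_pos hT, ENNReal.le_div_iff_mul_le (Or.inl hT')
      (Or.inl ENNReal.ofReal_ne_top), mul_comm]
    exact ENNReal.mul_le_of_le_div h
  rw [ENNReal.ofReal_le_ofReal_iff (by positivity)] at h3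
  have h4 : √(minGap fun i => C i ω) ≤ √N / T * γ := by
    refine h3.trans ?_
    rw [div_mul_eq_mul_div]
    gcongr
    exact h2.le
  rw [← Real.sq_sqrt h0]
  gcongr

end LargeKappa

/-! ### The tail bound with a free scale -/

section CoreTail

variable {Ω : Type*} [MeasurableSpace Ω] {μ : Measure Ω} [IsProbabilityMeasure μ] {m : ℕ}
  {d : Fin m → ℕ} {C : ∀ i : Fin m, Ω → EuclideanSpace ℝ (Exponent (m + 1) (d i))} {K c₀ : ℝ}

lemma numCoeffs_pos (hm : 0 < m) (d : Fin m → ℕ) : 0 < numCoeffs (m + 1) d := by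
  have : Nonempty (Fin m) := ⟨⟨0, hm⟩⟩
  refine Finset.sum_pos (fun i _ => Nat.choose_pos (by omega)) Finset.univ_nonempty

lemma le_maxDeg (i : Fin m) : d i ≤ maxDeg d := Finset.le_sup (f := d) (Finset.mem_univ i)

/-- `boundM` with the number of variables written as `m + 1` and the logarithm expanded. -/
lemma boundM_succ (A K c₀ : ℝ) (d : Fin m → ℕ) (hD : 0 < maxDeg d) :
    boundM A K c₀ (m + 1) d = A * √(numCoeffs (m + 1) d) * ((K * c₀) ^ (2 * m) *
      (3 * (maxDeg d : ℝ) ^ 2 * (1 + Real.log (maxDeg d))) ^ (2 * m - 1)) *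
        √((m + 1 : ℕ) : ℝ) := by
  have hD' : (0 : ℝ) < maxDeg d := by exact_mod_cast hD
  have h1 : Real.log (Real.exp 1 * (maxDeg d : ℝ)) = 1 + Real.log (maxDeg d) := by
    rw [Real.log_mul (Real.exp_pos 1).ne' hD'.ne', Real.log_exp]
  have h2 : 2 * (m + 1) - 3 = 2 * m - 1 := by omega
  change A * √(numCoeffs (m + 1) d) * (K * c₀) ^ (2 * m) *
    (3 * (maxDeg d : ℝ) ^ 2 * Real.log (Real.exp 1 * (maxDeg d : ℝ))) ^ (2 * (m + 1) - 3) *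
      √((m + 1 : ℕ) : ℝ) = _
  rw [h1, h2]
  ring

lemma twelve_div_le_mul (hm : 0 < m) (hK : 0 < K)
    (hsg : ∀ i, SubGaussian μ (C i) K) (hsb : ∀ i, SmallBall μ (C i) c₀) :
    12 / 25 ≤ K * c₀ := by
  let i : Fin m := ⟨0, hm⟩
  have hx : ‖EuclideanSpace.single (0 : Fin (m + 1)) (1 : ℝ)‖ = 1 := by simp
  have hθ : ‖veronese (d i) (EuclideanSpace.single (0 : Fin (m + 1)) (1 : ℝ))‖ = 1 := by
    rw [norm_veronese, hx, one_pow]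
  exact subGaussian_mul_smallBall_ge hK ((hsg i).inner_tail hθ) ((hsb i).inner_ball hθ)

/-- The tail bound with a free scale `s`. -/
lemma measureReal_kappa_tail (hm : 2 ≤ m) (hC : ∀ i, Measurable (C i)) (hind : iIndepFun C μ)
    (hK : 0 < K) (hc : 0 < c₀) (hsg : ∀ i, SubGaussian μ (C i) K)
    (hsb : ∀ i, SmallBall μ (C i) c₀) (hd1 : ∀ i, 1 ≤ d i) (hD : 2 ≤ maxDeg d) {t s : ℝ}
    (ht : 1 ≤ t) (hs : 1 ≤ s)
    (hts : Real.log t ≤ 2 * m * (1 + Real.log (maxDeg d)) * s) :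
    μ.real {ω | ENNReal.ofReal (t * boundM (10 ^ 7) K c₀ (m + 1) d) ≤ randomKappa C ω} ≤
      (2 + √s ^ m) / √t := by
  have hq := twelve_div_le_mul (by omega : 0 < m) hK hsg hsb
  set D := maxDeg d with hDdef
  set b : ℝ := 1 + Real.log D with hb
  have hD0 : (0 : ℝ) < D := by exact_mod_cast (by omega : 0 < D)
  have hD2 : (2 : ℝ) ≤ D := by exact_mod_cast hD
  have hb1 := one_add_log_ge hD
  rw [← hb] at hb1
  have hm0 : (0 : ℝ) < m := by exact_mod_cast (by omega : 0 < m)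
  have hQ := scale_numeric hD hm hq hb
  set Q : ℝ := (K * c₀) ^ (2 * m) * (3 * (D : ℝ) ^ 2 * b) ^ (2 * m - 1) with hQdef
  have hN : 0 < numCoeffs (m + 1) d := numCoeffs_pos (by omega) d
  set N : ℝ := (numCoeffs (m + 1) d : ℝ) with hNdef
  have hN0 : 0 < N := by exact Nat.cast_pos.2 hN
  have hM : boundM (10 ^ 7) K c₀ (m + 1) d = 10 ^ 7 * √N * Q * √((m + 1 : ℕ) : ℝ) :=
    boundM_succ _ _ _ d (by omega)
  set r : ℝ := √((m + 1 : ℕ) : ℝ) with hr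
  have hr1 : 1 ≤ r := by
    rw [hr]; refine Real.one_le_sqrt.2 ?_
    push_cast; linarith
  have hsN : 0 < √N := Real.sqrt_pos.2 hN0
  have hQ0 : 0 < Q := by linarith
  have hM0 : 0 < boundM (10 ^ 7) K c₀ (m + 1) d := by rw [hM]; positivity
  set T : ℝ := t * boundM (10 ^ 7) K c₀ (m + 1) d with hT
  have hT0 : 0 < T := by positivity
  -- The two sub-Gaussian events then have probability at most exp(-smb), which `hts` turns into
  -- t^(-1/2).
  set γ : ℝ := 3 * √b * K * √m * √s with hγ
  have hγ0 : 0 < γ := by positivity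
  have hγ2 : γ ^ 2 = 9 * b * K ^ 2 * m * s := by
    simp only [hγ, mul_pow]
    rw [Real.sq_sqrt (by linarith), Real.sq_sqrt hm0.le, Real.sq_sqrt (by linarith)]
    norm_num
  set ε : ℝ := √N / T with hε
  have hε0 : 0 < ε := by positivity
  have hεeq : ε = 1 / (t * 10 ^ 7 * Q * r) := by
    rw [hε, hT, hM]; field_simp
  have hεle : ε ≤ 1 / (10 ^ 7 * (m + 1)) := by
    rw [hεeq]
    apply one_div_le_one_div_of_le (by positivity)
    calc (10 : ℝ) ^ 7 * (m + 1) ≤ 1 * 10 ^ 7 * Q * 1 := by linarith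
      _ ≤ _ := by gcongr
  obtain ⟨hε1, hεn⟩ := ball_radii_numeric hε0 hεle (by linarith : 1 ≤ (D : ℝ))
  have hst : 0 < √t := Real.sqrt_pos.2 (by linarith)
  have hexp : Real.exp (-(s * m * b)) ≤ 1 / √t := by
    rw [Real.exp_neg, ← one_div]
    refine one_div_le_one_div_of_le hst ?_
    calc √t = Real.exp (Real.log t / 2) := by
          rw [← Real.log_sqrt (by linarith), Real.exp_log hst]
      _ ≤ _ := Real.exp_le_exp.2 (by linarith)
  have hE1 := (measureReal_exists_lt_sysEval (by omega) hC hind hK hsg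
    (by omega : 0 < D) (fun i => le_maxDeg i) hγ0.le).trans
    (sup_tail_numeric hD hm hK hs hb hγ2)
  have hE2 := (measureReal_le_sysNorm hC hK hsg hN (a := √N * γ) (by positivity)).trans
    (norm_tail_numeric hD hm hK hN0 hs hb hγ2)
  have hE3 := measureReal_gap_le rfl hm hC hind hc hsb (by omega : 0 < D) hd1
    (fun i => le_maxDeg i) hγ0 hε0 hε1 hεn
  rw [hγ, gap_bound_eq hm hD0 hε0, ← hγ] at hE3
  have hmain : 360 * √ε * ((K * c₀) ^ m * (1863 / 250 * D * √b) ^ m) ≤ 1 / √t :=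
    gap_numeric hD hm (by positivity) hb ht hr1 hεeq
  calc μ.real {ω | ENNReal.ofReal T ≤ randomKappa C ω}
      ≤ μ.real ({ω | ∃ u : EuclideanSpace ℝ (Fin (m + 1)), ‖u‖ = 1 ∧
            γ < ‖sysEval (randomSys C ω) u‖} ∪
          ({ω | √N * γ ≤ sysNorm d (randomSys C ω)} ∪
          {ω | (∀ u : EuclideanSpace ℝ (Fin (m + 1)), ‖u‖ = 1 →
              ‖sysEval (randomSys C ω) u‖ ≤ γ) ∧
            ∃ p ∈ orthoPairs (m + 1), gap d (randomSys C ω) p ≤ (ε * γ) ^ 2})) :=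
        measureReal_mono fun ω h => kappa_large_cases hm hd1 hT0 h
    _ ≤ 1 / √t + (1 / √t + 1 / √t * √s ^ m) := by
        refine (measureReal_union_le _ _).trans (add_le_add (hE1.trans hexp) ?_)
        refine (measureReal_union_le _ _).trans (add_le_add (hE2.trans hexp) (hE3.trans ?_))
        gcongr
    _ = _ := by ring

end CoreTail

/-! ### Expectation from an exponential tail -/

section ExponentialTail

variable {Ω : Type*} [MeasurableSpace Ω] {μ : Measure Ω} [IsProbabilityMeasure μ]

/-- A real random variable that is bounded below and has an exponential upper tail is
integrable, with an explicit bound for its expectation. -/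
lemma integrable_of_exp_tail {Y : Ω → ℝ} (hY : Measurable Y) {a b : ℝ} (ha : ∀ᵐ ω ∂μ, a ≤ Y ω)
    (hb : ∀ u, 0 ≤ u → μ.real {ω | b + u ≤ Y ω} ≤ 3 * Real.exp (-(1 / 4) * u)) :
    Integrable Y μ ∧ ∫ ω, Y ω ∂μ ≤ b + 12 := by
  set Z : Ω → ℝ := fun ω => max (Y ω - b) 0 with hZ
  have hZm : Measurable Z := by fun_prop
  have hZ0 : ∀ ω, 0 ≤ Z ω := fun ω => le_max_right _ _
  have hint : IntegrableOn (fun u : ℝ => 3 * Real.exp (-(1 / 4) * u)) (Set.Ioi 0) :=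
    (exp_neg_integrableOn_Ioi 0 (by norm_num)).const_mul 3
  have hval : ∫ u in Set.Ioi (0 : ℝ), 3 * Real.exp (-(1 / 4) * u) = 12 := by
    rw [integral_const_mul, integral_exp_mul_Ioi (by norm_num)]
    norm_num
  have hle : ∫⁻ ω, ENNReal.ofReal (Z ω) ∂μ ≤ ENNReal.ofReal 12 := by
    rw [lintegral_eq_lintegral_meas_le μ (Filter.Eventually.of_forall hZ0) hZm.aemeasurable,
      ← hval, ofReal_integral_eq_lintegral_ofReal hint
        (Filter.Eventually.of_forall fun u => by positivity)]
    refine setLIntegral_mono (by fun_prop) fun u hu => ?_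
    rw [← ofReal_measureReal]
    refine ENNReal.ofReal_le_ofReal (le_trans (measureReal_mono fun ω hω => ?_) (hb u hu.le))
    simp only [Set.mem_ofPred_eq, hZ] at hω ⊢
    rcases le_max_iff.1 hω with h | h
    · linarith
    · exact absurd h (not_le.2 hu)
  have hZi : Integrable Z μ := by
    refine ⟨hZm.aestronglyMeasurable, ?_⟩
    rw [hasFiniteIntegral_iff_ofReal (Filter.Eventually.of_forall hZ0)]
    exact hle.trans_lt ENNReal.ofReal_lt_top
  have hZint : ∫ ω, Z ω ∂μ ≤ 12 := by
    rw [integral_eq_lintegral_of_nonneg_ae (Filter.Eventually.of_forall hZ0)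
      hZm.aestronglyMeasurable]
    exact ENNReal.toReal_le_of_le_ofReal (by norm_num) hle
  have hYZ : ∀ ω, Y ω ≤ b + Z ω := fun ω => by
    have := le_max_left (Y ω - b) 0
    simp only [hZ]; linarith
  have hYi : Integrable Y μ := by
    refine Integrable.mono' (g := fun ω => |a| + |b| + Z ω)
      ((integrable_const _).add hZi) hY.aestronglyMeasurable ?_
    filter_upwards [ha] with ω hω
    have h1 := hYZ ω
    have h2 := hZ0 ω
    rw [Real.norm_eq_abs, abs_le]
    constructor
    · linarith [neg_abs_le a, abs_nonneg b]
    · linarith [le_abs_self b, abs_nonneg a]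
  refine ⟨hYi, ?_⟩
  calc ∫ ω, Y ω ∂μ ≤ ∫ ω, (b + Z ω) ∂μ :=
        integral_mono hYi ((integrable_const b).add hZi) hYZ
    _ = b + ∫ ω, Z ω ∂μ := by
        rw [integral_add (integrable_const b) hZi]; simp
    _ ≤ b + 12 := by linarith

end ExponentialTail

/-! ### Measurability and a lower bound for the condition number -/

section Kappa

variable {m : ℕ} {d : Fin m → ℕ}

lemma measurable_kappa_formSys (hm : 0 < m) (hd : ∀ i, 1 ≤ d i) :
    Measurable fun c : ∀ i, EuclideanSpace ℝ (Exponent (m + 1) (d i)) =>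
      kappa d (formSys c) := by
  have hW : Continuous fun c : ∀ i, EuclideanSpace ℝ (Exponent (m + 1) (d i)) =>
      sysNorm d (formSys c) := by
    simp only [sysNorm_formSys]
    fun_prop
  have hG : Continuous fun c : ∀ i, EuclideanSpace ℝ (Exponent (m + 1) (d i)) =>
      √(minGap c) := Real.continuous_sqrt.comp continuous_minGap
  have hS : MeasurableSet {c : ∀ i, EuclideanSpace ℝ (Exponent (m + 1) (d i)) |
      sysNorm d (formSys c) = 0} := hW.measurable (measurableSet_singleton 0)
  classical
  have : (fun c : ∀ i, EuclideanSpace ℝ (Exponent (m + 1) (d i)) => kappa d (formSys c)) =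
      fun c => if sysNorm d (formSys c) = 0 then 0 else
        ENNReal.ofReal (sysNorm d (formSys c)) / ENNReal.ofReal (√(minGap c)) := by
    funext c
    split_ifs with h
    · exact kappa_eq_zero_of_sysNorm h
    · exact kappa_formSys rfl hm hd c ((Real.sqrt_nonneg _).lt_of_ne' h)
  rw [this]
  exact Measurable.ite hS measurable_const
    (hW.measurable.ennreal_ofReal.div hG.measurable.ennreal_ofReal)

/-- On the sphere ‖P‖ ≤ ‖P‖_W, so Bernstein's inequality bounds the gap by (D² + 1)‖P‖_W². This
gives positivity and bounds the logarithm from below. -/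
lemma kappa_formSys_ge (hm : 0 < m) (hd : ∀ i, 1 ≤ d i)
    (c : ∀ i, EuclideanSpace ℝ (Exponent (m + 1) (d i))) (hW : 0 < sysNorm d (formSys c)) :
    ENNReal.ofReal (1 / (maxDeg d + 1)) ≤ kappa d (formSys c) := by
  rw [kappa_formSys rfl hm hd c hW]
  set W := sysNorm d (formSys c)
  have hD : 0 < maxDeg d := lt_of_lt_of_le (hd ⟨0, hm⟩) (le_maxDeg _)
  set D := maxDeg d
  obtain ⟨p, hp, hgap⟩ := exists_minGap (d := d) (by omega : 2 ≤ m + 1) c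
  obtain ⟨hx, hy, hxy⟩ := hp
  have h1 : ‖dirDeriv (formSys c) p.1 p.2‖ ≤ D * W :=
    norm_dirDeriv_le hD (fun i => form_isHomogeneous (c i)) le_maxDeg
      (fun z hz => norm_sysEval_formSys_le c hz) hx hy hxy
  have h2 := norm_sysEval_formSys_le c hx
  have h3 : minGap c ≤ ((D + 1) * W) ^ 2 := by
    have h4 : ∑ i, dirDeriv (formSys c) p.1 p.2 i ^ 2 / d i ≤
        ‖dirDeriv (formSys c) p.1 p.2‖ ^ 2 := by
      rw [EuclideanSpace.norm_sq_eq]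
      refine Finset.sum_le_sum fun i _ => ?_
      rw [Real.norm_eq_abs, sq_abs]
      exact div_le_self (sq_nonneg _) (by exact_mod_cast hd i)
    rw [← hgap, gap]
    calc _ ≤ (D * W) ^ 2 + W ^ 2 := by
          refine add_le_add (h4.trans ?_) ?_ <;> gcongr
      _ ≤ _ := by
          have : (0 : ℝ) ≤ D * W ^ 2 := by positivity
          nlinarith
  have h5 : √(minGap c) ≤ (D + 1) * W := Real.sqrt_le_iff.2 ⟨by positivity, h3⟩
  rw [ENNReal.le_div_iff_mul_le (Or.inr (by simpa using hW)) (Or.inl ENNReal.ofReal_ne_top),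
    ← ENNReal.ofReal_mul (by positivity)]
  refine ENNReal.ofReal_le_ofReal ?_
  rw [one_div, inv_mul_le_iff₀ (by positivity)]
  exact h5

end Kappa

/-! ### The tail in both ranges and the expected logarithm -/

section RandomKappa

variable {Ω : Type*} [MeasurableSpace Ω] {μ : Measure Ω} [IsProbabilityMeasure μ] {m : ℕ}
  {d : Fin m → ℕ} {C : ∀ i : Fin m, Ω → EuclideanSpace ℝ (Exponent (m + 1) (d i))} {K c₀ : ℝ}

lemma measurable_randomKappa (hm : 0 < m) (hd : ∀ i, 1 ≤ d i) (hC : ∀ i, Measurable (C i)) :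
    Measurable (randomKappa C) :=
  (measurable_kappa_formSys hm hd).comp (measurable_pi_lambda (fun ω i => C i ω) hC)

/-- A random vector with the small ball property is almost surely nonzero. -/
lemma SmallBall.ae_ne_zero {ι : Type*} [Fintype ι] [Nonempty ι] {X : Ω → EuclideanSpace ℝ ι}
    (hX : SmallBall μ X c₀) : ∀ᵐ ω ∂μ, X ω ≠ 0 := by
  classical
  let i : ι := Classical.arbitrary ι
  have h1 : ∀ ε : ℝ, 0 < ε → μ.real {ω | X ω = 0} ≤ c₀ * ε := fun ε hε => by
    refine le_trans (measureReal_mono fun ω (hω : X ω = 0) => ?_)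
      (hX (EuclideanSpace.single i 1) (by simp) ε hε)
    simp only [Set.mem_ofPred_eq, hω, inner_zero_right, abs_zero]
    positivity
  have h2 : μ.real {ω | X ω = 0} ≤ 0 := by
    have hlim : Filter.Tendsto (fun ε : ℝ => c₀ * ε) (nhdsWithin 0 (Set.Ioi 0)) (nhds 0) := by
      have : Filter.Tendsto (fun ε : ℝ => c₀ * ε) (nhds 0) (nhds (c₀ * 0)) :=
        (continuous_const_mul c₀).tendsto 0
      rw [mul_zero] at this
      exact this.mono_left nhdsWithin_le_nhds
    exact ge_of_tendsto hlim (eventually_nhdsWithin_of_forall fun ε hε => h1 ε hε)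
  have h3 : μ {ω | X ω = 0} = 0 :=
    (measureReal_eq_zero_iff).1 (le_antisymm h2 measureReal_nonneg)
  rw [ae_iff]
  simpa using h3

lemma ae_kappa_ge (hm : 0 < m) (hd : ∀ i, 1 ≤ d i) (hsb : ∀ i, SmallBall μ (C i) c₀) :
    ∀ᵐ ω ∂μ, ENNReal.ofReal (1 / (maxDeg d + 1)) ≤ randomKappa C ω := by
  let i : Fin m := ⟨0, hm⟩
  have : Nonempty (Exponent (m + 1) (d i)) := by
    refine Fintype.card_pos_iff.1 ?_
    rw [Fintype.card_coe, Finset.card_finsuppAntidiag_nat_eq_choose, Finset.card_univ,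
      Fintype.card_fin]
    exact Nat.choose_pos (by omega)
  filter_upwards [(hsb i).ae_ne_zero] with ω hω
  refine kappa_formSys_ge hm hd _ ?_
  rw [sysNorm_formSys]
  refine Real.sqrt_pos.2 (Finset.sum_pos' (fun j _ => sq_nonneg _) ⟨i, Finset.mem_univ _, ?_⟩)
  exact pow_pos (norm_pos_iff.2 hω) 2

lemma log_threshold (hD : 0 < maxDeg d) : Real.log (threshold (m + 1) d) =
    2 * m * (1 + Real.log (maxDeg d)) := by
  have hD' : (0 : ℝ) < maxDeg d := by exact_mod_cast hD
  change Real.log ((Real.exp 1 * (maxDeg d : ℝ)) ^ (2 * m)) = _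
  rw [Real.log_pow, Real.log_mul (Real.exp_pos 1).ne' hD'.ne', Real.log_exp]
  push_cast; ring

lemma one_le_threshold (hD : 0 < maxDeg d) : 1 ≤ threshold (m + 1) d := by
  have hD' : (1 : ℝ) ≤ maxDeg d := by exact_mod_cast hD
  have := Real.add_one_le_exp (1 : ℝ)
  exact one_le_pow₀ (by nlinarith)

lemma measureReal_kappa_tail_mid (hm : 2 ≤ m) (hC : ∀ i, Measurable (C i))
    (hind : iIndepFun C μ) (hK : 0 < K) (hc : 0 < c₀) (hsg : ∀ i, SubGaussian μ (C i) K)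
    (hsb : ∀ i, SmallBall μ (C i) c₀) (hd1 : ∀ i, 1 ≤ d i) (hD : 2 ≤ maxDeg d) {t : ℝ}
    (ht : 1 ≤ t) (ht' : t ≤ threshold (m + 1) d) :
    μ.real {ω | ENNReal.ofReal (t * boundM (10 ^ 7) K c₀ (m + 1) d) ≤ randomKappa C ω} ≤
      3 * t ^ (-(1 / 2) : ℝ) := by
  have hts := Real.log_le_log (by linarith) ht'
  rw [log_threshold (by omega)] at hts
  refine (measureReal_kappa_tail hm hC hind hK hc hsg hsb hd1 hD ht le_rfl (by linarith)).trans
    (le_of_eq ?_)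
  rw [Real.sqrt_one, one_pow, Real.rpow_neg (by linarith), ← Real.sqrt_eq_rpow]
  ring

/-- The scale solves log t = 2mbs, hence log(t/threshold) = 2mb(s - 1). Then s ≤ e^{s-1} bounds √s^m
by (t/threshold)^(1/(4b)). This factor is at least 1 and so absorbs the constant 2 as well. -/
lemma measureReal_kappa_tail_high (hm : 2 ≤ m) (hC : ∀ i, Measurable (C i))
    (hind : iIndepFun C μ) (hK : 0 < K) (hc : 0 < c₀) (hsg : ∀ i, SubGaussian μ (C i) K)
    (hsb : ∀ i, SmallBall μ (C i) c₀) (hd1 : ∀ i, 1 ≤ d i) (hD : 2 ≤ maxDeg d) {t : ℝ}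
    (ht : threshold (m + 1) d ≤ t) :
    μ.real {ω | ENNReal.ofReal (t * boundM (10 ^ 7) K c₀ (m + 1) d) ≤ randomKappa C ω} ≤
      3 * t ^ (-(1 / 2) : ℝ) * (t / threshold (m + 1) d) ^
        (1 / (4 * Real.log (Real.exp 1 * (maxDeg d : ℝ)))) := by
  have hD' : (0 : ℝ) < maxDeg d := by exact_mod_cast (by omega : 0 < maxDeg d)
  have hb : Real.log (Real.exp 1 * (maxDeg d : ℝ)) = 1 + Real.log (maxDeg d) := by
    rw [Real.log_mul (Real.exp_pos 1).ne' hD'.ne', Real.log_exp]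
  have hb1 := one_add_log_ge hD
  have hthr := one_le_threshold (m := m) (d := d) (by omega)
  have hlog := log_threshold (m := m) (d := d) (by omega)
  rw [hb]
  set b := 1 + Real.log (maxDeg d) with hbdef
  set thr := threshold (m + 1) d with hthrdef
  have hm0 : (0 : ℝ) < m := by exact_mod_cast (by omega : 0 < m)
  have ht1 : 1 ≤ t := hthr.trans ht
  set s : ℝ := Real.log t / (2 * m * b) with hs
  have hs1 : 1 ≤ s := by
    rw [hs, one_le_div (by positivity), ← hlog]
    exact Real.log_le_log (by linarith) ht
  have hts : 2 * m * b * s = Real.log t := by rw [hs]; field_simp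
  refine (measureReal_kappa_tail hm hC hind hK hc hsg hsb hd1 hD ht1 hs1 hts.ge).trans ?_
  have h1 : √s ^ m ≤ (t / thr) ^ (1 / (4 * b)) := by
    rw [Real.rpow_def_of_pos (by positivity), Real.log_div (by linarith) (by linarith), hlog,
      ← hts]
    calc √s ^ m ≤ Real.exp ((s - 1) / 2) ^ m := by
          gcongr
          refine Real.sqrt_le_iff.2 ⟨(Real.exp_pos _).le, ?_⟩
          rw [← Real.exp_nat_mul]
          have := Real.add_one_le_exp (s - 1)
          calc s ≤ Real.exp (s - 1) := by linarith
            _ = _ := by congr 1; push_cast; ring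
      _ = _ := by
          rw [← Real.exp_nat_mul]
          congr 1
          field_simp
          ring
  have h2 : 1 ≤ (t / thr) ^ (1 / (4 * b)) :=
    Real.one_le_rpow ((one_le_div (by linarith)).2 ht) (by positivity)
  rw [Real.rpow_neg (by linarith), ← Real.sqrt_eq_rpow, div_eq_mul_inv, mul_comm, mul_comm 3,
    mul_assoc]
  gcongr
  linarith

/-- A tail bound that holds on the whole range. -/
lemma measureReal_kappa_tail_exp (hm : 2 ≤ m) (hC : ∀ i, Measurable (C i))
    (hind : iIndepFun C μ) (hK : 0 < K) (hc : 0 < c₀) (hsg : ∀ i, SubGaussian μ (C i) K)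
    (hsb : ∀ i, SmallBall μ (C i) c₀) (hd1 : ∀ i, 1 ≤ d i) (hD : 2 ≤ maxDeg d) {u : ℝ}
    (hu : 0 ≤ u) :
    μ.real {ω | ENNReal.ofReal (Real.exp u * boundM (10 ^ 7) K c₀ (m + 1) d) ≤
      randomKappa C ω} ≤ 3 * Real.exp (-(1 / 4) * u) := by
  have ht : 1 ≤ Real.exp u := Real.one_le_exp hu
  have hpow : Real.exp u ^ (-(1 / 2) : ℝ) = Real.exp (-(1 / 2) * u) := by
    rw [← Real.exp_mul, mul_comm]
  rcases le_total (Real.exp u) (threshold (m + 1) d) with h | h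
  · refine (measureReal_kappa_tail_mid hm hC hind hK hc hsg hsb hd1 hD ht h).trans ?_
    rw [hpow]
    gcongr
    linarith
  · refine (measureReal_kappa_tail_high hm hC hind hK hc hsg hsb hd1 hD h).trans ?_
    have hD' : (0 : ℝ) < maxDeg d := by exact_mod_cast (by omega : 0 < maxDeg d)
    rw [hpow, Real.log_mul (Real.exp_pos 1).ne' hD'.ne', Real.log_exp]
    have hb1 := one_add_log_ge hD
    have hthr := one_le_threshold (m := m) (d := d) (by omega)
    -- Since b ≥ 1, the correction factor costs at most e^{u/4} out of the decay e^{-u/2}.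
    have h1 : (Real.exp u / threshold (m + 1) d) ^ (1 / (4 * (1 + Real.log (maxDeg d)))) ≤
        Real.exp (1 / 4 * u) := by
      calc _ ≤ Real.exp u ^ (1 / (4 * (1 + Real.log (maxDeg d)))) := by
            gcongr
            exact div_le_self (Real.exp_pos u).le hthr
        _ ≤ Real.exp u ^ (1 / 4 : ℝ) := by
            refine Real.rpow_le_rpow_of_exponent_le ht ?_
            exact one_div_le_one_div_of_le (by norm_num) (by linarith)
        _ = _ := by rw [← Real.exp_mul, mul_comm]
    calc _ ≤ 3 * Real.exp (-(1 / 2) * u) * Real.exp (1 / 4 * u) := by gcongr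
      _ = _ := by rw [mul_assoc, ← Real.exp_add]; congr 2; ring

lemma ae_kappa_ne_top (hm : 2 ≤ m) (hC : ∀ i, Measurable (C i))
    (hind : iIndepFun C μ) (hK : 0 < K) (hc : 0 < c₀) (hsg : ∀ i, SubGaussian μ (C i) K)
    (hsb : ∀ i, SmallBall μ (C i) c₀) (hd1 : ∀ i, 1 ≤ d i) (hD : 2 ≤ maxDeg d) :
    ∀ᵐ ω ∂μ, randomKappa C ω ≠ ∞ := by
  have h1 : ∀ u : ℝ, 0 ≤ u →
      μ.real {ω | randomKappa C ω = ∞} ≤ 3 * Real.exp (-(1 / 4) * u) := fun u hu => by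
    refine le_trans (measureReal_mono fun ω (hω : randomKappa C ω = ∞) => ?_)
      (measureReal_kappa_tail_exp hm hC hind hK hc hsg hsb hd1 hD hu)
    simp only [Set.mem_ofPred_eq, hω, le_top]
  have h2 : μ.real {ω | randomKappa C ω = ∞} ≤ 0 := by
    have hlim : Filter.Tendsto (fun u : ℝ => 3 * Real.exp (-(1 / 4) * u)) Filter.atTop
        (nhds (3 * 0)) :=
      (Real.tendsto_exp_atBot.comp
        (Filter.tendsto_id.const_mul_atTop_of_neg (by norm_num))).const_mul 3
    rw [mul_zero] at hlim
    exact ge_of_tendsto hlim ((Filter.eventually_ge_atTop 0).mono h1)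
  have h3 : μ {ω | randomKappa C ω = ∞} = 0 :=
    (measureReal_eq_zero_iff).1 (le_antisymm h2 measureReal_nonneg)
  rw [ae_iff]
  simpa using h3

lemma boundM_pos (hK : 0 < K) (hc : 0 < c₀) (hm : 0 < m) (hD : 2 ≤ maxDeg d) :
    0 < boundM (10 ^ 7) K c₀ (m + 1) d := by
  have hD' : (0 : ℝ) < maxDeg d := by exact_mod_cast (by omega : 0 < maxDeg d)
  have hN : (0 : ℝ) < numCoeffs (m + 1) d := Nat.cast_pos.2 (numCoeffs_pos hm d)
  have hb1 := one_add_log_ge hD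
  rw [boundM_succ _ _ _ d (by omega)]
  positivity

lemma integrable_log_randomKappa (hm : 2 ≤ m) (hC : ∀ i, Measurable (C i))
    (hind : iIndepFun C μ) (hK : 0 < K) (hc : 0 < c₀) (hsg : ∀ i, SubGaussian μ (C i) K)
    (hsb : ∀ i, SmallBall μ (C i) c₀) (hd1 : ∀ i, 1 ≤ d i) (hD : 2 ≤ maxDeg d) :
    Integrable (fun ω => Real.log (randomKappa C ω).toReal) μ ∧
      ∫ ω, Real.log (randomKappa C ω).toReal ∂μ ≤
        Real.log (boundM (10 ^ 7) K c₀ (m + 1) d) + 12 := by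
  have htop := ae_kappa_ne_top hm hC hind hK hc hsg hsb hd1 hD
  have hge := ae_kappa_ge (by omega : 0 < m) hd1 hsb
  have hM := boundM_pos (d := d) hK hc (by omega : 0 < m) hD
  set M := boundM (10 ^ 7) K c₀ (m + 1) d
  -- Almost surely the value is positive and finite, so the convention that the logarithm of
  -- `toReal` is 0 at the values 0 and ∞ plays no role.
  have hlow : ∀ᵐ ω ∂μ, (1 / (maxDeg d + 1) : ℝ) ≤ (randomKappa C ω).toReal := by
    filter_upwards [htop, hge] with ω h1 h2
    exact (ENNReal.ofReal_le_iff_le_toReal h1).1 h2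
  refine integrable_of_exp_tail (a := Real.log (1 / (maxDeg d + 1)))
    (Real.measurable_log.comp
      (measurable_randomKappa (by omega : 0 < m) hd1 hC).ennreal_toReal) ?_ fun u hu => ?_
  · filter_upwards [hlow] with ω h
    exact Real.log_le_log (by positivity) h
  · refine le_trans ?_ (measureReal_kappa_tail_exp hm hC hind hK hc hsg hsb hd1 hD hu)
    refine ENNReal.toReal_mono (measure_ne_top _ _) (measure_mono_ae ?_)
    filter_upwards [htop, hlow] with ω h1 h2 (h3 : Real.log M + u ≤ _)
    have h0 : 0 < (randomKappa C ω).toReal := lt_of_lt_of_le (by positivity) h2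
    change ENNReal.ofReal (Real.exp u * M) ≤ randomKappa C ω
    rw [ENNReal.ofReal_le_iff_le_toReal h1, ← Real.exp_log h0]
    calc Real.exp u * M = Real.exp (Real.log M + u) := by
          rw [Real.exp_add, Real.exp_log hM, mul_comm]
      _ ≤ _ := Real.exp_le_exp.2 h3

end RandomKappa

end RandomSystem

theorem corollary1p3 :
    ∃ A : ℝ, 0 < A ∧
      ∀ (n : ℕ) (_ : 3 ≤ n) (d : Fin (n - 1) → ℕ) (_ : ∀ i, 1 ≤ d i)
        (_ : 2 ≤ RandomSystem.maxDeg d)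
        (Ω : Type*) [MeasurableSpace Ω] (μ : Measure Ω) [IsProbabilityMeasure μ]
        (C : ∀ i : Fin (n - 1), Ω → EuclideanSpace ℝ (RandomSystem.Exponent n (d i)))
        (_ : ∀ i, Measurable (C i)) (_ : iIndepFun C μ)
        (K c₀ : ℝ) (_ : 0 < K) (_ : 0 < c₀)
        (_ : ∀ i, RandomSystem.Centered μ (C i))
        (_ : ∀ i, RandomSystem.SubGaussian μ (C i) K)
        (_ : ∀ i, RandomSystem.SmallBall μ (C i) c₀),
        (∀ t : ℝ, 1 ≤ t → t ≤ RandomSystem.threshold n d →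
          μ.real {ω | ENNReal.ofReal (t * RandomSystem.boundM A K c₀ n d) ≤
              RandomSystem.randomKappa C ω} ≤ 3 * t ^ (-(1 / 2) : ℝ)) ∧
        (∀ t : ℝ, RandomSystem.threshold n d ≤ t →
          μ.real {ω | ENNReal.ofReal (t * RandomSystem.boundM A K c₀ n d) ≤
              RandomSystem.randomKappa C ω} ≤
            3 * t ^ (-(1 / 2) : ℝ) *
              (t / RandomSystem.threshold n d) ^
                (1 / (4 * Real.log (Real.exp 1 * (RandomSystem.maxDeg d : ℝ))))) ∧
        (∀ᵐ ω ∂μ, RandomSystem.randomKappa C ω ≠ 0 ∧ RandomSystem.randomKappa C ω ≠ ∞) ∧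
        Integrable (fun ω => Real.log (RandomSystem.randomKappa C ω).toReal) μ ∧
        ∫ ω, Real.log (RandomSystem.randomKappa C ω).toReal ∂μ ≤
          1 + Real.log (RandomSystem.boundM A K c₀ n d) := by
  -- The tail estimates hold with 10⁷. Since the expectation bound there is log M + 12, with 12 = ∫
  -- 3e^{-u/4} du over u > 0, the factor e¹¹ moves all but 1 of it into log M.
  refine ⟨Real.exp 11 * 10 ^ 7, by positivity, ?_⟩
  intro n hn d hd1 hD Ω _ μ _ C hC hind K c₀ hK hc _ hsg hsb
  obtain ⟨m, rfl⟩ : ∃ m, n = m + 1 := ⟨n - 1, by omega⟩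
  have hm : 2 ≤ m := by omega
  change Fin m → ℕ at d
  have hM0 := RandomSystem.boundM_pos (d := d) hK hc (by omega : 0 < m) hD
  have hM : RandomSystem.boundM (Real.exp 11 * 10 ^ 7) K c₀ (m + 1) d =
      Real.exp 11 * RandomSystem.boundM (10 ^ 7) K c₀ (m + 1) d := by
    simp only [RandomSystem.boundM]; ring
  have hle : RandomSystem.boundM (10 ^ 7) K c₀ (m + 1) d ≤
      RandomSystem.boundM (Real.exp 11 * 10 ^ 7) K c₀ (m + 1) d := by
    rw [hM]
    exact le_mul_of_one_le_left hM0.le (Real.one_le_exp (by norm_num))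
  have hmono : ∀ t : ℝ, 0 ≤ t →
      μ.real {ω | ENNReal.ofReal (t * RandomSystem.boundM (Real.exp 11 * 10 ^ 7) K c₀ (m + 1) d) ≤
        RandomSystem.randomKappa C ω} ≤
      μ.real {ω | ENNReal.ofReal (t * RandomSystem.boundM (10 ^ 7) K c₀ (m + 1) d) ≤
        RandomSystem.randomKappa C ω} := fun t ht =>
    measureReal_mono fun ω h =>
      (ENNReal.ofReal_le_ofReal (mul_le_mul_of_nonneg_left hle ht)).trans h
  refine ⟨fun t ht ht' => (hmono t (by linarith)).trans
    (RandomSystem.measureReal_kappa_tail_mid hm hC hind hK hc hsg hsb hd1 hD ht ht'),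
    fun t ht => ?_, ?_, ?_⟩
  · have hthr := RandomSystem.one_le_threshold (m := m) (d := d) (by omega)
    exact (hmono t (zero_le_one.trans (hthr.trans ht))).trans
      (RandomSystem.measureReal_kappa_tail_high hm hC hind hK hc hsg hsb hd1 hD ht)
  · filter_upwards [RandomSystem.ae_kappa_ne_top hm hC hind hK hc hsg hsb hd1 hD,
      RandomSystem.ae_kappa_ge (by omega : 0 < m) hd1 hsb] with ω h1 h2
    refine ⟨?_, h1⟩
    exact ((ENNReal.ofReal_pos.2 (by positivity)).trans_le h2).ne'
  · obtain ⟨h1, h2⟩ :=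
      RandomSystem.integrable_log_randomKappa hm hC hind hK hc hsg hsb hd1 hD
    refine ⟨h1, h2.trans ?_⟩
    rw [hM, Real.log_mul (Real.exp_pos 11).ne' hM0.ne', Real.log_exp]
    linarith
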